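/- Let $d\in\mathbb N$ and $1\le p,q<\infty$. Let $w:\mathbb R^{2d}\to[0,\infty)$ be a locally integrable function, not identically zero, that is submultiplicative, i.e. $w(x+y)\le w(x)w(y)$ for all $x,y\in\mathbb R^{2d}$, and polynomially moderate, i.e. there are $s\in\mathbb R$ and a constant $C$ such that $w(x+y)\le C\,v_s(x)\,w(y)$ for all $x,y\in\mathbb R^{2d}$, where $v_s(x,\xi)=(1+|x|^2+|\xi|^2)^{s/2}$. Let $g\in\mathcal S(\mathbb R^d)$, $g\ne0$, and for $f\in\mathcal S'(\mathbb R^d)$ let $V_gf(x,\xi)=\int_{\mathbb R^d}f(t)\,\overline{g(t-x)}\,e^{-i t\cdot\xi}\,dt$ (in the sense of distributions) be its short-time Fourier transform. Let $\mathcal M^{p,q}_w(\mathbb R^d)$ be the space of all $f\in\mathcal S'(\mathbb R^d)$ with $$\|f\|_{\mathcal M^{p,q}_w}=\left(\int_{\mathbb R^d}\left(\int_{\mathbb R^d}|V_gf(x,\xi)|^p\,w(x,\xi)^p\,dx\right)^{q/p}d\xi\right)^{1/q}<\infty ,$$ and let $\mathcal W^{p,q}_w(\mathbb R^d)$ be the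 space of all $f\in\mathcal S'(\mathbb R^d)$ with $$\|f\|_{\mathcal W^{p,q}_w}=\left(\int_{\mathbb R^d}\left(\int_{\mathbb R^d}|V_gf(x,\xi)|^q\,w(x,\xi)^q\,d\xi\right)^{p/q}dx\right)^{1/p}<\infty .$$ Then the modulation space $\mathcal M^{p,q}_w(\mathbb R^d)$ and the Wiener amalgam space $\mathcal W^{p,q}_w(\mathbb R^d)$, with these norms, are Banach spaces with the metric approximation property. (A Banach space $B$ has the metric approximation property if for every compact $K\subset B$ and every $\varepsilon>0$ there is a bounded finite rank linear operator $F:B\to B$ with $\|F\|\le1$ and $\|x-Fx\|<\varepsilon$ for all $x\in K$.) -/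

import Mathlib

open MeasureTheory
open scoped SchwartzMap ENNReal ComplexConjugate

noncomputable section

/-- The Euclidean space `ℝᵈ`. -/
abbrev Rd (d : ℕ) : Type := EuclideanSpace ℝ (Fin d)

/-! ### The metric approximation property -/

/-- Every compact set is approximated, up to any `ε > 0`, by a bounded finite rank operator of
operator norm at most `1`. -/
def MetricApproximationProperty (X : Type*) [SeminormedAddCommGroup X] [NormedSpace ℂ X] : Prop :=
  ∀ K : Set X, IsCompact K → ∀ ε : ℝ, 0 < ε →
    ∃ F : X →L[ℂ] X, FiniteDimensional ℂ (LinearMap.range (F : X →ₗ[ℂ] X)) ∧ ‖F‖ ≤ 1 ∧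
      ∀ x ∈ K, ‖x - F x‖ < ε

/-! ### Weights on `ℝ²ᵈ = ℝᵈ × ℝᵈ` -/

/-- A weight function: non-negative and locally integrable. -/
def IsWeight {d : ℕ} (w : Rd d × Rd d → ℝ) : Prop :=
  (∀ z, 0 ≤ w z) ∧ LocallyIntegrable w volume

/-- `w (x + y) ≤ w x * w y`. -/
def IsSubmultiplicative {d : ℕ} (w : Rd d × Rd d → ℝ) : Prop :=
  ∀ x y, w (x + y) ≤ w x * w y

/-- `w` is `v`-moderate: `w (x + y) ≤ C v(x) w(y)` for a constant `C`. -/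
def IsModerate {d : ℕ} (v w : Rd d × Rd d → ℝ) : Prop :=
  ∃ C : ℝ, ∀ x y, w (x + y) ≤ C * v x * w y

/-- The polynomial weight `v_s(x, ξ) = (1 + |x|² + |ξ|²)^(s/2)`. -/
def polyWeight {d : ℕ} (s : ℝ) (z : Rd d × Rd d) : ℝ :=
  (1 + ‖z.1‖ ^ 2 + ‖z.2‖ ^ 2) ^ (s / 2)

/-- `w` is polynomially moderate: it is `v_s`-moderate for some `s`. -/
def IsPolynomiallyModerate {d : ℕ} (w : Rd d × Rd d → ℝ) : Prop :=
  ∃ s : ℝ, IsModerate (polyWeight s) w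

/-! ### Mixed-norm Lebesgue spaces on `ℝᵈ × ℝᵈ` -/

/-- The `L^{(p,q)}` norm, with exponent `p` in the first (inner) variable and `q` in the second
(outer) one: `(∫ (∫ |F(x, ξ)|^p dx)^{q/p} dξ)^{1/q}`, as an extended non-negative number. -/
def mixedNorm {d : ℕ} (p q : ℝ) (F : Rd d × Rd d → ℂ) : ℝ≥0∞ :=
  (∫⁻ ξ, (∫⁻ x, ‖F (x, ξ)‖ₑ ^ p) ^ (q / p)) ^ (1 / q)

lemma mixedNorm_add_le {d : ℕ} {p q : ℝ} (hp : 1 ≤ p) (hq : 1 ≤ q) {F G : Rd d × Rd d → ℂ}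
    (hF : AEStronglyMeasurable F volume) (hG : AEStronglyMeasurable G volume) :
    mixedNorm p q (F + G) ≤ mixedNorm p q F + mixedNorm p q G := by
  have hp0 : 0 < p := by linarith
  have hq0 : 0 < q := by linarith
  have key (H : Rd d × Rd d → ℂ) : mixedNorm p q H =
      (∫⁻ ξ, ((∫⁻ x, ‖H (x, ξ)‖ₑ ^ p) ^ (1 / p)) ^ q) ^ (1 / q) := by
    unfold mixedNorm
    congr 1
    refine lintegral_congr fun ξ => ?_
    rw [← ENNReal.rpow_mul]
    congr 1
    field_simp
  have sec {H : Rd d × Rd d → ℂ} (hH : AEStronglyMeasurable H volume) :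
      ∀ᵐ ξ : Rd d, AEStronglyMeasurable (fun x : Rd d => H (x, ξ)) volume := by
    have h1 : AEStronglyMeasurable (fun z : Rd d × Rd d => H z.swap)
        ((volume : Measure (Rd d)).prod (volume : Measure (Rd d))) :=
      AEStronglyMeasurable.prod_swap hH
    exact h1.prodMk_left
  have outer {H : Rd d × Rd d → ℂ} (hH : AEStronglyMeasurable H volume) :
      AEMeasurable (fun ξ : Rd d => (∫⁻ x, ‖H (x, ξ)‖ₑ ^ p) ^ (1 / p)) volume := by
    have h1 : AEMeasurable (fun z : Rd d × Rd d => ‖H z‖ₑ ^ p)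
        ((volume : Measure (Rd d)).prod (volume : Measure (Rd d))) :=
      hH.enorm.pow_const p
    exact (h1.lintegral_prod_left' ).pow_const _
  rw [key, key, key]
  refine le_trans ?_ (ENNReal.lintegral_Lp_add_le (outer hF) (outer hG) hq)
  gcongr ?_ ^ _
  refine lintegral_mono_ae ?_
  filter_upwards [sec hF, sec hG] with ξ h1 h2
  refine ENNReal.rpow_le_rpow ?_ hq0.le
  refine le_trans ?_ (ENNReal.lintegral_Lp_add_le h1.enorm h2.enorm hp)
  gcongr with x
  exact enorm_add_le _ _

lemma mixedNorm_smul {d : ℕ} {p q : ℝ} (hp : 1 ≤ p) (hq : 1 ≤ q) (c : ℂ) (F : Rd d × Rd d → ℂ) :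
    mixedNorm p q (c • F) = ‖c‖ₑ * mixedNorm p q F := by
  have hp0 : 0 < p := by linarith
  have hq0 : 0 < q := by linarith
  have h1 : ‖c‖ₑ ^ p ≠ ∞ := ENNReal.rpow_ne_top_of_nonneg hp0.le enorm_ne_top
  have h2 : (‖c‖ₑ ^ p) ^ (q / p) ≠ ∞ := ENNReal.rpow_ne_top_of_nonneg (by positivity) h1
  unfold mixedNorm
  simp only [Pi.smul_apply, enorm_smul, ENNReal.mul_rpow_of_nonneg _ _ hp0.le]
  simp only [lintegral_const_mul' _ _ h1,
    ENNReal.mul_rpow_of_nonneg _ _ (show 0 ≤ q / p by positivity)]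
  rw [lintegral_const_mul' _ _ h2, ENNReal.mul_rpow_of_nonneg _ _ (show 0 ≤ 1 / q by positivity)]
  congr 1
  rw [← ENNReal.rpow_mul, ← ENNReal.rpow_mul]
  convert ENNReal.rpow_one _ using 2
  field_simp

lemma mixedNorm_zero {d : ℕ} {p q : ℝ} (hp : 1 ≤ p) (hq : 1 ≤ q) :
    mixedNorm p q (0 : Rd d × Rd d → ℂ) = 0 := by
  simpa using mixedNorm_smul hp hq 0 (0 : Rd d × Rd d → ℂ)

/-- The space of measurable functions with finite `L^{(p,q)}` norm. -/
def mixedLp (d : ℕ) (p q : ℝ) [hp : Fact (1 ≤ p)] [hq : Fact (1 ≤ q)] :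
    Submodule ℂ (Rd d × Rd d → ℂ) where
  carrier := {F | AEStronglyMeasurable F volume ∧ mixedNorm p q F < ∞}
  add_mem' := fun hF hG => ⟨hF.1.add hG.1,
    (mixedNorm_add_le hp.out hq.out hF.1 hG.1).trans_lt (ENNReal.add_lt_top.2 ⟨hF.2, hG.2⟩)⟩
  zero_mem' := ⟨aestronglyMeasurable_const, by simp [mixedNorm_zero hp.out hq.out]⟩
  smul_mem' := fun c F hF => ⟨hF.1.const_smul c, by
    rw [mixedNorm_smul hp.out hq.out]; exact ENNReal.mul_lt_top enorm_lt_top hF.2⟩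

/-- The `L^{(p,q)}` norm on the functions for which it is finite. -/
def mixedSeminorm (d : ℕ) (p q : ℝ) [hp : Fact (1 ≤ p)] [hq : Fact (1 ≤ q)] :
    Seminorm ℂ (mixedLp d p q) :=
  Seminorm.of (fun F => (mixedNorm p q (F : Rd d × Rd d → ℂ)).toReal)
    (fun F G => by
      rw [← ENNReal.toReal_add F.2.2.ne G.2.2.ne]
      exact ENNReal.toReal_mono (ENNReal.add_ne_top.2 ⟨F.2.2.ne, G.2.2.ne⟩)
        (mixedNorm_add_le hp.out hq.out F.2.1 G.2.1))
    (fun c F => by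
      have h := mixedNorm_smul hp.out hq.out c (F : Rd d × Rd d → ℂ)
      simp only [Submodule.coe_smul, h, ENNReal.toReal_mul, toReal_enorm])

/-! ### The short-time Fourier transform -/

lemma hasTemperateGrowth_cexp : (fun r : ℝ => Complex.exp (-(r * Complex.I))).HasTemperateGrowth := by
  have h (n : ℕ) : iteratedDeriv n (fun r : ℝ => Complex.exp (-(r * Complex.I))) =
      fun r : ℝ => (-Complex.I) ^ n * Complex.exp (-(r * Complex.I)) := by
    induction n with
    | zero => simp
    | succ n ih =>
      rw [iteratedDeriv_succ, ih]
      funext r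
      have h0 : HasDerivAt (fun r : ℝ => (r : ℂ)) 1 r := Complex.ofRealCLM.hasDerivAt
      have h1 := ((h0.mul_const Complex.I).neg.cexp.const_mul ((-Complex.I) ^ n)).deriv
      refine h1.trans ?_
      simp only [Pi.neg_apply]
      ring
  have h2 : ContDiff ℝ (⊤ : ℕ∞) (fun r : ℝ => (r : ℂ)) := Complex.ofRealCLM.contDiff
  refine ⟨(h2.mul contDiff_const).neg.cexp, fun n => ⟨0, 1, fun r => ?_⟩⟩
  rw [norm_iteratedFDeriv_eq_norm_iteratedDeriv, h]
  simp [Complex.norm_exp]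

/-- The character `t ↦ e^{-i t·ξ}`. -/
def character {d : ℕ} (ξ : Rd d) (t : Rd d) : ℂ :=
  Complex.exp (-((inner ℝ t ξ : ℝ) * Complex.I))

lemma hasTemperateGrowth_character {d : ℕ} (ξ : Rd d) : (character ξ).HasTemperateGrowth :=
  hasTemperateGrowth_cexp.comp (Function.hasTemperateGrowth_inner_left ξ)

/-- The Schwartz function `t ↦ e^{-i t·ξ} conj (g (t - x))`. -/
def stftAtom {d : ℕ} (g : 𝓢(Rd d, ℂ)) (x ξ : Rd d) : 𝓢(Rd d, ℂ) :=
  SchwartzMap.smulLeftCLM ℂ (character ξ)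
    (SchwartzMap.compSubConstCLM ℝ x
      (SchwartzMap.postcompCLM (𝕜 := ℝ) (Complex.conjCLE : ℂ →L[ℝ] ℂ) g))

lemma stftAtom_apply {d : ℕ} (g : 𝓢(Rd d, ℂ)) (x ξ t : Rd d) :
    stftAtom g x ξ t = Complex.exp (-((inner ℝ t ξ : ℝ) * Complex.I)) * conj (g (t - x)) := by
  simp [stftAtom, SchwartzMap.smulLeftCLM_apply_apply (hasTemperateGrowth_character ξ), character]

/-- The short-time Fourier transform `V_g f (x, ξ)` of a tempered distribution `f` with respect to
the window `g`, that is `∫ f(t) conj (g (t - x)) e^{-i t·ξ} dt` in the sense of distributions. -/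
def stft {d : ℕ} (g : 𝓢(Rd d, ℂ)) (f : 𝓢'(Rd d, ℂ)) (z : Rd d × Rd d) : ℂ :=
  f (stftAtom g z.1 z.2)

/-- The linear map `f ↦ V_g f · w`. -/
def weightedStft {d : ℕ} (w : Rd d × Rd d → ℝ) (g : 𝓢(Rd d, ℂ)) :
    𝓢'(Rd d, ℂ) →ₗ[ℂ] (Rd d × Rd d → ℂ) where
  toFun f := fun z => stft g f z * (w z : ℂ)
  map_add' f f' := by
    funext z
    exact add_mul (f (stftAtom g z.1 z.2)) (f' (stftAtom g z.1 z.2)) _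
  map_smul' c f := by
    funext z
    exact mul_assoc c (f (stftAtom g z.1 z.2)) _

/-- The coordinate flip `F ↦ ((x, ξ) ↦ F (ξ, x))`. -/
def flipMap (d : ℕ) : (Rd d × Rd d → ℂ) →ₗ[ℂ] (Rd d × Rd d → ℂ) :=
  LinearMap.funLeft ℂ ℂ Prod.swap

/-! ### Modulation spaces -/

/-- The modulation space `M_w^{p,q}(ℝᵈ)`: the tempered distributions `f` with
`V_g f · w ∈ L^{(p,q)}`, with the norm `‖V_g f · w‖_{L^{(p,q)}}` given by the window `g`. -/
def ModulationSpace {d : ℕ} (p q : ℝ) [Fact (1 ≤ p)] [Fact (1 ≤ q)]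
    (w : Rd d × Rd d → ℝ) (g : 𝓢(Rd d, ℂ)) : Type :=
  ((mixedLp d p q).comap (weightedStft w g) : Submodule ℂ 𝓢'(Rd d, ℂ))

namespace ModulationSpace

variable {d : ℕ} (p q : ℝ) [Fact (1 ≤ p)] [Fact (1 ≤ q)] (w : Rd d × Rd d → ℝ) (g : 𝓢(Rd d, ℂ))

instance : AddCommGroup (ModulationSpace p q w g) :=
  Submodule.addCommGroup ((mixedLp d p q).comap (weightedStft w g))

instance : Module ℂ (ModulationSpace p q w g) :=
  Submodule.module ((mixedLp d p q).comap (weightedStft w g))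

/-- The linear map `f ↦ V_g f · w` into `L^{(p,q)}`. -/
def toMixedLp : ModulationSpace p q w g →ₗ[ℂ] mixedLp d p q :=
  (weightedStft w g).restrict (fun _ h => h)

/-- The norm of the modulation space. -/
def seminorm : Seminorm ℂ (ModulationSpace p q w g) :=
  (mixedSeminorm d p q).comp (toMixedLp p q w g)

instance : SeminormedAddCommGroup (ModulationSpace p q w g) :=
  AddGroupSeminorm.toSeminormedAddCommGroup (seminorm p q w g).toAddGroupSeminorm

instance : NormedSpace ℂ (ModulationSpace p q w g) where
  norm_smul_le c f := (map_smul_eq_mul (seminorm p q w g) c f).le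

variable {p q w g}

/-- The tempered distribution underlying an element of the modulation space. -/
def toDistribution (f : ModulationSpace p q w g) : 𝓢'(Rd d, ℂ) :=
  Subtype.val f

lemma norm_def (f : ModulationSpace p q w g) :
    ‖f‖ = (mixedNorm p q (fun z => stft g f.toDistribution z * (w z : ℂ))).toReal :=
  rfl

end ModulationSpace

/-! ### Wiener amalgam spaces -/

/-- The Wiener amalgam space `W_w^{p,q}(ℝᵈ)`: the tempered distributions `f` such that the
coordinate flip of `V_g f · w` lies in `L^{(q,p)}`, with the norm given by the window `g`. Thus
the frequency variable is integrated first, with exponent `q`, and then the space variable, with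
exponent `p`. -/
def WienerAmalgamSpace {d : ℕ} (p q : ℝ) [Fact (1 ≤ p)] [Fact (1 ≤ q)]
    (w : Rd d × Rd d → ℝ) (g : 𝓢(Rd d, ℂ)) : Type :=
  ((mixedLp d q p).comap (flipMap d ∘ₗ weightedStft w g) : Submodule ℂ 𝓢'(Rd d, ℂ))

namespace WienerAmalgamSpace

variable {d : ℕ} (p q : ℝ) [Fact (1 ≤ p)] [Fact (1 ≤ q)] (w : Rd d × Rd d → ℝ) (g : 𝓢(Rd d, ℂ))

instance : AddCommGroup (WienerAmalgamSpace p q w g) :=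
  Submodule.addCommGroup ((mixedLp d q p).comap (flipMap d ∘ₗ weightedStft w g))

instance : Module ℂ (WienerAmalgamSpace p q w g) :=
  Submodule.module ((mixedLp d q p).comap (flipMap d ∘ₗ weightedStft w g))

/-- The linear map sending `f` to the coordinate flip of `V_g f · w` in `L^{(q,p)}`. -/
def toMixedLp : WienerAmalgamSpace p q w g →ₗ[ℂ] mixedLp d q p :=
  (flipMap d ∘ₗ weightedStft w g).restrict (fun _ h => h)

/-- The norm of the Wiener amalgam space. -/
def seminorm : Seminorm ℂ (WienerAmalgamSpace p q w g) :=
  (mixedSeminorm d q p).comp (toMixedLp p q w g)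

instance : SeminormedAddCommGroup (WienerAmalgamSpace p q w g) :=
  AddGroupSeminorm.toSeminormedAddCommGroup (seminorm p q w g).toAddGroupSeminorm

instance : NormedSpace ℂ (WienerAmalgamSpace p q w g) where
  norm_smul_le c f := (map_smul_eq_mul (seminorm p q w g) c f).le

variable {p q w g}

/-- The tempered distribution underlying an element of the Wiener amalgam space. -/
def toDistribution (f : WienerAmalgamSpace p q w g) : 𝓢'(Rd d, ℂ) :=
  Subtype.val f

lemma norm_def (f : WienerAmalgamSpace p q w g) :
    ‖f‖ = (mixedNorm q p
      (fun z => stft g f.toDistribution (z.2, z.1) * (w (z.2, z.1) : ℂ))).toReal :=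
  rfl

end WienerAmalgamSpace

end

/-!
Up to the constant `(2π)ᵈ ‖g‖₂²`, the short-time Fourier transform `V f` is reproduced by
integration against a rapidly decaying kernel. Pairing `f` with Schwartz functions is therefore
continuous for the weighted mixed norm of `V f`, so a Cauchy sequence has a weak limit among the
tempered distributions, to which it converges in norm by Fatou's lemma.

For the approximation property take the localisation operator `A_δ` whose symbol is a cutoff `χ_δ`
supported in the ball of radius `1 / δ` and Lipschitz with constant `δ`. The transform of `A_δ f` is
`χ_δ · V f`, of norm at most `‖f‖`, plus the commutator of `χ_δ` with the reproducing kernel applied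
to `V f`. Off-diagonal decay of the kernel and moderateness of the weight bound the commutator by
`O(δ)`. Replacing the integral over phase space by a finite sum costs another `O(δ)` and makes the
operator have finite rank. These operators have norm `1 + O(δ)` and tend strongly to the identity by
dominated convergence. After normalisation they are contractions, and strong convergence of
contractions is uniform on compact sets.
-/

noncomputable section

open Filter Topology
open scoped LineDeriv BoundedContinuousFunction FourierTransform

/-! ### Lebesgue and mixed norms of extended non-negative functions -/

section Lebesgue

variable {α β : Type*} [MeasurableSpace α] [MeasurableSpace β] {μ : Measure α} {ν : Measure β}
  {p : ℝ}

lemma eLpNorm'_mono_ae_ennreal (hp : 0 ≤ p) {f g : α → ℝ≥0∞} (h : f ≤ᵐ[μ] g) :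
    eLpNorm' f p μ ≤ eLpNorm' g p μ :=
  eLpNorm'_mono_enorm_ae hp h

lemma eLpNorm'_const_mul_ennreal (hp : 0 < p) {c : ℝ≥0∞} (hc : c ≠ ∞) (f : α → ℝ≥0∞) :
    eLpNorm' (fun x => c * f x) p μ = c * eLpNorm' f p μ := by
  simp only [eLpNorm'_eq_lintegral_enorm, enorm_eq_self, ENNReal.mul_rpow_of_nonneg _ _ hp.le]
  rw [lintegral_const_mul' _ _ (ENNReal.rpow_ne_top_of_nonneg hp.le hc),
    ENNReal.mul_rpow_of_nonneg _ _ (by positivity), ← ENNReal.rpow_mul,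
    mul_one_div_cancel hp.ne', ENNReal.rpow_one]

lemma eLpNorm'_add_le_ennreal (hp : 1 ≤ p) {f g : α → ℝ≥0∞} (hf : AEMeasurable f μ)
    (hg : AEMeasurable g μ) :
    eLpNorm' (fun x => f x + g x) p μ ≤ eLpNorm' f p μ + eLpNorm' g p μ :=
  eLpNorm'_add_le hf.aestronglyMeasurable hg.aestronglyMeasurable hp

lemma eLpNorm'_liminf_le (hp : 0 < p) {f : ℕ → α → ℝ≥0∞} (hf : ∀ n, AEMeasurable (f n) μ) :
    eLpNorm' (fun x => liminf (fun n => f n x) atTop) p μ ≤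
      liminf (fun n => eLpNorm' (f n) p μ) atTop := by
  have rpow_liminf (r : ℝ) (hr : 0 < r) (u : ℕ → ℝ≥0∞) :
      (liminf u atTop) ^ r = liminf (fun n => u n ^ r) atTop :=
    OrderIso.liminf_apply (ENNReal.orderIsoRpow r hr)
  simp only [eLpNorm'_eq_lintegral_enorm, enorm_eq_self, rpow_liminf p hp]
  rw [← rpow_liminf (1 / p) (by positivity)]
  gcongr
  exact lintegral_liminf_le' fun n => (hf n).pow_const p

lemma eLpNorm'_lt_top_iff (hp : 0 < p) {f : α → ℝ≥0∞} :
    eLpNorm' f p μ < ∞ ↔ ∫⁻ x, f x ^ p ∂μ < ∞ := by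
  simp only [eLpNorm'_eq_lintegral_enorm, enorm_eq_self]
  exact ENNReal.rpow_lt_top_iff_of_pos (by positivity)

lemma tendsto_eLpNorm'_zero (hp : 0 < p) {f : ℕ → α → ℝ≥0∞} {F : α → ℝ≥0∞}
    (hf : ∀ n, AEMeasurable (f n) μ) (hle : ∀ n, f n ≤ᵐ[μ] F) (hF : eLpNorm' F p μ < ∞)
    (hlim : ∀ᵐ x ∂μ, Tendsto (fun n => f n x) atTop (𝓝 0)) :
    Tendsto (fun n => eLpNorm' (f n) p μ) atTop (𝓝 0) := by
  have tendsto_rpow_zero {r : ℝ} (hr : 0 < r) {u : ℕ → ℝ≥0∞} (hu : Tendsto u atTop (𝓝 0)) :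
      Tendsto (fun n => u n ^ r) atTop (𝓝 0) := by
    simpa only [ENNReal.zero_rpow_of_pos hr] using hu.ennrpow_const r
  have tendsto_lintegral : Tendsto (fun n => ∫⁻ x, f n x ^ p ∂μ) atTop (𝓝 0) := by
    rw [← lintegral_zero (μ := μ)]
    refine tendsto_lintegral_of_dominated_convergence' (fun x => F x ^ p)
      (fun n => (hf n).pow_const p) (fun n => ?_) ((eLpNorm'_lt_top_iff hp).1 hF).ne ?_
    · filter_upwards [hle n] with x hx using ENNReal.rpow_le_rpow hx hp.le
    · filter_upwards [hlim] with x hx using tendsto_rpow_zero hp hx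
  simpa only [eLpNorm'_eq_lintegral_enorm, enorm_eq_self] using
    tendsto_rpow_zero (one_div_pos.2 hp) tendsto_lintegral

lemma exists_lintegral_mul_le_eLpNorm' (hp : 1 ≤ p) {ρ : α → ℝ≥0∞} (hρ : AEMeasurable ρ μ)
    (hρ_le : ∀ x, ρ x ≤ 1) (hρ_int : ∫⁻ x, ρ x ∂μ < ∞) :
    ∃ C : ℝ≥0∞, C ≠ ∞ ∧
      ∀ f : α → ℝ≥0∞, AEMeasurable f μ → ∫⁻ x, ρ x * f x ∂μ ≤ C * eLpNorm' f p μ := by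
  simp only [eLpNorm'_eq_lintegral_enorm, enorm_eq_self]
  rcases hp.eq_or_lt with rfl | hp
  · refine ⟨1, ENNReal.one_ne_top, fun f _ => ?_⟩
    simp only [ENNReal.rpow_one, one_div, inv_one, one_mul]
    exact lintegral_mono fun x => mul_le_of_le_one_left' (hρ_le x)
  · have hconj := (Real.HolderConjugate.conjExponent hp).symm
    have hpos := hconj.pos
    refine ⟨(∫⁻ x, ρ x ^ p.conjExponent ∂μ) ^ (1 / p.conjExponent), ?_,
      fun f hf => ENNReal.lintegral_mul_le_Lp_mul_Lq μ hconj hρ hf⟩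
    refine ENNReal.rpow_ne_top_of_nonneg (by positivity) (lt_of_le_of_lt ?_ hρ_int).ne
    exact lintegral_mono fun x => ENNReal.rpow_le_self_of_le_one (hρ_le x) hconj.lt.le

lemma measurable_eLpNorm'_left [SFinite μ] {F : α × β → ℝ≥0∞} (hF : Measurable F) :
    Measurable fun y => eLpNorm' (fun x => F (x, y)) p μ := by
  simp only [eLpNorm'_eq_lintegral_enorm, enorm_eq_self]
  exact ((hF.pow_const p).lintegral_prod_left').pow_const _

lemma aemeasurable_eLpNorm'_left [SFinite μ] [SFinite ν] {F : α × β → ℝ≥0∞}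
    (hF : AEMeasurable F (μ.prod ν)) :
    AEMeasurable (fun y => eLpNorm' (fun x => F (x, y)) p μ) ν := by
  simp only [eLpNorm'_eq_lintegral_enorm, enorm_eq_self]
  exact ((hF.pow_const p).lintegral_prod_left').pow_const _

lemma lintegral_lintegral_mul_le [SFinite μ] [SFinite ν] {p' : ℝ} (hpp' : p.HolderConjugate p')
    {h : α → β → ℝ≥0∞} (hh : Measurable (Function.uncurry h)) {u : α → ℝ≥0∞} (hu : Measurable u) :
    ∫⁻ x, (∫⁻ y, h x y ∂ν) * u x ∂μ ≤
      (∫⁻ y, eLpNorm' (fun x => h x y) p μ ∂ν) * eLpNorm' u p' μ :=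
  calc ∫⁻ x, (∫⁻ y, h x y ∂ν) * u x ∂μ
      = ∫⁻ x, ∫⁻ y, h x y * u x ∂ν ∂μ :=
        lintegral_congr fun _ => (lintegral_mul_const _ hh.of_uncurry_left).symm
    _ = ∫⁻ y, ∫⁻ x, h x y * u x ∂μ ∂ν :=
        lintegral_lintegral_swap (hh.mul (hu.comp measurable_fst)).aemeasurable
    _ ≤ ∫⁻ y, eLpNorm' (fun x => h x y) p μ * eLpNorm' u p' μ ∂ν :=
        lintegral_mono fun _ => ENNReal.lintegral_mul_le_Lp_mul_Lq μ hpp'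
          hh.of_uncurry_right.aemeasurable hu.aemeasurable
    _ = (∫⁻ y, eLpNorm' (fun x => h x y) p μ ∂ν) * eLpNorm' u p' μ :=
        lintegral_mul_const _ (measurable_eLpNorm'_left hh)

lemma lintegral_le_rpow_of_le_lintegral_rpow [SFinite μ] [SFinite ν] (hp : 1 < p)
    {h : α → β → ℝ≥0∞} (hh : Measurable (Function.uncurry h)) {g : α → ℝ≥0∞} (hg : Measurable g)
    (hle : ∀ x, g x ≤ (∫⁻ y, h x y ∂ν) ^ p) (hg_int : ∫⁻ x, g x ∂μ ≠ ∞) :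
    ∫⁻ x, g x ∂μ ≤ (∫⁻ y, eLpNorm' (fun x => h x y) p μ ∂ν) ^ p := by
  have hconj := Real.HolderConjugate.conjExponent hp
  have hp_pos := hconj.pos
  have hp'_pos := hconj.symm.pos
  set p' := p.conjExponent
  set A := ∫⁻ x, g x ∂μ
  rcases eq_or_ne A 0 with hA | hA
  · rw [hA]; exact zero_le
  have rpow_split (a : ℝ≥0∞) : a = a ^ (1 / p) * a ^ (1 / p') := by
    rw [← ENNReal.rpow_add_of_nonneg _ _ (by positivity) (by positivity), one_div, one_div,
      hconj.inv_add_inv_eq_one, ENNReal.rpow_one]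
  have norm_rpow : eLpNorm' (fun x => g x ^ (1 / p')) p' μ = A ^ (1 / p') := by
    simp only [eLpNorm'_eq_lintegral_enorm, enorm_eq_self, ← ENNReal.rpow_mul,
      one_div_mul_cancel hp'_pos.ne', ENNReal.rpow_one, A]
  have hA_le : A ^ (1 / p) * A ^ (1 / p') ≤
      (∫⁻ y, eLpNorm' (fun x => h x y) p μ ∂ν) * A ^ (1 / p') := by
    rw [← rpow_split, ← norm_rpow]
    refine (lintegral_mono fun x => ?_).trans (lintegral_lintegral_mul_le hconj hh (hg.pow_const _))
    conv_lhs => rw [rpow_split (g x)]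
    gcongr
    rw [one_div, ENNReal.rpow_inv_le_iff hp_pos]
    exact hle x
  have hA_root := (ENNReal.mul_le_mul_iff_left
    (by simp only [ne_eq, ENNReal.rpow_eq_zero_iff, hA, hg_int, false_and, or_self,
      not_false_eq_true])
    (ENNReal.rpow_ne_top_of_nonneg (by positivity) hg_int)).1 hA_le
  rwa [one_div, ENNReal.rpow_inv_le_iff hp_pos] at hA_root

lemma eLpNorm'_lintegral_le [SigmaFinite μ] [SFinite ν] (hp : 1 ≤ p)
    {h : α → β → ℝ≥0∞} (hh : Measurable (Function.uncurry h)) :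
    eLpNorm' (fun x => ∫⁻ y, h x y ∂ν) p μ ≤ ∫⁻ y, eLpNorm' (fun x => h x y) p μ ∂ν := by
  rcases hp.eq_or_lt with rfl | hp
  · simp only [eLpNorm'_eq_lintegral_enorm, enorm_eq_self, ENNReal.rpow_one, one_div, inv_one]
    exact (lintegral_lintegral_swap hh.aemeasurable).le
  simp only [eLpNorm'_eq_lintegral_enorm (f := fun x => ∫⁻ y, h x y ∂ν), enorm_eq_self]
  rw [one_div, ENNReal.rpow_inv_le_iff (by linarith), lintegral_eq_nnreal]
  refine iSup₂_le fun φ hφ => le_of_forall_lt fun L hL => ?_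
  rw [← SimpleFunc.lintegral_eq_lintegral] at hL
  obtain ⟨g, hgφ, hg_int, hLg⟩ := exists_lt_lintegral_simpleFunc_of_lt_lintegral (f := φ) hL
  exact hLg.trans_le (lintegral_le_rpow_of_le_lintegral_rpow hp hh
    g.measurable.coe_nnreal_ennreal
    (fun x => (ENNReal.coe_le_coe.2 (hgφ x)).trans (hφ x)) hg_int.ne)

end Lebesgue

section MixedNorm

variable {α β γ : Type*} [MeasurableSpace α] [MeasurableSpace β] [MeasurableSpace γ]
  {μ : Measure α} {ν : Measure β} {ρ : Measure γ} {p q : ℝ}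

/-- The mixed `L^{(p,q)}` norm of an extended non-negative function on a product, with exponent
`p` in the first (inner) variable and `q` in the second (outer) one. -/
def mixedENorm (p q : ℝ) (μ : Measure α) (ν : Measure β) (F : α × β → ℝ≥0∞) : ℝ≥0∞ :=
  eLpNorm' (fun y => eLpNorm' (fun x => F (x, y)) p μ) q ν

lemma mixedNorm_eq_mixedENorm {d : ℕ} (F : Rd d × Rd d → ℂ) :
    mixedNorm p q F = mixedENorm p q volume volume fun z => ‖F z‖ₑ := by
  simp only [mixedNorm, mixedENorm, eLpNorm'_eq_lintegral_enorm, enorm_eq_self,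
    ← ENNReal.rpow_mul, one_div_mul_eq_div]

lemma ae_ae_section [SFinite μ] [SFinite ν] {P : α × β → Prop} (h : ∀ᵐ z ∂μ.prod ν, P z) :
    ∀ᵐ y ∂ν, ∀ᵐ x ∂μ, P (x, y) := by
  rw [← Measure.prod_swap] at h
  exact Measure.ae_ae_of_ae_prod (ae_of_ae_map measurable_swap.aemeasurable h)

lemma aemeasurable_section [SFinite μ] [SFinite ν] {F : α × β → ℝ≥0∞}
    (hF : AEMeasurable F (μ.prod ν)) : ∀ᵐ y ∂ν, AEMeasurable (fun x => F (x, y)) μ := by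
  filter_upwards [ae_ae_section hF.ae_eq_mk] with y hy
  exact ⟨_, hF.measurable_mk.comp measurable_prodMk_right, hy⟩

lemma mixedENorm_const_mul (hp : 0 < p) (hq : 0 < q) {c : ℝ≥0∞} (hc : c ≠ ∞)
    (F : α × β → ℝ≥0∞) :
    mixedENorm p q μ ν (fun z => c * F z) = c * mixedENorm p q μ ν F := by
  simp only [mixedENorm, eLpNorm'_const_mul_ennreal hp hc, eLpNorm'_const_mul_ennreal hq hc]

lemma mixedENorm_prod_lt_top (hp : 0 < p) (hq : 0 < q) {f : α → ℝ≥0∞} {g : β → ℝ≥0∞}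
    (hf : eLpNorm' f p μ < ∞) (hg_ne : ∀ y, g y ≠ ∞) (hg : eLpNorm' g q ν < ∞) :
    mixedENorm p q μ ν (fun z => f z.1 * g z.2) < ∞ := by
  simp only [mixedENorm, mul_comm (f _), eLpNorm'_const_mul_ennreal hp (hg_ne _)]
  simp only [mul_comm (g _), eLpNorm'_const_mul_ennreal hq hf.ne]
  exact ENNReal.mul_lt_top hf hg

lemma mixedENorm_lintegral_le [SigmaFinite μ] [SigmaFinite ν] [SFinite ρ] (hp : 1 ≤ p)
    (hq : 1 ≤ q) {h : α × β → γ → ℝ≥0∞} (hh : Measurable (Function.uncurry h)) :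
    mixedENorm p q μ ν (fun z => ∫⁻ t, h z t ∂ρ) ≤
      ∫⁻ t, mixedENorm p q μ ν (fun z => h z t) ∂ρ := by
  have hinner (y : β) : eLpNorm' (fun x => ∫⁻ t, h (x, y) t ∂ρ) p μ ≤
      ∫⁻ t, eLpNorm' (fun x => h (x, y) t) p μ ∂ρ :=
    eLpNorm'_lintegral_le hp
      (hh.comp ((measurable_fst.prodMk measurable_const).prodMk measurable_snd))
  refine (eLpNorm'_mono_ae_ennreal (by linarith) (ae_of_all _ hinner)).trans
    (eLpNorm'_lintegral_le hq ?_)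
  refine measurable_eLpNorm'_left (F := fun a : α × (β × γ) => h (a.1, a.2.1) a.2.2) ?_
  exact hh.comp (MeasurableEquiv.prodAssoc (α := α)).symm.measurable

variable [SFinite μ] [SFinite ν]

lemma mixedENorm_mono_ae (hp : 0 ≤ p) (hq : 0 ≤ q) {F G : α × β → ℝ≥0∞} (h : F ≤ᵐ[μ.prod ν] G) :
    mixedENorm p q μ ν F ≤ mixedENorm p q μ ν G := by
  refine eLpNorm'_mono_ae_ennreal hq ?_
  filter_upwards [ae_ae_section h] with y hy using eLpNorm'_mono_ae_ennreal hp hy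

lemma mixedENorm_add_le (hp : 1 ≤ p) (hq : 1 ≤ q) {F G : α × β → ℝ≥0∞}
    (hF : AEMeasurable F (μ.prod ν)) (hG : AEMeasurable G (μ.prod ν)) :
    mixedENorm p q μ ν (fun z => F z + G z) ≤ mixedENorm p q μ ν F + mixedENorm p q μ ν G := by
  refine (eLpNorm'_mono_ae_ennreal (by linarith) ?_).trans (eLpNorm'_add_le_ennreal hq
    (aemeasurable_eLpNorm'_left hF) (aemeasurable_eLpNorm'_left hG))
  filter_upwards [aemeasurable_section hF, aemeasurable_section hG] with y hFy hGy
  exact eLpNorm'_add_le_ennreal hp hFy hGy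

lemma mixedENorm_liminf_le (hp : 0 < p) (hq : 0 < q) {F : ℕ → α × β → ℝ≥0∞}
    (hF : ∀ n, AEMeasurable (F n) (μ.prod ν)) :
    mixedENorm p q μ ν (fun z => liminf (fun n => F n z) atTop) ≤
      liminf (fun n => mixedENorm p q μ ν (F n)) atTop := by
  refine (eLpNorm'_mono_ae_ennreal hq.le ?_).trans
    (eLpNorm'_liminf_le hq fun n => aemeasurable_eLpNorm'_left (hF n))
  filter_upwards [ae_all_iff.2 fun n => aemeasurable_section (hF n)] with y hy
  exact eLpNorm'_liminf_le hp hy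

lemma tendsto_mixedENorm_zero (hp : 0 < p) (hq : 0 < q) {F : ℕ → α × β → ℝ≥0∞}
    {G : α × β → ℝ≥0∞} (hF : ∀ n, AEMeasurable (F n) (μ.prod ν))
    (hG : AEMeasurable G (μ.prod ν)) (hle : ∀ n, F n ≤ᵐ[μ.prod ν] G)
    (hfin : mixedENorm p q μ ν G < ∞)
    (hlim : ∀ᵐ z ∂μ.prod ν, Tendsto (fun n => F n z) atTop (𝓝 0)) :
    Tendsto (fun n => mixedENorm p q μ ν (F n)) atTop (𝓝 0) := by
  have inner_lt_top : ∀ᵐ y ∂ν, eLpNorm' (fun x => G (x, y)) p μ ^ q < ∞ :=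
    ae_lt_top' ((aemeasurable_eLpNorm'_left hG).pow_const q) ((eLpNorm'_lt_top_iff hq).1 hfin).ne
  refine tendsto_eLpNorm'_zero hq (fun n => aemeasurable_eLpNorm'_left (hF n)) (fun n => ?_) hfin ?_
  · filter_upwards [ae_ae_section (hle n)] with y hy using eLpNorm'_mono_ae_ennreal hp.le hy
  · filter_upwards [inner_lt_top, ae_all_iff.2 fun n => aemeasurable_section (hF n),
      ae_all_iff.2 fun n => ae_ae_section (hle n), ae_ae_section hlim] with y hGy hFy hley hlimy
    exact tendsto_eLpNorm'_zero hp hFy hley ((ENNReal.rpow_lt_top_iff_of_pos hq).1 hGy) hlimy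

lemma exists_lintegral_mul_le_mixedENorm (hp : 1 ≤ p) (hq : 1 ≤ q) {f : α → ℝ≥0∞}
    {g : β → ℝ≥0∞} (hf : Measurable f) (hg : Measurable g) (hf_le : ∀ x, f x ≤ 1)
    (hg_le : ∀ y, g y ≤ 1) (hf_int : ∫⁻ x, f x ∂μ < ∞) (hg_int : ∫⁻ y, g y ∂ν < ∞) :
    ∃ C : ℝ≥0∞, C ≠ ∞ ∧ ∀ F : α × β → ℝ≥0∞, AEMeasurable F (μ.prod ν) →
      ∫⁻ z, f z.1 * g z.2 * F z ∂μ.prod ν ≤ C * mixedENorm p q μ ν F := by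
  obtain ⟨C, hC, hfC⟩ := exists_lintegral_mul_le_eLpNorm' hp hf.aemeasurable hf_le hf_int
  obtain ⟨D, hD, hgD⟩ := exists_lintegral_mul_le_eLpNorm' hq hg.aemeasurable hg_le hg_int
  refine ⟨C * D, ENNReal.mul_ne_top hC hD, fun F hF => ?_⟩
  have hfg : Measurable fun z : α × β => f z.1 * g z.2 :=
    (hf.comp measurable_fst).mul (hg.comp measurable_snd)
  calc ∫⁻ z, f z.1 * g z.2 * F z ∂μ.prod ν
      = ∫⁻ y, ∫⁻ x, f x * g y * F (x, y) ∂μ ∂ν :=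
        lintegral_prod_symm _ (hfg.aemeasurable.mul hF)
    _ ≤ ∫⁻ y, C * (g y * eLpNorm' (fun x => F (x, y)) p μ) ∂ν := by
        refine lintegral_mono_ae ?_
        filter_upwards [aemeasurable_section hF] with y hy
        simp only [mul_comm (f _) (g y), mul_assoc]
        rw [lintegral_const_mul' _ _ ((hg_le y).trans_lt ENNReal.one_lt_top).ne, mul_left_comm]
        gcongr
        exact hfC _ hy
    _ = C * ∫⁻ y, g y * eLpNorm' (fun x => F (x, y)) p μ ∂ν := lintegral_const_mul' _ _ hC
    _ ≤ C * (D * mixedENorm p q μ ν F) := by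
        gcongr
        exact hgD _ (aemeasurable_eLpNorm'_left hF)
    _ = C * D * mixedENorm p q μ ν F := (mul_assoc _ _ _).symm

end MixedNorm

section Translation

variable {G H : Type*} [AddCommGroup G] [AddCommGroup H] [MeasurableSpace G] [MeasurableSpace H]
  {p q : ℝ} {μ : Measure G} {ν : Measure H}

lemma mixedENorm_translate [MeasurableAdd G] [MeasurableAdd H] [μ.IsAddLeftInvariant]
    [ν.IsAddLeftInvariant] (F : G × H → ℝ≥0∞) (y : G × H) :
    mixedENorm p q μ ν (fun z => F (z - y)) = mixedENorm p q μ ν F := by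
  obtain ⟨y, η⟩ := y
  have inner (ξ : H) : ∫⁻ x, F (x - y, ξ - η) ^ p ∂μ = ∫⁻ x, F (x, ξ - η) ^ p ∂μ :=
    lintegral_sub_right_eq_self (fun x => F (x, ξ - η) ^ p) y
  simp only [mixedENorm, eLpNorm'_eq_lintegral_enorm, enorm_eq_self, Prod.mk_sub_mk, inner]
  rw [lintegral_sub_right_eq_self (fun ξ => ((∫⁻ x, F (x, ξ) ^ p ∂μ) ^ (1 / p)) ^ q) η]

lemma lintegral_conv_eq_lintegral_translate [MeasurableAdd G] [MeasurableNeg G]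
    [μ.IsAddLeftInvariant] [μ.IsNegInvariant] (k : G → ℝ≥0∞) {f g : G → ℝ≥0∞}
    (hfg : f =ᵐ[μ] g) (z : G) :
    ∫⁻ z', k (z - z') * f z' ∂μ = ∫⁻ y, k y * g (z - y) ∂μ := by
  rw [← lintegral_sub_left_eq_self _ z]
  simp only [sub_sub_cancel]
  refine lintegral_congr_ae ?_
  filter_upwards [(Measure.measurePreserving_sub_left μ z).quasiMeasurePreserving.ae hfg]
    with y hy
  rw [hy]

instance isNegInvariant_prod [MeasurableNeg G] [MeasurableNeg H] [SFinite μ] [SFinite ν]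
    [μ.IsNegInvariant] [ν.IsNegInvariant] : (μ.prod ν).IsNegInvariant :=
  ⟨((Measure.measurePreserving_neg μ).prod (Measure.measurePreserving_neg ν)).map_eq⟩

lemma mixedENorm_conv_le [TopologicalSpace G] [TopologicalSpace H] [IsTopologicalAddGroup G]
    [IsTopologicalAddGroup H] [SecondCountableTopology G] [SecondCountableTopology H]
    [BorelSpace G] [BorelSpace H] [SigmaFinite μ] [SigmaFinite ν] [μ.IsAddLeftInvariant]
    [ν.IsAddLeftInvariant] [μ.IsNegInvariant] [ν.IsNegInvariant] (hp : 1 ≤ p) (hq : 1 ≤ q)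
    {k F : G × H → ℝ≥0∞}
    (hk : Measurable k) (hk_ne : ∀ z, k z ≠ ∞) (hF : AEMeasurable F (μ.prod ν)) :
    mixedENorm p q μ ν (fun z => ∫⁻ z', k (z - z') * F z' ∂μ.prod ν) ≤
      (∫⁻ z, k z ∂μ.prod ν) * mixedENorm p q μ ν F := by
  simp only [lintegral_conv_eq_lintegral_translate k hF.ae_eq_mk]
  calc mixedENorm p q μ ν (fun z => ∫⁻ y, k y * hF.mk F (z - y) ∂μ.prod ν)
      ≤ ∫⁻ y, mixedENorm p q μ ν (fun z => k y * hF.mk F (z - y)) ∂μ.prod ν :=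
        mixedENorm_lintegral_le hp hq ((hk.comp measurable_snd).mul
          (hF.measurable_mk.comp (measurable_fst.sub measurable_snd)))
    _ = ∫⁻ y, k y * mixedENorm p q μ ν (hF.mk F) ∂μ.prod ν := by
        refine lintegral_congr fun y => ?_
        rw [mixedENorm_const_mul (by linarith) (by linarith) (hk_ne y), mixedENorm_translate]
    _ = (∫⁻ z, k z ∂μ.prod ν) * mixedENorm p q μ ν (hF.mk F) := lintegral_mul_const _ hk
    _ ≤ (∫⁻ z, k z ∂μ.prod ν) * mixedENorm p q μ ν F := by
        gcongr
        exact mixedENorm_mono_ae (by linarith) (by linarith) hF.ae_eq_mk.symm.le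

end Translation

/-- The function `(1 + |x|)(1 + |ξ|)` on phase space, against which the decay of short-time Fourier
transforms is measured. -/
def phaseWeight {d : ℕ} (z : Rd d × Rd d) : ℝ := (1 + ‖z.1‖) * (1 + ‖z.2‖)

/-- The integrable function `((1 + |x|)(1 + |ξ|))^{-(d+1)}` on phase space. -/
def phaseDecay {d : ℕ} (z : Rd d × Rd d) : ℝ≥0∞ := ENNReal.ofReal ((phaseWeight z ^ (d + 1))⁻¹)

/-- The factor `(1 + |x|)^{-(d+1)}` of `phaseDecay`. -/
def spaceDecay {d : ℕ} (x : Rd d) : ℝ≥0∞ := ENNReal.ofReal (((1 + ‖x‖) ^ (d + 1))⁻¹)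

section Decay

variable {d : ℕ}

lemma phaseDecay_eq_mul (z : Rd d × Rd d) : phaseDecay z = spaceDecay z.1 * spaceDecay z.2 := by
  rw [phaseDecay, phaseWeight, mul_pow, mul_inv, ENNReal.ofReal_mul (by positivity)]
  rfl

lemma measurable_spaceDecay : Measurable (spaceDecay (d := d)) := by
  unfold spaceDecay; fun_prop

lemma measurable_phaseDecay : Measurable (phaseDecay (d := d)) := by
  unfold phaseDecay phaseWeight; fun_prop

lemma spaceDecay_le_one (x : Rd d) : spaceDecay x ≤ 1 := by
  refine ENNReal.ofReal_le_one.2 (inv_le_one_of_one_le₀ (one_le_pow₀ ?_))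
  linarith [norm_nonneg x]

lemma lintegral_spaceDecay_lt_top : ∫⁻ x : Rd d, spaceDecay x < ∞ := by
  have h : Integrable (fun x : Rd d => (1 + ‖x‖) ^ (-((d + 1 : ℕ) : ℝ))) volume :=
    integrable_one_add_norm (by simp)
  refine lt_of_le_of_lt (lintegral_mono fun x => ?_) h.lintegral_lt_top
  rw [spaceDecay, Real.rpow_neg (by positivity), Real.rpow_natCast]

lemma lintegral_phaseDecay_lt_top : ∫⁻ z : Rd d × Rd d, phaseDecay z < ∞ := by
  simp only [phaseDecay_eq_mul, Measure.volume_eq_prod]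
  rw [lintegral_prod_mul measurable_spaceDecay.aemeasurable measurable_spaceDecay.aemeasurable]
  exact ENNReal.mul_lt_top lintegral_spaceDecay_lt_top lintegral_spaceDecay_lt_top

lemma eLpNorm'_spaceDecay_lt_top {p : ℝ} (hp : 1 ≤ p) :
    eLpNorm' (spaceDecay (d := d)) p volume < ∞ := by
  refine (eLpNorm'_lt_top_iff (by linarith)).2 (lt_of_le_of_lt (lintegral_mono fun x => ?_)
    lintegral_spaceDecay_lt_top)
  exact ENNReal.rpow_le_self_of_le_one (spaceDecay_le_one x) hp

end Decay

/-- The properties of the norm of a translation invariant solid function space on phase space that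
make the reproducing formula of the short-time Fourier transform act on it: both `L^{(p,q)}` and
its coordinate flip have them, so that modulation and amalgam spaces are treated at once. -/
structure AdmissibleNorm {d : ℕ} (N : (Rd d × Rd d → ℝ≥0∞) → ℝ≥0∞) : Prop where
  mono_ae : ∀ {F G : Rd d × Rd d → ℝ≥0∞}, F ≤ᵐ[volume] G → N F ≤ N G
  add_le : ∀ {F G : Rd d × Rd d → ℝ≥0∞}, AEMeasurable F → AEMeasurable G →
    N (fun z => F z + G z) ≤ N F + N G
  const_mul : ∀ {c : ℝ≥0∞}, c ≠ ∞ → ∀ F : Rd d × Rd d → ℝ≥0∞, N (fun z => c * F z) = c * N F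
  liminf_le : ∀ {F : ℕ → Rd d × Rd d → ℝ≥0∞}, (∀ n, AEMeasurable (F n)) →
    N (fun z => liminf (fun n => F n z) atTop) ≤ liminf (fun n => N (F n)) atTop
  tendsto_zero : ∀ {F : ℕ → Rd d × Rd d → ℝ≥0∞} {G : Rd d × Rd d → ℝ≥0∞},
    (∀ n, AEMeasurable (F n)) → AEMeasurable G → (∀ n, F n ≤ᵐ[volume] G) → N G < ∞ →
    (∀ᵐ z, Tendsto (fun n => F n z) atTop (𝓝 0)) → Tendsto (fun n => N (F n)) atTop (𝓝 0)
  conv_le : ∀ {k F : Rd d × Rd d → ℝ≥0∞}, Measurable k → (∀ z, k z ≠ ∞) → AEMeasurable F →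
    N (fun z => ∫⁻ z', k (z - z') * F z') ≤ (∫⁻ z, k z) * N F
  lintegral_le : ∃ C : ℝ≥0∞, C ≠ ∞ ∧ ∀ F : Rd d × Rd d → ℝ≥0∞, AEMeasurable F →
    ∫⁻ z, phaseDecay z * F z ≤ C * N F
  decay_lt_top : N phaseDecay < ∞

lemma admissibleNorm_mixedENorm {d : ℕ} {p q : ℝ} (hp : 1 ≤ p) (hq : 1 ≤ q) :
    AdmissibleNorm (mixedENorm p q (volume : Measure (Rd d)) (volume : Measure (Rd d))) := by
  have hp_pos : 0 < p := by linarith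
  have hq_pos : 0 < q := by linarith
  exact
  { mono_ae := mixedENorm_mono_ae hp_pos.le hq_pos.le
    add_le := mixedENorm_add_le hp hq
    const_mul := mixedENorm_const_mul hp_pos hq_pos
    liminf_le := mixedENorm_liminf_le hp_pos hq_pos
    tendsto_zero := tendsto_mixedENorm_zero hp_pos hq_pos
    conv_le := mixedENorm_conv_le hp hq
    lintegral_le := by
      simp only [phaseDecay_eq_mul]
      exact exists_lintegral_mul_le_mixedENorm hp hq measurable_spaceDecay measurable_spaceDecay
        spaceDecay_le_one spaceDecay_le_one lintegral_spaceDecay_lt_top lintegral_spaceDecay_lt_top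
    decay_lt_top := by
      rw [funext phaseDecay_eq_mul]
      exact mixedENorm_prod_lt_top hp_pos hq_pos (eLpNorm'_spaceDecay_lt_top hp)
        (fun _ => ENNReal.ofReal_ne_top) (eLpNorm'_spaceDecay_lt_top hq) }

lemma AdmissibleNorm.swap {d : ℕ} {N : (Rd d × Rd d → ℝ≥0∞) → ℝ≥0∞} (hN : AdmissibleNorm N) :
    AdmissibleNorm fun F : Rd d × Rd d → ℝ≥0∞ => N fun z => F z.swap := by
  have hswap : MeasurePreserving (Prod.swap : Rd d × Rd d → Rd d × Rd d) volume volume :=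
    Measure.measurePreserving_swap
  have hae := fun {P : Rd d × Rd d → Prop} => hswap.quasiMeasurePreserving.ae (p := P)
  have hmeas {F : Rd d × Rd d → ℝ≥0∞} (hF : AEMeasurable F) :
      AEMeasurable fun z : Rd d × Rd d => F z.swap :=
    hF.comp_quasiMeasurePreserving hswap.quasiMeasurePreserving
  have lintegral_swap (F : Rd d × Rd d → ℝ≥0∞) : ∫⁻ z : Rd d × Rd d, F z.swap = ∫⁻ z, F z :=
    hswap.lintegral_comp_emb MeasurableEquiv.prodComm.measurableEmbedding F
  have hdecay (z : Rd d × Rd d) : phaseDecay z.swap = phaseDecay z := by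
    simp only [phaseDecay_eq_mul, Prod.fst_swap, Prod.snd_swap, mul_comm]
  refine
  { mono_ae := fun h => hN.mono_ae (hae h)
    add_le := fun hF hG => hN.add_le (hmeas hF) (hmeas hG)
    const_mul := fun hc F => hN.const_mul hc _
    liminf_le := fun hF => hN.liminf_le fun n => hmeas (hF n)
    tendsto_zero := fun hF hG hle hfin hlim => hN.tendsto_zero (fun n => hmeas (hF n)) (hmeas hG)
      (fun n => hae (hle n)) hfin (hae hlim)
    conv_le := fun {k F} hk hk_ne hF => ?_
    lintegral_le := ?_
    decay_lt_top := by simpa only [hdecay] using hN.decay_lt_top }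
  · have h := hN.conv_le (hk.comp measurable_swap) (fun z => hk_ne z.swap) (hmeas hF)
    simp only [Function.comp_def, lintegral_swap, Prod.swap_sub] at h
    simpa only [fun z : Rd d × Rd d => lintegral_swap fun z' => k (z.swap - z') * F z'] using h
  · obtain ⟨C, hC, h⟩ := hN.lintegral_le
    refine ⟨C, hC, fun F hF => ?_⟩
    rw [← lintegral_swap]
    simpa only [hdecay] using h _ (hmeas hF)

section PhaseWeight

variable {d : ℕ}

lemma one_le_phaseWeight (z : Rd d × Rd d) : 1 ≤ phaseWeight z :=
  one_le_mul_of_one_le_of_one_le (le_add_of_nonneg_right (norm_nonneg _))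
    (le_add_of_nonneg_right (norm_nonneg _))

lemma norm_fst_le_phaseWeight (z : Rd d × Rd d) : ‖z.1‖ ≤ phaseWeight z := by
  unfold phaseWeight
  nlinarith [norm_nonneg z.1, norm_nonneg z.2]

lemma norm_snd_le_phaseWeight (z : Rd d × Rd d) : ‖z.2‖ ≤ phaseWeight z := by
  unfold phaseWeight
  nlinarith [norm_nonneg z.1, norm_nonneg z.2]

lemma phaseWeight_pos (z : Rd d × Rd d) : 0 < phaseWeight z :=
  zero_lt_one.trans_le (one_le_phaseWeight z)

lemma norm_le_phaseWeight (z : Rd d × Rd d) : ‖z‖ ≤ phaseWeight z :=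
  max_le (norm_fst_le_phaseWeight z) (norm_snd_le_phaseWeight z)

lemma phaseWeight_le_one_add_norm_sq (z : Rd d × Rd d) : phaseWeight z ≤ (1 + ‖z‖) ^ 2 := by
  rw [sq, phaseWeight]
  gcongr
  exacts [norm_fst_le z, norm_snd_le z]

lemma phaseWeight_neg (z : Rd d × Rd d) : phaseWeight (-z) = phaseWeight z := by
  simp only [phaseWeight, Prod.fst_neg, Prod.snd_neg, norm_neg]

lemma phaseWeight_sub_comm (z z' : Rd d × Rd d) : phaseWeight (z - z') = phaseWeight (z' - z) := by
  rw [← neg_sub, phaseWeight_neg]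

lemma phaseWeight_add_le (x y : Rd d × Rd d) :
    phaseWeight (x + y) ≤ phaseWeight x * phaseWeight y := by
  have one_add_norm_add_le (a b : Rd d) : 1 + ‖a + b‖ ≤ (1 + ‖a‖) * (1 + ‖b‖) := by
    have := norm_add_le a b
    nlinarith [norm_nonneg a, norm_nonneg b]
  calc phaseWeight (x + y) ≤ ((1 + ‖x.1‖) * (1 + ‖y.1‖)) * ((1 + ‖x.2‖) * (1 + ‖y.2‖)) :=
        mul_le_mul (one_add_norm_add_le _ _) (one_add_norm_add_le _ _) (by positivity)
          (by positivity)
    _ = phaseWeight x * phaseWeight y := mul_mul_mul_comm _ _ _ _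

lemma phaseWeight_le_sub_mul (z y : Rd d × Rd d) :
    phaseWeight z ≤ phaseWeight (z - y) * phaseWeight y := by
  simpa only [sub_add_cancel] using phaseWeight_add_le (z - y) y

end PhaseWeight

/-! ### Derivatives and coordinate multiplications of Schwartz functions -/

section SchwartzOperators

variable {E : Type*} [NormedAddCommGroup E] [NormedSpace ℝ E]

/-- The embedding of Schwartz functions into bounded continuous functions. -/
abbrev toBCF : 𝓢(E, ℂ) →L[ℂ] (E →ᵇ ℂ) :=
  SchwartzMap.toBoundedContinuousFunctionCLM ℂ E ℂ

/-- Complex conjugation of Schwartz functions, only real-linear. -/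
def schwartzConj : 𝓢(E, ℂ) →L[ℝ] 𝓢(E, ℂ) :=
  SchwartzMap.postcompCLM (𝕜 := ℝ) (Complex.conjCLE : ℂ →L[ℝ] ℂ)

@[simp]
lemma schwartzConj_apply (φ : 𝓢(E, ℂ)) (t : E) : schwartzConj φ t = conj (φ t) := rfl

lemma lineDerivOp_schwartzConj (v : E) (φ : 𝓢(E, ℂ)) :
    ∂_{v} (schwartzConj φ) = schwartzConj (∂_{v} φ) := by
  ext t
  have hasFDerivAt_conj : HasFDerivAt (schwartzConj φ)
      ((Complex.conjCLE : ℂ →L[ℝ] ℂ).comp (fderiv ℝ φ t)) t :=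
    (Complex.conjCLE : ℂ →L[ℝ] ℂ).hasFDerivAt.comp t φ.differentiableAt.hasFDerivAt
  rw [SchwartzMap.lineDerivOp_apply_eq_fderiv, hasFDerivAt_conj.fderiv, schwartzConj_apply,
    SchwartzMap.lineDerivOp_apply_eq_fderiv]
  rfl

lemma norm_schwartz_sub_le {F : Type*} [NormedAddCommGroup F] [NormedSpace ℝ F] (φ : 𝓢(E, F))
    (s t : E) : ‖φ s - φ t‖ ≤ SchwartzMap.seminorm ℝ 0 1 φ * ‖s - t‖ := by
  refine convex_univ.norm_image_sub_le_of_norm_fderiv_le (𝕜 := ℝ)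
    (fun x _ => φ.differentiableAt) (fun x _ => ?_) (Set.mem_univ t) (Set.mem_univ s)
  simpa only [norm_iteratedFDeriv_one, pow_zero, one_mul] using SchwartzMap.le_seminorm ℝ 0 1 φ x

lemma norm_mul_norm_schwartz_sub_le {F : Type*} [NormedAddCommGroup F] [NormedSpace ℝ F]
    (φ : 𝓢(E, F)) (t x : E) : ‖t‖ * ‖φ (t - x)‖ ≤
      (SchwartzMap.seminorm ℝ 1 0 φ + SchwartzMap.seminorm ℝ 0 0 φ) * (1 + ‖x‖) := by
  have norm_le : ‖φ (t - x)‖ ≤ SchwartzMap.seminorm ℝ 0 0 φ := SchwartzMap.norm_le_seminorm ℝ φ _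
  have norm_mul_le : ‖t - x‖ * ‖φ (t - x)‖ ≤ SchwartzMap.seminorm ℝ 1 0 φ := by
    simpa using SchwartzMap.le_seminorm ℝ 1 0 φ (t - x)
  have seminorm_nonneg : 0 ≤ SchwartzMap.seminorm ℝ 1 0 φ := apply_nonneg _ _
  calc ‖t‖ * ‖φ (t - x)‖ ≤ (‖t - x‖ + ‖x‖) * ‖φ (t - x)‖ := by
        gcongr
        exact norm_le_norm_sub_add t x
    _ = ‖t - x‖ * ‖φ (t - x)‖ + ‖x‖ * ‖φ (t - x)‖ := add_mul _ _ _
    _ ≤ SchwartzMap.seminorm ℝ 1 0 φ + ‖x‖ * SchwartzMap.seminorm ℝ 0 0 φ := by gcongr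
    _ ≤ _ := by nlinarith [norm_nonneg x, norm_nonneg (φ (t - x))]

end SchwartzOperators

section CoordMul

variable {E : Type*} [NormedAddCommGroup E] [InnerProductSpace ℝ E]

/-- Multiplication of Schwartz functions by the linear function `t ↦ ⟨t, v⟩`. -/
def coordMul (v : E) : 𝓢(E, ℂ) →L[ℂ] 𝓢(E, ℂ) :=
  SchwartzMap.smulLeftCLM ℂ fun t : E => ((inner ℝ t v : ℝ) : ℂ)

lemma coordMul_apply (v : E) (φ : 𝓢(E, ℂ)) (t : E) :
    coordMul v φ t = (inner ℝ t v : ℝ) * φ t := by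
  have hasTemperateGrowth : (fun t : E => ((inner ℝ t v : ℝ) : ℂ)).HasTemperateGrowth :=
    Complex.ofRealCLM.hasTemperateGrowth.comp (Function.hasTemperateGrowth_inner_left v)
  simp [coordMul, SchwartzMap.smulLeftCLM_apply_apply hasTemperateGrowth]

end CoordMul

section Atoms

variable {d : ℕ}

lemma norm_character (ξ t : Rd d) : ‖character ξ t‖ = 1 := by
  simp [character, Complex.norm_exp]

lemma norm_character_sub_le (ξ ξ' t : Rd d) :
    ‖character ξ' t - character ξ t‖ ≤ ‖t‖ * ‖ξ' - ξ‖ := by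
  have factor : character ξ' t - character ξ t =
      character ξ t * (Complex.exp (Complex.I * ((inner ℝ t (ξ - ξ') : ℝ) : ℂ)) - 1) := by
    rw [character, character, mul_sub, ← Complex.exp_add, mul_one, inner_sub_right]
    congr 2
    push_cast
    ring
  rw [factor, norm_mul, norm_character, one_mul, norm_sub_rev ξ']
  exact Real.norm_exp_I_mul_ofReal_sub_one_le.trans (norm_inner_le_norm _ _)

lemma hasFDerivAt_character (ξ t : Rd d) : HasFDerivAt (character ξ)
    (character ξ t • -(Complex.ofRealCLM.comp (innerSL ℝ ξ)).smulRight Complex.I) t := by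
  have hasFDerivAt_inner : HasFDerivAt (fun t : Rd d => ((inner ℝ t ξ : ℝ) : ℂ) * Complex.I)
      ((Complex.ofRealCLM.comp (innerSL ℝ ξ)).smulRight Complex.I) t := by
    refine HasFDerivAt.congr_of_eventuallyEq
      ((Complex.ofRealCLM.comp (innerSL ℝ ξ)).smulRight Complex.I).hasFDerivAt
      (Eventually.of_forall fun s => ?_)
    simp [real_inner_comm]
  exact hasFDerivAt_inner.neg.cexp

lemma stftAtom_eq_character_mul (g : 𝓢(Rd d, ℂ)) (x ξ t : Rd d) :
    stftAtom g x ξ t = character ξ t * conj (g (t - x)) :=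
  stftAtom_apply g x ξ t

lemma norm_stftAtom_apply (g : 𝓢(Rd d, ℂ)) (x ξ t : Rd d) : ‖stftAtom g x ξ t‖ = ‖g (t - x)‖ := by
  rw [stftAtom_eq_character_mul, norm_mul, norm_character, one_mul, RCLike.norm_conj]

lemma norm_toBCF_stftAtom_le (g : 𝓢(Rd d, ℂ)) (x ξ : Rd d) :
    ‖toBCF (stftAtom g x ξ)‖ ≤ SchwartzMap.seminorm ℝ 0 0 g :=
  (BoundedContinuousFunction.norm_le (apply_nonneg _ _)).2 fun t =>
    (norm_stftAtom_apply g x ξ t).trans_le (SchwartzMap.norm_le_seminorm ℝ g _)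

lemma norm_toBCF_stftAtom_sub_le (g : 𝓢(Rd d, ℂ)) (x x' ξ ξ' : Rd d) :
    ‖toBCF (stftAtom g x' ξ') - toBCF (stftAtom g x ξ)‖ ≤
      SchwartzMap.seminorm ℝ 0 1 g * ‖x' - x‖ +
        (SchwartzMap.seminorm ℝ 1 0 g + SchwartzMap.seminorm ℝ 0 0 g) * (1 + ‖x‖) * ‖ξ' - ξ‖ := by
  refine (BoundedContinuousFunction.norm_le (by positivity)).2 fun t => ?_
  have split : (toBCF (stftAtom g x' ξ') - toBCF (stftAtom g x ξ)) t =
      character ξ' t * conj (g (t - x') - g (t - x)) +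
        (character ξ' t - character ξ t) * conj (g (t - x)) := by
    change stftAtom g x' ξ' t - stftAtom g x ξ t = _
    rw [stftAtom_eq_character_mul, stftAtom_eq_character_mul, map_sub (starRingEnd ℂ)]
    ring
  rw [split]
  refine (norm_add_le _ _).trans (add_le_add ?_ ?_)
  · rw [norm_mul, norm_character, one_mul, RCLike.norm_conj]
    refine (norm_schwartz_sub_le g _ _).trans_eq ?_
    rw [sub_sub_sub_cancel_left, norm_sub_rev]
  · rw [norm_mul, RCLike.norm_conj]
    calc _ ≤ ‖t‖ * ‖ξ' - ξ‖ * ‖g (t - x)‖ := by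
          gcongr
          exact norm_character_sub_le ξ ξ' t
      _ = ‖t‖ * ‖g (t - x)‖ * ‖ξ' - ξ‖ := by ring
      _ ≤ _ := by gcongr ?_ * _; exact norm_mul_norm_schwartz_sub_le g t x

lemma continuous_toBCF_stftAtom (g : 𝓢(Rd d, ℂ)) :
    Continuous fun z : Rd d × Rd d => toBCF (stftAtom g z.1 z.2) := by
  refine continuous_iff_continuousAt.2 fun z => tendsto_iff_norm_sub_tendsto_zero.2 ?_
  refine squeeze_zero (fun _ => norm_nonneg _)
    (fun z' => norm_toBCF_stftAtom_sub_le g z.1 z'.1 z.2 z'.2) ?_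
  have continuous_bound : Continuous fun z' : Rd d × Rd d =>
      SchwartzMap.seminorm ℝ 0 1 g * ‖z'.1 - z.1‖ +
        (SchwartzMap.seminorm ℝ 1 0 g + SchwartzMap.seminorm ℝ 0 0 g) * (1 + ‖z.1‖) *
          ‖z'.2 - z.2‖ := by fun_prop
  simpa using continuous_bound.tendsto z

lemma lineDerivOp_stftAtom (v : Rd d) (g : 𝓢(Rd d, ℂ)) (x ξ : Rd d) :
    ∂_{v} (stftAtom g x ξ) =
      (-((inner ℝ v ξ : ℝ) * Complex.I)) • stftAtom g x ξ + stftAtom (∂_{v} g) x ξ := by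
  ext t
  have hasFDerivAt_sub : HasFDerivAt (fun t => g (t - x)) (fderiv ℝ g (t - x)) t := by
    simpa only [ContinuousLinearMap.comp_id, Function.comp_def, id] using
      g.differentiableAt.hasFDerivAt.comp t ((hasFDerivAt_id t).sub_const x)
  have hasFDerivAt_atom := (hasFDerivAt_character ξ t).mul
    ((Complex.conjCLE : ℂ →L[ℝ] ℂ).hasFDerivAt.comp t hasFDerivAt_sub)
  have fderiv_atom : fderiv ℝ (stftAtom g x ξ) t = _ :=
    (hasFDerivAt_atom.congr_of_eventuallyEq
      (Eventually.of_forall (stftAtom_eq_character_mul g x ξ))).fderiv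
  rw [SchwartzMap.lineDerivOp_apply_eq_fderiv, fderiv_atom]
  simp only [_root_.add_apply, _root_.smul_apply, stftAtom_eq_character_mul,
    SchwartzMap.lineDerivOp_apply_eq_fderiv]
  simp [real_inner_comm]
  ring

lemma coordMul_stftAtom (v : Rd d) (g : 𝓢(Rd d, ℂ)) (x ξ : Rd d) :
    coordMul v (stftAtom g x ξ) =
      ((inner ℝ x v : ℝ) : ℂ) • stftAtom g x ξ + stftAtom (coordMul v g) x ξ := by
  ext t
  simp only [_root_.add_apply, _root_.smul_apply, stftAtom_apply, coordMul_apply,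
    inner_sub_left, map_mul, Complex.conj_ofReal, smul_eq_mul]
  push_cast
  ring

end Atoms

section WeylMonomials

variable {E : Type*} [NormedAddCommGroup E] [InnerProductSpace ℝ E] {d : ℕ}

/-- The monomials of the Weyl algebra: compositions of directional derivatives and multiplications
by coordinates, as operators on Schwartz functions. -/
inductive IsWeylMonomial : (𝓢(E, ℂ) →L[ℂ] 𝓢(E, ℂ)) → Prop
  | id : IsWeylMonomial (ContinuousLinearMap.id ℂ 𝓢(E, ℂ))
  | comp_lineDerivOp {P : 𝓢(E, ℂ) →L[ℂ] 𝓢(E, ℂ)} (hP : IsWeylMonomial P) (v : E) :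
      IsWeylMonomial (P.comp (LineDeriv.lineDerivOpCLM ℂ 𝓢(E, ℂ) v))
  | comp_coordMul {P : 𝓢(E, ℂ) →L[ℂ] 𝓢(E, ℂ)} (hP : IsWeylMonomial P) (v : E) :
      IsWeylMonomial (P.comp (coordMul v))

namespace IsWeylMonomial

lemma comp_iteratedLineDerivOp {n : ℕ} (m : Fin n → E) {P : 𝓢(E, ℂ) →L[ℂ] 𝓢(E, ℂ)}
    (hP : IsWeylMonomial P) :
    IsWeylMonomial (P.comp (LineDeriv.iteratedLineDerivOpCLM ℂ 𝓢(E, ℂ) m)) := by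
  induction n generalizing P with
  | zero =>
    convert hP using 1
    ext φ t
    simp
  | succ n ih => exact ih (Fin.tail m) (hP.comp_lineDerivOp (m 0))

lemma exists_transpose [FiniteDimensional ℝ E] [MeasurableSpace E] [BorelSpace E] (μ : Measure E)
    [μ.IsAddHaarMeasure] {P : 𝓢(E, ℂ) →L[ℂ] 𝓢(E, ℂ)} (hP : IsWeylMonomial P) :
    ∃ Q : 𝓢(E, ℂ) → 𝓢(E, ℂ), ∀ φ ψ : 𝓢(E, ℂ), ∫ t, ψ t * P φ t ∂μ = ∫ t, Q ψ t * φ t ∂μ := by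
  induction hP with
  | id => exact ⟨_root_.id, fun _ _ => rfl⟩
  | comp_lineDerivOp _ v ih =>
    obtain ⟨Q, hQ⟩ := ih
    refine ⟨fun ψ => -∂_{v} (Q ψ), fun φ ψ => ?_⟩
    simp only [ContinuousLinearMap.comp_apply, hQ, LineDeriv.lineDerivOpCLM_apply,
      SchwartzMap.integral_mul_lineDerivOp_right_eq_neg_left, _root_.neg_apply, neg_mul,
      integral_neg]
  | comp_coordMul _ v ih =>
    obtain ⟨Q, hQ⟩ := ih
    refine ⟨fun ψ => coordMul v (Q ψ), fun φ ψ => ?_⟩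
    simp only [ContinuousLinearMap.comp_apply, hQ, coordMul_apply]
    exact integral_congr_ae (Eventually.of_forall fun t => by ring)

lemma continuous_atom {P : 𝓢(Rd d, ℂ) →L[ℂ] 𝓢(Rd d, ℂ)} (hP : IsWeylMonomial P)
    (g : 𝓢(Rd d, ℂ)) : Continuous fun z : Rd d × Rd d => toBCF (P (stftAtom g z.1 z.2)) := by
  induction hP generalizing g with
  | id => exact continuous_toBCF_stftAtom g
  | comp_lineDerivOp _ v ih =>
    simp only [ContinuousLinearMap.comp_apply, LineDeriv.lineDerivOpCLM_apply,
      lineDerivOp_stftAtom, map_add, map_smul]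
    exact ((by fun_prop : Continuous fun z : Rd d × Rd d =>
      -((inner ℝ v z.2 : ℝ) * Complex.I)).smul (ih g)).add (ih _)
  | comp_coordMul _ v ih =>
    simp only [ContinuousLinearMap.comp_apply, coordMul_stftAtom, map_add, map_smul]
    exact ((by fun_prop : Continuous fun z : Rd d × Rd d =>
      ((inner ℝ z.1 v : ℝ) : ℂ)).smul (ih g)).add (ih _)

end IsWeylMonomial

lemma exists_norm_smul_add_le_phaseWeight {V : Type*} [NormedAddCommGroup V] [NormedSpace ℂ V]
    {F F' : Rd d × Rd d → V} {c : Rd d × Rd d → ℂ} {A : ℝ}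
    (hA : 0 ≤ A) (hc : ∀ z, ‖c z‖ ≤ A * phaseWeight z)
    (hF : ∃ (C : ℝ) (n : ℕ), 0 ≤ C ∧ ∀ z, ‖F z‖ ≤ C * phaseWeight z ^ n)
    (hF' : ∃ (C : ℝ) (n : ℕ), 0 ≤ C ∧ ∀ z, ‖F' z‖ ≤ C * phaseWeight z ^ n) :
    ∃ (C : ℝ) (n : ℕ), 0 ≤ C ∧ ∀ z, ‖c z • F z + F' z‖ ≤ C * phaseWeight z ^ n := by
  obtain ⟨C, n, hC, h⟩ := hF
  obtain ⟨C', n', hC', h'⟩ := hF'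
  refine ⟨A * C + C', n + n' + 1, by positivity, fun z => ?_⟩
  have one_le := one_le_phaseWeight z
  calc ‖c z • F z + F' z‖ ≤ ‖c z‖ * ‖F z‖ + ‖F' z‖ :=
        (norm_add_le _ _).trans_eq (by rw [norm_smul])
    _ ≤ A * phaseWeight z * (C * phaseWeight z ^ n) + C' * phaseWeight z ^ n' := by
        gcongr
        exacts [hc z, h z, h' z]
    _ = A * C * phaseWeight z ^ (n + 1) + C' * phaseWeight z ^ n' := by ring
    _ ≤ A * C * phaseWeight z ^ (n + n' + 1) + C' * phaseWeight z ^ (n + n' + 1) := by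
        gcongr <;> first | exact one_le | omega
    _ = _ := (add_mul _ _ _).symm

lemma IsWeylMonomial.norm_atom_le {P : 𝓢(Rd d, ℂ) →L[ℂ] 𝓢(Rd d, ℂ)} (hP : IsWeylMonomial P)
    (g : 𝓢(Rd d, ℂ)) : ∃ (C : ℝ) (n : ℕ), 0 ≤ C ∧
      ∀ z : Rd d × Rd d, ‖toBCF (P (stftAtom g z.1 z.2))‖ ≤ C * phaseWeight z ^ n := by
  induction hP generalizing g with
  | id =>
    refine ⟨SchwartzMap.seminorm ℝ 0 0 g, 0, apply_nonneg _ _, fun z => ?_⟩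
    rw [pow_zero, mul_one]
    exact norm_toBCF_stftAtom_le g z.1 z.2
  | comp_lineDerivOp _ v ih =>
    simp only [ContinuousLinearMap.comp_apply, LineDeriv.lineDerivOpCLM_apply,
      lineDerivOp_stftAtom, map_add, map_smul]
    refine exists_norm_smul_add_le_phaseWeight (norm_nonneg v) (fun z => ?_) (ih g) (ih _)
    simp only [norm_neg, norm_mul, Complex.norm_real, Complex.norm_I, mul_one]
    refine (norm_inner_le_norm _ _).trans ?_
    gcongr
    exact norm_snd_le_phaseWeight z
  | comp_coordMul _ v ih =>
    simp only [ContinuousLinearMap.comp_apply, coordMul_stftAtom, map_add, map_smul]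
    refine exists_norm_smul_add_le_phaseWeight (norm_nonneg v) (fun z => ?_) (ih g) (ih _)
    rw [Complex.norm_real, mul_comm]
    refine (norm_inner_le_norm _ _).trans ?_
    gcongr
    exact norm_fst_le_phaseWeight z

end WeylMonomials

/-! ### Tempered distributions factor through bounded continuous functions -/

section WeylBounded

variable {E : Type*} [NormedAddCommGroup E] [InnerProductSpace ℝ E]

/-- A function on the Schwartz space is Weyl bounded if it is dominated by finitely many sup norms
of Weyl monomials. -/
def IsWeylBounded (q : 𝓢(E, ℂ) → ℝ) : Prop :=
  ∃ (ι : Type) (_ : Fintype ι) (P : ι → 𝓢(E, ℂ) →L[ℂ] 𝓢(E, ℂ)) (C : ℝ), 0 ≤ C ∧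
    (∀ i, IsWeylMonomial (P i)) ∧ ∀ φ, q φ ≤ C * ∑ i, ‖toBCF (P i φ)‖

namespace IsWeylBounded

lemma norm_toBCF : IsWeylBounded fun φ : 𝓢(E, ℂ) => ‖toBCF φ‖ :=
  ⟨Unit, inferInstance, fun _ => ContinuousLinearMap.id ℂ _, 1, zero_le_one,
    fun _ => IsWeylMonomial.id, fun φ => by simp⟩

lemma mono {q q' : 𝓢(E, ℂ) → ℝ} (h : IsWeylBounded q') (hle : ∀ φ, q φ ≤ q' φ) :
    IsWeylBounded q := by
  obtain ⟨ι, hι, P, C, hC, hP, h⟩ := h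
  exact ⟨ι, hι, P, C, hC, hP, fun φ => (hle φ).trans (h φ)⟩

lemma const_mul {q : 𝓢(E, ℂ) → ℝ} (h : IsWeylBounded q) {c : ℝ} (hc : 0 ≤ c) :
    IsWeylBounded fun φ => c * q φ := by
  obtain ⟨ι, hι, P, C, hC, hP, h⟩ := h
  refine ⟨ι, hι, P, c * C, by positivity, hP, fun φ => ?_⟩
  rw [mul_assoc]
  exact mul_le_mul_of_nonneg_left (h φ) hc

lemma sum {κ : Type} (s : Finset κ) {q : κ → 𝓢(E, ℂ) → ℝ}
    (h : ∀ k, IsWeylBounded (q k)) : IsWeylBounded fun φ => ∑ k ∈ s, q k φ := by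
  choose ι hι P C hC hP h using h
  refine ⟨Σ k : s, ι k, inferInstance, fun a => P a.1 a.2, ∑ k ∈ s, C k,
    Finset.sum_nonneg fun k _ => hC k, fun a => hP _ _, fun φ => ?_⟩
  rw [Finset.sum_mul]
  refine Finset.sum_le_sum fun k hk => (h k φ).trans (mul_le_mul_of_nonneg_left ?_ (hC k))
  rw [Fintype.sum_sigma]
  exact Finset.single_le_sum (f := fun k : s => ∑ i, ‖toBCF (P k i φ)‖)
    (fun _ _ => Finset.sum_nonneg fun _ _ => norm_nonneg _) (Finset.mem_univ (⟨k, hk⟩ : s))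

lemma comp {q : 𝓢(E, ℂ) → ℝ} (h : IsWeylBounded q) {Q : 𝓢(E, ℂ) →L[ℂ] 𝓢(E, ℂ)}
    (hQ : ∀ P, IsWeylMonomial P → IsWeylMonomial (P.comp Q)) :
    IsWeylBounded fun φ => q (Q φ) := by
  obtain ⟨ι, hι, P, C, hC, hP, h⟩ := h
  exact ⟨ι, hι, fun i => (P i).comp Q, C, hC, fun i => hQ _ (hP i), fun φ => h (Q φ)⟩

end IsWeylBounded

variable {κ : Type} [Fintype κ] (b : OrthonormalBasis κ ℝ E)

include b

lemma norm_le_sum_abs_inner (t : E) : ‖t‖ ≤ ∑ j, |inner ℝ t (b j)| :=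
  calc ‖t‖ = ‖∑ j, inner ℝ (b j) t • b j‖ := by rw [b.sum_repr']
    _ ≤ ∑ j, ‖inner ℝ (b j) t • b j‖ := norm_sum_le _ _
    _ = ∑ j, |inner ℝ t (b j)| := by
        simp only [norm_smul, b.norm_eq_one, mul_one, real_inner_comm, Real.norm_eq_abs]

lemma norm_multilinear_le_sum {n : ℕ} (T : ContinuousMultilinearMap ℝ (fun _ : Fin n => E) ℂ) :
    ‖T‖ ≤ ∑ r : Fin n → κ, ‖T fun i => b (r i)‖ := by
  refine ContinuousMultilinearMap.opNorm_le_bound (Finset.sum_nonneg fun _ _ => norm_nonneg _)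
    fun v => ?_
  conv_lhs => rw [← funext fun i => b.sum_repr' (v i)]
  classical
  rw [ContinuousMultilinearMap.map_sum, Finset.sum_mul]
  refine (norm_sum_le _ _).trans (Finset.sum_le_sum fun r _ => ?_)
  rw [ContinuousMultilinearMap.map_smul_univ, norm_smul, mul_comm, norm_prod]
  gcongr with i
  exact (norm_inner_le_norm _ _).trans_eq (by rw [b.norm_eq_one, one_mul])

lemma exists_isWeylBounded_pow_mul_le (k : ℕ) : ∃ q : 𝓢(E, ℂ) → ℝ, IsWeylBounded q ∧
    ∀ φ t, ‖t‖ ^ k * ‖φ t‖ ≤ q φ := by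
  induction k with
  | zero =>
    refine ⟨_, IsWeylBounded.norm_toBCF, fun φ t => ?_⟩
    rw [pow_zero, one_mul]
    exact (toBCF φ).norm_coe_le_norm t
  | succ k ih =>
    obtain ⟨q, hq, h⟩ := ih
    refine ⟨fun φ => ∑ j, q (coordMul (b j) φ),
      IsWeylBounded.sum _ fun j => hq.comp fun P hP => hP.comp_coordMul _, fun φ t => ?_⟩
    calc ‖t‖ ^ (k + 1) * ‖φ t‖ = ‖t‖ * (‖t‖ ^ k * ‖φ t‖) := by ring
      _ ≤ (∑ j, |inner ℝ t (b j)|) * (‖t‖ ^ k * ‖φ t‖) := by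
          gcongr
          exact norm_le_sum_abs_inner b t
      _ = ∑ j, ‖t‖ ^ k * ‖coordMul (b j) φ t‖ := by
          simp only [Finset.sum_mul, coordMul_apply, norm_mul, Complex.norm_real,
            Real.norm_eq_abs, mul_left_comm (‖t‖ ^ k)]
      _ ≤ _ := Finset.sum_le_sum fun j _ => h _ t

lemma isWeylBounded_seminorm (k n : ℕ) :
    IsWeylBounded fun φ : 𝓢(E, ℂ) => SchwartzMap.seminorm ℂ k n φ := by
  obtain ⟨q, hq, h⟩ := exists_isWeylBounded_pow_mul_le b k
  refine (IsWeylBounded.sum Finset.univ fun r : Fin n → κ =>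
    hq.comp (Q := LineDeriv.iteratedLineDerivOpCLM ℂ 𝓢(E, ℂ) fun i => b (r i))
      fun P hP => hP.comp_iteratedLineDerivOp _).mono fun φ => ?_
  have pow_mul_le (t : E) : ‖t‖ ^ k * ‖iteratedFDeriv ℝ n φ t‖ ≤ ∑ r : Fin n → κ,
      q (LineDeriv.iteratedLineDerivOpCLM ℂ 𝓢(E, ℂ) (fun i => b (r i)) φ) := by
    refine (mul_le_mul_of_nonneg_left (norm_multilinear_le_sum b _) (by positivity)).trans ?_
    rw [Finset.mul_sum]
    refine Finset.sum_le_sum fun r _ => le_trans (le_of_eq ?_) (h _ t)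
    rw [LineDeriv.iteratedLineDerivOpCLM_apply, SchwartzMap.iteratedLineDerivOp_eq_iteratedFDeriv]
  exact SchwartzMap.seminorm_le_bound ℂ k n φ
    ((by positivity : (0 : ℝ) ≤ ‖(0 : E)‖ ^ k * ‖iteratedFDeriv ℝ n φ 0‖).trans
      (pow_mul_le 0)) pow_mul_le

omit b in
lemma seminorm_sum_apply {𝕜 V ι : Type*} [SeminormedRing 𝕜] [AddCommGroup V] [Module 𝕜 V]
    (s : Finset ι) (q : ι → Seminorm 𝕜 V) (v : V) : (∑ k ∈ s, q k) v = ∑ k ∈ s, q k v :=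
  map_sum (⟨⟨fun p : Seminorm 𝕜 V => p v, rfl⟩, fun _ _ => rfl⟩ : Seminorm 𝕜 V →+ ℝ) q s

omit b in
lemma isWeylBounded_of_continuous [FiniteDimensional ℝ E] {q : Seminorm ℂ 𝓢(E, ℂ)}
    (hq : Continuous q) : IsWeylBounded q := by
  obtain ⟨s, C, -, h⟩ := Seminorm.bound_of_continuous (schwartz_withSeminorms ℂ E ℂ) q hq
  refine ((IsWeylBounded.sum s fun m : ℕ × ℕ =>
    isWeylBounded_seminorm (stdOrthonormalBasis ℝ E) m.1 m.2).const_mul C.2).mono fun φ => ?_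
  refine (h φ).trans (mul_le_mul_of_nonneg_left ?_ C.2)
  exact (Seminorm.finset_sup_le_sum (schwartzSeminormFamily ℂ E ℂ) s φ).trans_eq
    (seminorm_sum_apply s _ φ)

end WeylBounded

lemma exists_strongDual_comp_eq {𝕜 V F : Type*} [RCLike 𝕜] [AddCommGroup V] [Module 𝕜 V]
    [NormedAddCommGroup F] [NormedSpace 𝕜 F] (f : V →ₗ[𝕜] 𝕜) (T : V →ₗ[𝕜] F) (C : ℝ)
    (h : ∀ v, ‖f v‖ ≤ C * ‖T v‖) : ∃ L : F →L[𝕜] 𝕜, ∀ v, f v = L (T v) := by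
  have mem_range : f ∈ LinearMap.range T.dualMap := by
    rw [LinearMap.range_dualMap_eq_dualAnnihilator_ker, Submodule.mem_dualAnnihilator]
    intro v hv
    simpa [LinearMap.mem_ker.1 hv] using h v
  obtain ⟨L₀, rfl⟩ := mem_range
  obtain ⟨L, hL, -⟩ := exists_extension_norm_eq (LinearMap.range T)
    ((L₀.domRestrict (LinearMap.range T)).mkContinuous C (by rintro ⟨-, v, rfl⟩; exact h v))
  exact ⟨L, fun v => (hL ⟨T v, LinearMap.mem_range_self T v⟩).symm⟩

section Factorization

variable {d : ℕ} {ι : Type}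

/-- The joint map `φ ↦ (P i φ)ᵢ` of a finite family of operators on Schwartz functions, with values
in a Banach space. -/
def jointBCF {E : Type*} [NormedAddCommGroup E] [NormedSpace ℝ E]
    (P : ι → 𝓢(E, ℂ) →L[ℂ] 𝓢(E, ℂ)) : 𝓢(E, ℂ) →L[ℂ] (ι → E →ᵇ ℂ) :=
  ContinuousLinearMap.pi fun i => toBCF.comp (P i)

lemma exists_factorization {E : Type*} [NormedAddCommGroup E] [InnerProductSpace ℝ E]
    [FiniteDimensional ℝ E] (f : 𝓢'(E, ℂ)) :
    ∃ (ι : Type) (_ : Fintype ι) (P : ι → 𝓢(E, ℂ) →L[ℂ] 𝓢(E, ℂ))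
      (L : (ι → E →ᵇ ℂ) →L[ℂ] ℂ), (∀ i, IsWeylMonomial (P i)) ∧ ∀ φ, f φ = L (jointBCF P φ) := by
  have continuous_f : Continuous fun φ : 𝓢(E, ℂ) => f φ := ContinuousLinearMap.continuous f
  obtain ⟨ι, hι, P, C, hC, hP, h⟩ := isWeylBounded_of_continuous
    (q := (normSeminorm ℂ ℂ).comp (ContinuousLinearMap.toLinearMap f)) continuous_f.norm
  obtain ⟨L, hL⟩ := exists_strongDual_comp_eq (ContinuousLinearMap.toLinearMap f)
    (jointBCF P).toLinearMap (C * Fintype.card ι) fun φ => by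
      rw [mul_assoc, ← nsmul_eq_mul, ← Finset.card_univ, ← Finset.sum_const]
      exact (h φ).trans (mul_le_mul_of_nonneg_left
        (Finset.sum_le_sum fun i _ => norm_le_pi_norm (jointBCF P φ) i) hC)
  exact ⟨ι, hι, P, L, hP, hL⟩

lemma continuous_jointBCF_stftAtom {P : ι → 𝓢(Rd d, ℂ) →L[ℂ] 𝓢(Rd d, ℂ)}
    (hP : ∀ i, IsWeylMonomial (P i)) (g : 𝓢(Rd d, ℂ)) :
    Continuous fun z : Rd d × Rd d => jointBCF P (stftAtom g z.1 z.2) :=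
  continuous_pi fun i => (hP i).continuous_atom g

lemma norm_jointBCF_stftAtom_le [Fintype ι] {P : ι → 𝓢(Rd d, ℂ) →L[ℂ] 𝓢(Rd d, ℂ)}
    (hP : ∀ i, IsWeylMonomial (P i)) (g : 𝓢(Rd d, ℂ)) :
    ∃ (C : ℝ) (n : ℕ), 0 ≤ C ∧ ∀ z : Rd d × Rd d,
      ‖jointBCF P (stftAtom g z.1 z.2)‖ ≤ C * phaseWeight z ^ n := by
  choose C n hC h using fun i => (hP i).norm_atom_le g
  have sum_nonneg : 0 ≤ ∑ i, C i := Finset.sum_nonneg fun i _ => hC i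
  refine ⟨∑ i, C i, ∑ i, n i, sum_nonneg, fun z => ?_⟩
  have one_le := one_le_phaseWeight z
  refine (pi_norm_le_iff_of_nonneg (by positivity)).2 fun i => (h i z).trans ?_
  gcongr
  · exact Finset.single_le_sum (fun i _ => hC i) (Finset.mem_univ i)
  · exact Finset.single_le_sum (fun i _ => Nat.zero_le _) (Finset.mem_univ i)

lemma continuous_stft (g : 𝓢(Rd d, ℂ)) (f : 𝓢'(Rd d, ℂ)) : Continuous (stft g f) := by
  obtain ⟨ι, _, P, L, hP, h⟩ := exists_factorization f
  rw [show stft g f = fun z => L (jointBCF P (stftAtom g z.1 z.2)) from funext fun z => h _]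
  exact L.continuous.comp (continuous_jointBCF_stftAtom hP g)

end Factorization

/-! ### Pairings with time-frequency shifts -/

section SchwartzIntegrals

variable {E : Type*} [NormedAddCommGroup E] [NormedSpace ℝ E] [MeasurableSpace E] [BorelSpace E]
  [FiniteDimensional ℝ E] {μ : Measure E} [μ.IsAddHaarMeasure]

lemma integrable_schwartz_mul_bcf (ψ : 𝓢(E, ℂ)) (u : E →ᵇ ℂ) : Integrable (fun t => ψ t * u t) μ :=
  ψ.integrable.mul_bdd u.continuous.aestronglyMeasurable
    (Eventually.of_forall fun t => u.norm_coe_le_norm t)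

lemma integrable_schwartz_mul_conj (φ ψ : 𝓢(E, ℂ)) : Integrable (fun t => φ t * conj (ψ t)) μ :=
  integrable_schwartz_mul_bcf φ (toBCF (schwartzConj ψ))

lemma integrable_norm_schwartz_sq (φ : 𝓢(E, ℂ)) : Integrable (fun t => ‖φ t‖ ^ 2) μ :=
  (integrable_schwartz_mul_conj φ φ).norm.congr (Eventually.of_forall fun t => by simp [sq])

lemma integral_norm_schwartz_sq_pos {φ : 𝓢(E, ℂ)} (hφ : φ ≠ 0) : 0 < ∫ t, ‖φ t‖ ^ 2 ∂μ := by
  have continuous_sq : Continuous fun t => ‖φ t‖ ^ 2 := by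
    have := φ.continuous
    fun_prop
  obtain ⟨t, ht⟩ : ∃ t, φ t ≠ 0 := by
    by_contra! h
    exact hφ (SchwartzMap.ext h)
  exact (integral_pos_iff_support_of_nonneg (fun t => sq_nonneg _)
    (integrable_norm_schwartz_sq φ)).2
      (continuous_sq.isOpen_support.measure_pos μ ⟨t, by simpa using ht⟩)

lemma eq_zero_of_integral_schwartz_mul_eq_zero {u : E →ᵇ ℂ}
    (h : ∀ ψ : 𝓢(E, ℂ), ∫ t, ψ t * u t ∂μ = 0) : u = 0 := by
  have ae_eq_zero : u =ᵐ[μ] fun _ => 0 := by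
    refine ae_eq_zero_of_integral_contDiff_smul_eq_zero u.continuous.locallyIntegrable
      fun η smooth_η compact_η => ?_
    have smooth_ofReal : ContDiff ℝ (⊤ : ℕ∞) fun t => ((η t : ℝ) : ℂ) :=
      Complex.ofRealCLM.contDiff.comp smooth_η
    have compact_ofReal : HasCompactSupport fun t => ((η t : ℝ) : ℂ) :=
      compact_η.comp_left (g := fun r : ℝ => (r : ℂ)) Complex.ofReal_zero
    simpa using h (compact_ofReal.toSchwartzMap smooth_ofReal)
  ext t
  exact congrFun ((Continuous.ae_eq_iff_eq μ u.continuous continuous_const).1 ae_eq_zero) t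

variable (μ) in
lemma exists_clm_integral_schwartz (ψ : 𝓢(E, ℂ)) :
    ∃ T : (E →ᵇ ℂ) →L[ℂ] ℂ, ∀ u, T u = ∫ t, ψ t * u t ∂μ := by
  refine ⟨LinearMap.mkContinuous
    { toFun := fun u : E →ᵇ ℂ => ∫ t, ψ t * u t ∂μ
      map_add' := fun u v => by
        rw [← integral_add (integrable_schwartz_mul_bcf ψ u) (integrable_schwartz_mul_bcf ψ v)]
        simp only [BoundedContinuousFunction.coe_add, Pi.add_apply, mul_add]
      map_smul' := fun c u => by
        rw [RingHom.id_apply, smul_eq_mul, ← integral_const_mul]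
        simp only [BoundedContinuousFunction.coe_smul, smul_eq_mul, mul_left_comm] }
    (∫ t, ‖ψ t‖ ∂μ) fun u => ?_, fun u => rfl⟩
  refine (norm_integral_le_integral_norm _).trans ?_
  rw [← integral_mul_const]
  refine integral_mono (integrable_schwartz_mul_bcf ψ u).norm (ψ.integrable.norm.mul_const _)
    fun t => ?_
  simp only [norm_mul]
  gcongr
  exact u.norm_coe_le_norm t

end SchwartzIntegrals

section Pairing

variable {d : ℕ}

/-- The short-time Fourier transform of a Schwartz function `φ` up to conjugations: the pairing
`∫ φ(t) g(t - x) e^{i t·ξ} dt` of `φ` with the conjugate of an atom. -/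
def shiftPairing (g φ : 𝓢(Rd d, ℂ)) (z : Rd d × Rd d) : ℂ :=
  ∫ t, φ t * conj (stftAtom g z.1 z.2 t)

lemma conj_shiftPairing (g φ : 𝓢(Rd d, ℂ)) (z : Rd d × Rd d) :
    conj (shiftPairing g φ z) = ∫ t, schwartzConj φ t * stftAtom g z.1 z.2 t := by
  rw [shiftPairing, ← integral_conj]
  simp only [map_mul, Complex.conj_conj, schwartzConj_apply]

lemma conj_shiftPairing_eq_stft (g φ : 𝓢(Rd d, ℂ)) (z : Rd d × Rd d) :
    conj (shiftPairing g φ z) =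
      stft g (SchwartzMap.toTemperedDistributionCLM (Rd d) ℂ volume (schwartzConj φ)) z := by
  rw [conj_shiftPairing, stft,
    SchwartzMap.toTemperedDistributionCLM_apply_apply (μ := volume)]
  simp only [smul_eq_mul, mul_comm]

lemma continuous_shiftPairing (g φ : 𝓢(Rd d, ℂ)) : Continuous (shiftPairing g φ) := by
  have h := Complex.continuous_conj.comp (continuous_stft g
    (SchwartzMap.toTemperedDistributionCLM (Rd d) ℂ volume (schwartzConj φ)))
  refine h.congr fun z => ?_
  rw [Function.comp_apply, ← conj_shiftPairing_eq_stft, Complex.conj_conj]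

lemma shiftPairing_coordMul (g φ : 𝓢(Rd d, ℂ)) (v : Rd d) (z : Rd d × Rd d) :
    (inner ℝ z.1 v : ℝ) * shiftPairing g φ z =
      shiftPairing g (coordMul v φ) z - shiftPairing (coordMul v g) φ z := by
  have transpose : shiftPairing g (coordMul v φ) z =
      ∫ t, φ t * conj (coordMul v (stftAtom g z.1 z.2) t) := by
    refine integral_congr_ae (Eventually.of_forall fun t => ?_)
    simp only [coordMul_apply, map_mul, Complex.conj_ofReal]
    ring
  rw [transpose, coordMul_stftAtom, eq_sub_iff_add_eq, shiftPairing, shiftPairing,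
    ← integral_const_mul, ← integral_add ((integrable_schwartz_mul_conj _ _).const_mul _)
      (integrable_schwartz_mul_conj _ _)]
  refine integral_congr_ae (Eventually.of_forall fun t => ?_)
  simp only [_root_.add_apply, _root_.smul_apply, map_add, smul_eq_mul, map_mul,
    Complex.conj_ofReal]
  ring

lemma shiftPairing_lineDerivOp (g φ : 𝓢(Rd d, ℂ)) (v : Rd d) (z : Rd d × Rd d) :
    ((inner ℝ z.2 v : ℝ) * Complex.I) * shiftPairing g φ z =
      -shiftPairing g (∂_{v} φ) z - shiftPairing (∂_{v} g) φ z := by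
  have integration_by_parts : -shiftPairing g (∂_{v} φ) z =
      ∫ t, φ t * conj ((∂_{v} (stftAtom g z.1 z.2)) t) := by
    have := SchwartzMap.integral_mul_lineDerivOp_right_eq_neg_left (μ := volume) φ
      (schwartzConj (stftAtom g z.1 z.2)) v
    rw [lineDerivOp_schwartzConj] at this
    exact this.symm
  rw [integration_by_parts, lineDerivOp_stftAtom, eq_sub_iff_add_eq, shiftPairing, shiftPairing,
    ← integral_const_mul, ← integral_add ((integrable_schwartz_mul_conj _ _).const_mul _)
      (integrable_schwartz_mul_conj _ _)]
  refine integral_congr_ae (Eventually.of_forall fun t => ?_)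
  simp only [_root_.add_apply, _root_.smul_apply, map_add, smul_eq_mul, map_mul, map_neg,
    Complex.conj_ofReal, Complex.conj_I, real_inner_comm]
  ring

lemma norm_shiftPairing_le (g φ : 𝓢(Rd d, ℂ)) (z : Rd d × Rd d) :
    ‖shiftPairing g φ z‖ ≤ (∫ t, ‖g t‖) * SchwartzMap.seminorm ℂ 0 0 φ := by
  refine (norm_integral_le_integral_norm _).trans ?_
  rw [← integral_sub_right_eq_self (fun t => ‖g t‖) z.1, mul_comm, ← integral_const_mul]
  refine integral_mono (integrable_schwartz_mul_conj _ _).norm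
    ((g.integrable.norm.comp_sub_right z.1).const_mul _) fun t => ?_
  simp only [norm_mul, RCLike.norm_conj, norm_stftAtom_apply]
  gcongr
  exact SchwartzMap.norm_le_seminorm ℂ φ t

/-- The weight `h` on phase space is absorbed by pairings: `h · |shiftPairing g φ|` is bounded by a
continuous seminorm of `φ`, for every window `g`. -/
def PairingDecay (h : Rd d × Rd d → ℝ) : Prop :=
  ∀ g : 𝓢(Rd d, ℂ), ∃ q : Seminorm ℂ 𝓢(Rd d, ℂ), Continuous q ∧
    ∀ φ z, h z * ‖shiftPairing g φ z‖ ≤ q φ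

namespace PairingDecay

lemma one : PairingDecay (d := d) fun _ => 1 := fun g => by
  lift ∫ t, ‖g t‖ to NNReal using integral_nonneg fun _ => norm_nonneg _ with c hc
  refine ⟨c • (SchwartzMap.seminorm ℂ 0 0 : Seminorm ℂ 𝓢(Rd d, ℂ)),
    ((schwartz_withSeminorms ℂ (Rd d) ℂ).continuous_seminorm (0, 0)).const_smul c, fun φ z => ?_⟩
  have := norm_shiftPairing_le g φ z
  rwa [← hc, ← one_mul ‖_‖] at this

lemma one_add_norm_mul {h : Rd d × Rd d → ℝ} (hh : PairingDecay h) (h0 : ∀ z, 0 ≤ h z)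
    {c : Rd d × Rd d → Rd d} (T : Rd d → 𝓢(Rd d, ℂ) →L[ℂ] 𝓢(Rd d, ℂ))
    (hT : ∀ v g φ z, |inner ℝ (c z) v| * ‖shiftPairing g φ z‖ ≤
      ‖shiftPairing g (T v φ) z‖ + ‖shiftPairing (T v g) φ z‖) :
    PairingDecay fun z => (1 + ‖c z‖) * h z := by
  intro g
  let b := EuclideanSpace.basisFun (Fin d) ℝ
  obtain ⟨q, hq, le_q⟩ := hh g
  choose r hr le_r using fun j => hh (T (b j) g)
  let total : Seminorm ℂ 𝓢(Rd d, ℂ) := q + ∑ j, (q.comp (T (b j)).toLinearMap + r j)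
  have total_apply (φ : 𝓢(Rd d, ℂ)) : total φ = q φ + ∑ j, (q (T (b j) φ) + r j φ) :=
    congrArg (q φ + ·) (seminorm_sum_apply _ _ φ)
  refine ⟨total, ?_, fun φ z => ?_⟩
  · rw [show ⇑total = _ from funext total_apply]
    exact hq.add (continuous_finsetSum _ fun j _ => (hq.comp (T (b j)).continuous).add (hr j))
  · rw [total_apply]
    calc (1 + ‖c z‖) * h z * ‖shiftPairing g φ z‖
        ≤ (1 + ∑ j, |inner ℝ (c z) (b j)|) * h z * ‖shiftPairing g φ z‖ := by
          have := h0 z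
          gcongr
          exact norm_le_sum_abs_inner b (c z)
      _ = h z * ‖shiftPairing g φ z‖ +
          ∑ j, h z * (|inner ℝ (c z) (b j)| * ‖shiftPairing g φ z‖) := by
        rw [← Finset.mul_sum, ← Finset.sum_mul]
        ring
      _ ≤ h z * ‖shiftPairing g φ z‖ +
          ∑ j, h z * (‖shiftPairing g (T (b j) φ) z‖ + ‖shiftPairing (T (b j) g) φ z‖) := by
        have := h0 z
        gcongr with j
        exact hT _ g φ z
      _ ≤ q φ + ∑ j, (q (T (b j) φ) + r j φ) := by
        simp only [mul_add]
        gcongr with j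
        exacts [le_q φ z, le_q _ z, le_r j φ z]

lemma phaseWeight_pow (n : ℕ) : PairingDecay (d := d) fun z => phaseWeight z ^ n := by
  induction n with
  | zero => simpa only [pow_zero] using one
  | succ n ih =>
    have pow_nonneg (z : Rd d × Rd d) : 0 ≤ phaseWeight z ^ n :=
      pow_nonneg (zero_le_one.trans (one_le_phaseWeight z)) n
    have decay_snd := ih.one_add_norm_mul pow_nonneg (c := Prod.snd)
      (LineDeriv.lineDerivOpCLM ℂ 𝓢(Rd d, ℂ)) fun v g φ z => by
        have := congrArg norm (shiftPairing_lineDerivOp g φ v z)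
        rw [norm_mul, norm_mul, Complex.norm_I, mul_one, Complex.norm_real,
          Real.norm_eq_abs] at this
        rw [this, LineDeriv.lineDerivOpCLM_apply, LineDeriv.lineDerivOpCLM_apply,
          ← norm_neg (shiftPairing g _ z)]
        exact norm_sub_le _ _
    have decay_fst := decay_snd.one_add_norm_mul
      (fun z => mul_nonneg (by positivity) (pow_nonneg z)) (c := Prod.fst) coordMul
      fun v g φ z => by
        have := congrArg norm (shiftPairing_coordMul g φ v z)
        rw [norm_mul, Complex.norm_real, Real.norm_eq_abs] at this
        rw [this]
        exact norm_sub_le _ _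
    rwa [show (fun z : Rd d × Rd d => phaseWeight z ^ (n + 1)) =
        fun z => (1 + ‖z.1‖) * ((1 + ‖z.2‖) * phaseWeight z ^ n) from
      funext fun z => by rw [pow_succ', phaseWeight, mul_assoc]]

end PairingDecay

lemma exists_phaseWeight_pow_mul_shiftPairing_le (g φ : 𝓢(Rd d, ℂ)) (n : ℕ) :
    ∃ C : ℝ, 0 ≤ C ∧ ∀ z, phaseWeight z ^ n * ‖shiftPairing g φ z‖ ≤ C := by
  obtain ⟨q, -, h⟩ := PairingDecay.phaseWeight_pow n g
  exact ⟨q φ, apply_nonneg _ _, h φ⟩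

lemma integrable_of_phaseWeight_le {F : Type*} [NormedAddCommGroup F] {u : Rd d × Rd d → F}
    (hu : AEStronglyMeasurable u volume) {C : ℝ}
    (h : ∀ z, phaseWeight z ^ (d + 1) * ‖u z‖ ≤ C) : Integrable u volume := by
  have pow_pos (z : Rd d × Rd d) : 0 < phaseWeight z ^ (d + 1) :=
    pow_pos (zero_lt_one.trans_le (one_le_phaseWeight z)) _
  have integrable_inv : Integrable (fun z : Rd d × Rd d => (phaseWeight z ^ (d + 1))⁻¹) volume := by
    have measurable_inv : Measurable fun z : Rd d × Rd d => (phaseWeight z ^ (d + 1))⁻¹ := by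
      unfold phaseWeight
      fun_prop
    refine ⟨measurable_inv.aestronglyMeasurable, ?_⟩
    rw [hasFiniteIntegral_iff_ofReal (Eventually.of_forall fun z => (inv_pos.2 (pow_pos z)).le)]
    exact lintegral_phaseDecay_lt_top
  refine (integrable_inv.const_mul C).mono' hu (Eventually.of_forall fun z => ?_)
  rw [← div_eq_mul_inv, le_div_iff₀ (pow_pos z), mul_comm]
  exact h z

lemma integrable_shiftPairing_smul (g φ : 𝓢(Rd d, ℂ)) {F : Type*} [NormedAddCommGroup F]
    [NormedSpace ℂ F] {u : Rd d × Rd d → F} (hu : Continuous u) {C : ℝ} {n : ℕ} (hC : 0 ≤ C)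
    (h : ∀ z, ‖u z‖ ≤ C * phaseWeight z ^ n) :
    Integrable (fun z => shiftPairing g φ z • u z) volume := by
  obtain ⟨D, -, hD⟩ := exists_phaseWeight_pow_mul_shiftPairing_le g φ (d + 1 + n)
  refine integrable_of_phaseWeight_le (C := D * C)
    ((continuous_shiftPairing g φ).smul hu).aestronglyMeasurable fun z => ?_
  have := zero_le_one.trans (one_le_phaseWeight z)
  calc phaseWeight z ^ (d + 1) * ‖shiftPairing g φ z • u z‖
      ≤ phaseWeight z ^ (d + 1) * (‖shiftPairing g φ z‖ * (C * phaseWeight z ^ n)) := by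
        rw [norm_smul]
        gcongr
        exact h z
    _ = phaseWeight z ^ (d + 1 + n) * ‖shiftPairing g φ z‖ * C := by ring
    _ ≤ D * C := by
        gcongr
        exact hD z

end Pairing

/-! ### The orthogonality relation and the reproducing formula -/

section Moyal

/-- The product of `φ` with the translate of the window `g` by `x`. -/
def windowed {E : Type*} [NormedAddCommGroup E] [NormedSpace ℝ E] (g φ : 𝓢(E, ℂ)) (x : E) :
    𝓢(E, ℂ) :=
  SchwartzMap.pairing (ContinuousLinearMap.mul ℂ ℂ) φ (SchwartzMap.compSubConstCLM ℝ x g)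

lemma windowed_apply {E : Type*} [NormedAddCommGroup E] [NormedSpace ℝ E] (g φ : 𝓢(E, ℂ))
    (x t : E) : windowed g φ x t = φ t * g (t - x) := by
  simp [windowed]

variable {d : ℕ}

lemma shiftPairing_eq_fourierInv (g φ : 𝓢(Rd d, ℂ)) (x ξ : Rd d) :
    shiftPairing g φ (x, ξ) = (𝓕⁻ (windowed g φ x)) ((2 * Real.pi)⁻¹ • ξ) := by
  rw [SchwartzMap.fourierInv_coe, Real.fourierInv_eq']
  refine integral_congr_ae (Eventually.of_forall fun t => ?_)
  have cancel_two_pi : 2 * Real.pi * ((2 * Real.pi)⁻¹ * inner ℝ t ξ) = inner ℝ t ξ :=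
    mul_inv_cancel_left₀ Real.two_pi_pos.ne' _
  simp only [stftAtom_apply, windowed_apply, inner_smul_right, map_mul, Complex.conj_conj,
    smul_eq_mul, ← Complex.exp_conj, map_neg, Complex.conj_ofReal, Complex.conj_I, cancel_two_pi,
    mul_neg, neg_neg]
  ring

/-- The constant `(2π)ᵈ ‖g‖₂²` of the orthogonality relation. -/
def moyalConst (g : 𝓢(Rd d, ℂ)) : ℝ := (2 * Real.pi) ^ d * ∫ t, ‖g t‖ ^ 2

lemma moyalConst_pos {g : 𝓢(Rd d, ℂ)} (hg : g ≠ 0) : 0 < moyalConst g :=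
  mul_pos (pow_pos Real.two_pi_pos d) (integral_norm_schwartz_sq_pos hg)

lemma integral_shiftPairing_mul_conj_section (g φ ψ : 𝓢(Rd d, ℂ)) (x : Rd d) :
    ∫ ξ, shiftPairing g φ (x, ξ) * conj (shiftPairing g ψ (x, ξ)) =
      (2 * Real.pi : ℝ) ^ d * ∫ t, (φ t * conj (ψ t)) * (‖g (t - x)‖ ^ 2 : ℝ) := by
  have plancherel (a b : 𝓢(Rd d, ℂ)) : ∫ ξ, (𝓕⁻ a) ξ * conj ((𝓕⁻ b) ξ) = ∫ t, a t * conj (b t) := by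
    simpa [RCLike.inner_apply] using (SchwartzMap.integral_inner_fourier_fourier (𝓕⁻ b) (𝓕⁻ a)).symm
  have dilate := Measure.integral_comp_inv_smul_of_nonneg volume
    (fun ξ : Rd d => (𝓕⁻ (windowed g φ x)) ξ * conj ((𝓕⁻ (windowed g ψ x)) ξ))
    Real.two_pi_pos.le
  simp only [shiftPairing_eq_fourierInv]
  rw [dilate, plancherel, finrank_euclideanSpace_fin, Complex.real_smul, Complex.ofReal_pow]
  congr 1
  refine integral_congr_ae (Eventually.of_forall fun t => ?_)
  simp only [windowed_apply, map_mul, Complex.ofReal_pow, ← Complex.mul_conj']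
  ring

lemma integrable_shiftPairing_mul_conj (g φ ψ : 𝓢(Rd d, ℂ)) :
    Integrable (fun z => shiftPairing g φ z * conj (shiftPairing g ψ z)) volume := by
  obtain ⟨C, hC, le_C⟩ := exists_phaseWeight_pow_mul_shiftPairing_le g ψ 0
  refine integrable_shiftPairing_smul g φ (n := 0)
    (Complex.continuous_conj.comp (continuous_shiftPairing g ψ)) hC fun z => ?_
  simpa using le_C z

lemma integral_shiftPairing_mul_conj (g φ ψ : 𝓢(Rd d, ℂ)) :
    ∫ z, shiftPairing g φ z * conj (shiftPairing g ψ z) =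
      moyalConst g * ∫ t, φ t * conj (ψ t) := by
  have integrable_window : Integrable (fun s : Rd d => ((‖g (-s)‖ ^ 2 : ℝ) : ℂ)) :=
    (integrable_norm_schwartz_sq g).comp_neg.ofReal
  have integrable_conv := (integrable_schwartz_mul_conj (μ := volume) φ ψ).convolution_integrand
    (ContinuousLinearMap.mul ℂ ℂ) integrable_window
  simp only [ContinuousLinearMap.mul_apply', neg_sub] at integrable_conv
  have integral_window (t : Rd d) : ∫ x, (φ t * conj (ψ t)) * ((‖g (t - x)‖ ^ 2 : ℝ) : ℂ) =
      (φ t * conj (ψ t)) * ((∫ s, ‖g s‖ ^ 2 : ℝ) : ℂ) := by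
    rw [integral_const_mul, integral_complex_ofReal,
      integral_sub_left_eq_self (fun s => ‖g s‖ ^ 2) volume t]
  rw [Measure.volume_eq_prod, integral_prod _ (integrable_shiftPairing_mul_conj g φ ψ)]
  simp only [integral_shiftPairing_mul_conj_section]
  rw [integral_const_mul, integral_integral_swap integrable_conv]
  simp only [integral_window, integral_mul_const, moyalConst]
  push_cast
  ring

lemma integral_shiftPairing_smul_jointBCF {ι : Type} [Fintype ι]
    {P : ι → 𝓢(Rd d, ℂ) →L[ℂ] 𝓢(Rd d, ℂ)} (hP : ∀ i, IsWeylMonomial (P i)) (g φ : 𝓢(Rd d, ℂ)) :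
    ∫ z : Rd d × Rd d, shiftPairing g φ z • jointBCF P (stftAtom g z.1 z.2) =
      (moyalConst g : ℂ) • jointBCF P φ := by
  obtain ⟨C, n, hC, le_C⟩ := norm_jointBCF_stftAtom_le hP g
  have integrable := integrable_shiftPairing_smul g φ (continuous_jointBCF_stftAtom hP g) hC le_C
  funext i
  refine sub_eq_zero.1 (eq_zero_of_integral_schwartz_mul_eq_zero (μ := volume) fun ψ => ?_)
  obtain ⟨T, hT⟩ := exists_clm_integral_schwartz volume ψ
  obtain ⟨Q, hQ⟩ := (hP i).exists_transpose volume
  let S : (ι → Rd d →ᵇ ℂ) →L[ℂ] ℂ := T.comp (ContinuousLinearMap.proj i)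
  have S_jointBCF (χ : 𝓢(Rd d, ℂ)) : S (jointBCF P χ) = ∫ t, Q ψ t * χ t :=
    (hT _).trans (hQ χ ψ)
  have S_atom (z : Rd d × Rd d) : S (jointBCF P (stftAtom g z.1 z.2)) =
      conj (shiftPairing g (schwartzConj (Q ψ)) z) := by
    rw [S_jointBCF, conj_shiftPairing]
    simp
  rw [← hT, map_sub, sub_eq_zero]
  change S _ = S ((moyalConst g : ℂ) • jointBCF P φ)
  rw [← S.integral_comp_comm integrable, map_smul, S_jointBCF]
  simp only [map_smul, S_atom, smul_eq_mul]
  rw [integral_shiftPairing_mul_conj]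
  simp only [schwartzConj_apply, Complex.conj_conj, mul_comm]

lemma exists_norm_stft_le (g : 𝓢(Rd d, ℂ)) (f : 𝓢'(Rd d, ℂ)) :
    ∃ (C : ℝ) (n : ℕ), 0 ≤ C ∧ ∀ z, ‖stft g f z‖ ≤ C * phaseWeight z ^ n := by
  obtain ⟨ι, _, P, L, hP, h⟩ := exists_factorization f
  obtain ⟨C, n, hC, le_C⟩ := norm_jointBCF_stftAtom_le hP g
  refine ⟨‖L‖ * C, n, by positivity, fun z => ?_⟩
  calc ‖stft g f z‖ = ‖L (jointBCF P (stftAtom g z.1 z.2))‖ := congrArg norm (h _)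
    _ ≤ ‖L‖ * ‖jointBCF P (stftAtom g z.1 z.2)‖ := L.le_opNorm _
    _ ≤ ‖L‖ * (C * phaseWeight z ^ n) := by
      gcongr
      exact le_C z
    _ = ‖L‖ * C * phaseWeight z ^ n := (mul_assoc _ _ _).symm

lemma integrable_shiftPairing_mul_stft (g φ : 𝓢(Rd d, ℂ)) (f : 𝓢'(Rd d, ℂ)) :
    Integrable (fun z => shiftPairing g φ z * stft g f z) volume := by
  obtain ⟨C, n, hC, h⟩ := exists_norm_stft_le g f
  exact integrable_shiftPairing_smul g φ (continuous_stft g f) hC h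

lemma integral_shiftPairing_mul_stft (g φ : 𝓢(Rd d, ℂ)) (f : 𝓢'(Rd d, ℂ)) :
    ∫ z, shiftPairing g φ z * stft g f z = moyalConst g * f φ := by
  obtain ⟨ι, _, P, L, hP, h⟩ := exists_factorization f
  obtain ⟨C, n, hC, le_C⟩ := norm_jointBCF_stftAtom_le hP g
  calc ∫ z, shiftPairing g φ z * stft g f z
      = ∫ z, L (shiftPairing g φ z • jointBCF P (stftAtom g z.1 z.2)) := by
        refine integral_congr_ae (Eventually.of_forall fun z => ?_)
        simp only [map_smul, smul_eq_mul, ← h, stft]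
    _ = L ((moyalConst g : ℂ) • jointBCF P φ) := by
        rw [L.integral_comp_comm
          (integrable_shiftPairing_smul g φ (continuous_jointBCF_stftAtom hP g) hC le_C),
          integral_shiftPairing_smul_jointBCF hP]
    _ = moyalConst g * f φ := by rw [map_smul, smul_eq_mul, ← h]

end Moyal

/-! ### The reproducing kernel -/

section Kernel

variable {d : ℕ}

/-- The reproducing kernel of the short-time Fourier transform, without the normalising factor
`(moyalConst g)⁻¹`. -/
def stftKernel (g : 𝓢(Rd d, ℂ)) (z z' : Rd d × Rd d) : ℂ :=
  shiftPairing g (stftAtom g z.1 z.2) z'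

lemma integral_stftKernel_mul_stft (g : 𝓢(Rd d, ℂ)) (f : 𝓢'(Rd d, ℂ)) (z : Rd d × Rd d) :
    ∫ z', stftKernel g z z' * stft g f z' = moyalConst g * stft g f z :=
  integral_shiftPairing_mul_stft g _ f

lemma stftKernel_eq (g : 𝓢(Rd d, ℂ)) (z z' : Rd d × Rd d) :
    stftKernel g z z' = Complex.exp ((inner ℝ z.1 (z'.2 - z.2) : ℝ) * Complex.I) *
      shiftPairing g (schwartzConj g) (z' - z) := by
  rw [stftKernel, shiftPairing, shiftPairing, ← integral_add_right_eq_self _ z.1,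
    ← integral_const_mul]
  refine integral_congr_ae (Eventually.of_forall fun t => ?_)
  have phase : Complex.exp (-(((inner ℝ t z.2 + inner ℝ z.1 z.2 : ℝ) : ℂ) * Complex.I)) *
      Complex.exp (((inner ℝ t z'.2 + inner ℝ z.1 z'.2 : ℝ) : ℂ) * Complex.I) =
      Complex.exp (((inner ℝ z.1 z'.2 - inner ℝ z.1 z.2 : ℝ) : ℂ) * Complex.I) *
      Complex.exp (((inner ℝ t z'.2 - inner ℝ t z.2 : ℝ) : ℂ) * Complex.I) := by
    rw [← Complex.exp_add, ← Complex.exp_add]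
    congr 1
    push_cast
    ring
  simp only [stftAtom_apply, map_mul, Complex.conj_conj, schwartzConj_apply, Prod.fst_sub,
    Prod.snd_sub, ← Complex.exp_conj, map_neg, Complex.conj_ofReal, Complex.conj_I,
    add_sub_cancel_right, mul_neg, neg_neg, inner_add_left, inner_sub_right,
    sub_sub_eq_add_sub]
  linear_combination (conj (g t) * g (t + z.1 - z'.1)) * phase

lemma norm_stftKernel (g : 𝓢(Rd d, ℂ)) (z z' : Rd d × Rd d) :
    ‖stftKernel g z z'‖ = ‖shiftPairing g (schwartzConj g) (z' - z)‖ := by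
  rw [stftKernel_eq, norm_mul, Complex.norm_exp_ofReal_mul_I, one_mul]

lemma continuous_stftKernel (g : 𝓢(Rd d, ℂ)) :
    Continuous fun a : (Rd d × Rd d) × (Rd d × Rd d) => stftKernel g a.1 a.2 := by
  simp only [stftKernel_eq]
  have := continuous_shiftPairing g (schwartzConj g)
  fun_prop

/-- The time-frequency shift of `conj g` by `y` as a tempered distribution; its short-time Fourier
transform is the reproducing kernel at `y`. -/
def shiftDistribution (g : 𝓢(Rd d, ℂ)) (y : Rd d × Rd d) : 𝓢'(Rd d, ℂ) :=
  SchwartzMap.toTemperedDistributionCLM (Rd d) ℂ volume (schwartzConj (stftAtom g y.1 y.2))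

lemma stft_shiftDistribution (g : 𝓢(Rd d, ℂ)) (y z : Rd d × Rd d) :
    stft g (shiftDistribution g y) z = stftKernel g z y :=
  SchwartzMap.toTemperedDistributionCLM_apply_apply (μ := volume) _ _

lemma exists_phaseWeight_pow_mul_stftKernel_le (g : 𝓢(Rd d, ℂ)) (n : ℕ) :
    ∃ C : ℝ, 0 ≤ C ∧ ∀ z z', phaseWeight (z - z') ^ n * ‖stftKernel g z z'‖ ≤ C := by
  obtain ⟨C, hC, h⟩ := exists_phaseWeight_pow_mul_shiftPairing_le g (schwartzConj g) n
  refine ⟨C, hC, fun z z' => ?_⟩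
  rw [norm_stftKernel, phaseWeight_sub_comm]
  exact h _

end Kernel

/-! ### Weights and norms of weighted short-time Fourier transforms -/

section Weights

variable {d : ℕ}

lemma one_add_sq_add_sq_le_phaseWeight_sq (z : Rd d × Rd d) :
    1 + ‖z.1‖ ^ 2 + ‖z.2‖ ^ 2 ≤ phaseWeight z ^ 2 := by
  have hx := norm_nonneg z.1
  have hξ := norm_nonneg z.2
  unfold phaseWeight
  nlinarith [mul_nonneg hx hξ, sq_nonneg (‖z.1‖ * ‖z.2‖), mul_nonneg hx (mul_nonneg hx hξ),
    mul_nonneg hξ (mul_nonneg hx hξ)]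

lemma exists_polyWeight_le (s : ℝ) :
    ∃ k : ℕ, ∀ z : Rd d × Rd d, polyWeight s z ≤ phaseWeight z ^ k := by
  refine ⟨⌈|s|⌉₊, fun z => ?_⟩
  have one_le_base : 1 ≤ 1 + ‖z.1‖ ^ 2 + ‖z.2‖ ^ 2 := by
    rw [add_assoc]
    exact le_add_of_nonneg_right (by positivity)
  calc polyWeight s z ≤ (1 + ‖z.1‖ ^ 2 + ‖z.2‖ ^ 2) ^ (|s| / 2) :=
        Real.rpow_le_rpow_of_exponent_le one_le_base (by linarith [le_abs_self s])
    _ ≤ (phaseWeight z ^ 2) ^ (|s| / 2) :=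
        Real.rpow_le_rpow (by linarith) (one_add_sq_add_sq_le_phaseWeight_sq z) (by positivity)
    _ = phaseWeight z ^ |s| := by
        rw [← Real.rpow_natCast_mul (phaseWeight_pos z).le]
        congr 1
        push_cast
        ring
    _ ≤ phaseWeight z ^ (⌈|s|⌉₊ : ℝ) :=
        Real.rpow_le_rpow_of_exponent_le (one_le_phaseWeight z) (Nat.le_ceil _)
    _ = phaseWeight z ^ ⌈|s|⌉₊ := Real.rpow_natCast _ _

/-- A measurable weight that is moderate with respect to, and bounded above and below by, powers of
`phaseWeight`. -/
structure IsControlledWeight (w : Rd d × Rd d → ℝ) (C : ℝ) (k : ℕ) : Prop where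
  aestronglyMeasurable : AEStronglyMeasurable w volume
  nonneg : ∀ z, 0 ≤ w z
  const_pos : 0 < C
  moderate : ∀ x y, w (x + y) ≤ C * phaseWeight x ^ k * w y
  one_le : ∀ z, 1 ≤ C * phaseWeight z ^ k * w z
  le : ∀ z, w z ≤ C * phaseWeight z ^ k

lemma exists_phaseWeight_moderate {w : Rd d × Rd d → ℝ} (nonneg : ∀ z, 0 ≤ w z)
    (hmod : IsPolynomiallyModerate w) :
    ∃ (C : ℝ) (k : ℕ), 0 < C ∧ ∀ x y, w (x + y) ≤ C * phaseWeight x ^ k * w y := by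
  obtain ⟨s, C, hC⟩ := hmod
  obtain ⟨k, hk⟩ := exists_polyWeight_le (d := d) s
  refine ⟨max C 1, k, lt_max_of_lt_right one_pos, fun x y => (hC x y).trans ?_⟩
  have polyWeight_nonneg : 0 ≤ polyWeight s x := by unfold polyWeight; positivity
  have := nonneg y
  gcongr
  exacts [le_max_left _ _, hk x]

lemma le_mul_phaseWeight_of_moderate {w : Rd d × Rd d → ℝ} {C : ℝ} {k : ℕ} (hC : 0 ≤ C)
    (nonneg : ∀ z, 0 ≤ w z) (moderate : ∀ x y, w (x + y) ≤ C * phaseWeight x ^ k * w y)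
    (y z : Rd d × Rd d) : w y ≤ C * phaseWeight y ^ k * (phaseWeight z ^ k * w z) := by
  have phaseWeight_sub_le : phaseWeight (y - z) ≤ phaseWeight y * phaseWeight z := by
    simpa only [sub_eq_add_neg, phaseWeight_neg] using phaseWeight_add_le y (-z)
  have := nonneg z
  have := phaseWeight_pos (y - z)
  calc w y ≤ C * phaseWeight (y - z) ^ k * w z := by
        simpa only [sub_add_cancel] using moderate (y - z) z
    _ ≤ C * (phaseWeight y * phaseWeight z) ^ k * w z := by gcongr
    _ = C * phaseWeight y ^ k * (phaseWeight z ^ k * w z) := by ring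

lemma exists_isControlledWeight {w : Rd d × Rd d → ℝ} (hw : IsWeight w) (hw0 : w ≠ 0)
    (hmod : IsPolynomiallyModerate w) : ∃ (C : ℝ) (k : ℕ), IsControlledWeight w C k := by
  have nonneg := hw.1
  obtain ⟨C, k, hC, moderate⟩ := exists_phaseWeight_moderate nonneg hmod
  obtain ⟨y, hy⟩ := Function.ne_iff.1 hw0
  have wy_pos : 0 < w y := (nonneg y).lt_of_ne' hy
  refine ⟨max C (max (C * phaseWeight y ^ k / w y) (C * w 0)), k,
    hw.2.aestronglyMeasurable, nonneg, lt_max_of_lt_left hC, fun x z => (moderate x z).trans ?_,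
    fun z => ?_, fun z => ?_⟩
  all_goals
    have hz := nonneg z
    have hPz := phaseWeight_pos z
  · have := phaseWeight_pos x
    gcongr
    exact le_max_left _ _
  · calc 1 ≤ C * phaseWeight y ^ k / w y * phaseWeight z ^ k * w z := by
          rw [mul_assoc, div_mul_eq_mul_div, one_le_div wy_pos]
          exact le_mul_phaseWeight_of_moderate hC.le nonneg moderate y z
      _ ≤ _ := by
          gcongr
          exact (le_max_left _ _).trans (le_max_right _ _)
  · calc w z ≤ C * phaseWeight z ^ k * w 0 := by simpa only [add_zero] using moderate z 0
      _ = C * w 0 * phaseWeight z ^ k := mul_right_comm _ _ _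
      _ ≤ _ := by
          gcongr
          exact (le_max_right _ _).trans (le_max_right _ _)

end Weights

section Estimates

variable {d : ℕ} {N : (Rd d × Rd d → ℝ≥0∞) → ℝ≥0∞} {w : Rd d × Rd d → ℝ} {C : ℝ} {k : ℕ}

/-- The extended norm of a tempered distribution determined by the norm `N` on the time-frequency
plane, the weight `w` and the window `g`. -/
def stftNorm (N : (Rd d × Rd d → ℝ≥0∞) → ℝ≥0∞) (w : Rd d × Rd d → ℝ) (g : 𝓢(Rd d, ℂ))
    (f : 𝓢'(Rd d, ℂ)) : ℝ≥0∞ :=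
  N fun z => ‖stft g f z * (w z : ℂ)‖ₑ

lemma stft_sub (g : 𝓢(Rd d, ℂ)) (f f' : 𝓢'(Rd d, ℂ)) (z : Rd d × Rd d) :
    stft g (f - f') z = stft g f z - stft g f' z := rfl

lemma phaseWeight_pow_mul_stftKernel_le {g : 𝓢(Rd d, ℂ)} {n : ℕ} {B : ℝ}
    (hB : ∀ z z', phaseWeight (z - z') ^ n * ‖stftKernel g z z'‖ ≤ B) (z y : Rd d × Rd d) :
    phaseWeight z ^ n * ‖stftKernel g z y‖ ≤ phaseWeight y ^ n * B := by
  have hz := phaseWeight_pos z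
  have hy := phaseWeight_pos y
  calc phaseWeight z ^ n * ‖stftKernel g z y‖
      ≤ (phaseWeight (z - y) * phaseWeight y) ^ n * ‖stftKernel g z y‖ := by
        gcongr
        exact phaseWeight_le_sub_mul z y
    _ = phaseWeight y ^ n * (phaseWeight (z - y) ^ n * ‖stftKernel g z y‖) := by ring
    _ ≤ phaseWeight y ^ n * B := by gcongr; exact hB z y

namespace IsControlledWeight

lemma enorm_ofReal (hw : IsControlledWeight w C k) (z : Rd d × Rd d) :
    ‖(w z : ℂ)‖ₑ = ENNReal.ofReal (w z) := by
  rw [← ofReal_norm, Complex.norm_real, Real.norm_of_nonneg (hw.nonneg z)]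

lemma aestronglyMeasurable_mul (hw : IsControlledWeight w C k) {F : Rd d × Rd d → ℂ}
    (hF : Continuous F) : AEStronglyMeasurable (fun z => F z * (w z : ℂ)) volume :=
  hF.aestronglyMeasurable.mul
    (Complex.continuous_ofReal.comp_aestronglyMeasurable hw.aestronglyMeasurable)

lemma aemeasurable_enorm_stft_mul (hw : IsControlledWeight w C k) (g : 𝓢(Rd d, ℂ))
    (f : 𝓢'(Rd d, ℂ)) : AEMeasurable fun z => ‖stft g f z * (w z : ℂ)‖ₑ :=
  (hw.aestronglyMeasurable_mul (continuous_stft g f)).enorm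

lemma enorm_mul_le (hw : IsControlledWeight w C k) {H : Rd d × Rd d → ℂ} {D : ℝ}
    (hH : ∀ z, phaseWeight z ^ (d + 1 + k) * ‖H z‖ ≤ D) (z : Rd d × Rd d) :
    ‖H z * (w z : ℂ)‖ₑ ≤ ENNReal.ofReal (C * D) * phaseDecay z := by
  have hz := phaseWeight_pos z
  have hC := hw.const_pos
  have hD : 0 ≤ D := le_trans (by positivity) (hH z)
  rw [← ofReal_norm, phaseDecay, norm_mul, Complex.norm_real, Real.norm_of_nonneg (hw.nonneg z),
    ← ENNReal.ofReal_mul (by positivity)]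
  refine ENNReal.ofReal_le_ofReal ?_
  rw [← div_eq_mul_inv, le_div_iff₀ (by positivity)]
  calc ‖H z‖ * w z * phaseWeight z ^ (d + 1)
      ≤ ‖H z‖ * (C * phaseWeight z ^ k) * phaseWeight z ^ (d + 1) := by
        gcongr
        exact hw.le z
    _ = C * (phaseWeight z ^ (d + 1 + k) * ‖H z‖) := by ring
    _ ≤ C * D := by gcongr; exact hH z

lemma enorm_le_phaseDecay_mul (hw : IsControlledWeight w C k) {H : Rd d × Rd d → ℂ} {D : ℝ}
    (hH : ∀ z, phaseWeight z ^ (d + 1 + k) * ‖H z‖ ≤ D) (z : Rd d × Rd d) :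
    ‖H z‖ₑ ≤ ENNReal.ofReal (C * D) * (phaseDecay z * ‖(w z : ℂ)‖ₑ) := by
  have hz := phaseWeight_pos z
  have hC := hw.const_pos
  have hD : 0 ≤ D := le_trans (by positivity) (hH z)
  rw [hw.enorm_ofReal, phaseDecay, ← ENNReal.ofReal_mul (by positivity),
    ← ENNReal.ofReal_mul (by positivity), ← ofReal_norm]
  refine ENNReal.ofReal_le_ofReal ?_
  calc ‖H z‖ ≤ D * (phaseWeight z ^ (d + 1 + k))⁻¹ := by
        rw [← div_eq_mul_inv, le_div_iff₀ (by positivity), mul_comm]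
        exact hH z
    _ ≤ D * (phaseWeight z ^ (d + 1 + k))⁻¹ * (C * phaseWeight z ^ k * w z) :=
        le_mul_of_one_le_right (by positivity) (hw.one_le z)
    _ = C * D * ((phaseWeight z ^ (d + 1))⁻¹ * w z) := by
        rw [pow_add _ (d + 1) k]
        field_simp

lemma exists_norm_mul_stftKernel_mul_le (hw : IsControlledWeight w C k) (g : 𝓢(Rd d, ℂ)) :
    ∃ B : ℝ, 0 ≤ B ∧ ∀ z z' : Rd d × Rd d,
      ‖z - z'‖ * ‖stftKernel g z z'‖ * w z ≤ B * (phaseWeight (z - z') ^ (d + 1))⁻¹ * w z' := by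
  obtain ⟨B, hB, h⟩ := exists_phaseWeight_pow_mul_stftKernel_le g (d + 1 + k + 1)
  have hC := hw.const_pos
  refine ⟨B * C, by positivity, fun z z' => ?_⟩
  have hp := phaseWeight_pos (z - z')
  have hz := hw.nonneg z
  have hz' := hw.nonneg z'
  have w_le : w z ≤ C * phaseWeight (z - z') ^ k * w z' := by
    simpa only [sub_add_cancel] using hw.moderate (z - z') z'
  calc ‖z - z'‖ * ‖stftKernel g z z'‖ * w z
      ≤ phaseWeight (z - z') * ‖stftKernel g z z'‖ * (C * phaseWeight (z - z') ^ k * w z') := by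
        gcongr
        exact norm_le_phaseWeight _
    _ = (phaseWeight (z - z') ^ (d + 1 + k + 1) * ‖stftKernel g z z'‖) * C *
          (phaseWeight (z - z') ^ (d + 1))⁻¹ * w z' := by
        rw [show d + 1 + k + 1 = (d + 1) + (k + 1) by ring, pow_add _ (d + 1)]
        field_simp
        ring
    _ ≤ B * C * (phaseWeight (z - z') ^ (d + 1))⁻¹ * w z' := by
        gcongr
        exact h z z'

end IsControlledWeight

lemma norm_le_toReal_of_enorm_le {E : Type*} [SeminormedAddCommGroup E] {x : E} {a : ℝ}
    (ha : 0 ≤ a) {b : ℝ≥0∞} (hb : b < ∞) (h : ‖x‖ₑ ≤ ENNReal.ofReal a * b) :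
    ‖x‖ ≤ a * b.toReal := by
  rw [← toReal_enorm]
  refine (ENNReal.toReal_mono (ENNReal.mul_lt_top ENNReal.ofReal_lt_top hb).ne h).trans_eq ?_
  rw [ENNReal.toReal_mul, ENNReal.toReal_ofReal ha]

namespace AdmissibleNorm

lemma mono (hN : AdmissibleNorm N) {F G : Rd d × Rd d → ℝ≥0∞} (h : ∀ z, F z ≤ G z) : N F ≤ N G :=
  hN.mono_ae (Eventually.of_forall h)

lemma exists_lintegral_mul_stft_le (hN : AdmissibleNorm N) (hw : IsControlledWeight w C k)
    (g : 𝓢(Rd d, ℂ)) : ∃ A : ℝ, 0 ≤ A ∧ ∀ (f : 𝓢'(Rd d, ℂ)) (H : Rd d × Rd d → ℂ) (D : ℝ),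
      (∀ z, phaseWeight z ^ (d + 1 + k) * ‖H z‖ ≤ D) →
      ∫⁻ z, ‖H z * stft g f z‖ₑ ≤ ENNReal.ofReal (A * D) * stftNorm N w g f := by
  obtain ⟨B, hB, h⟩ := hN.lintegral_le
  refine ⟨B.toReal * C, mul_nonneg ENNReal.toReal_nonneg hw.const_pos.le, fun f H D hH => ?_⟩
  calc ∫⁻ z, ‖H z * stft g f z‖ₑ
      ≤ ∫⁻ z, ENNReal.ofReal (C * D) * (phaseDecay z * ‖stft g f z * (w z : ℂ)‖ₑ) := by
        refine lintegral_mono fun z => ?_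
        rw [enorm_mul, enorm_mul, mul_comm ‖stft g f z‖ₑ, ← mul_assoc (phaseDecay z), ← mul_assoc]
        gcongr
        exact hw.enorm_le_phaseDecay_mul hH z
    _ ≤ ENNReal.ofReal (C * D) * (B * stftNorm N w g f) := by
        rw [lintegral_const_mul' _ _ ENNReal.ofReal_ne_top]
        gcongr
        exact h _ (hw.aemeasurable_enorm_stft_mul g f)
    _ = ENNReal.ofReal (B.toReal * C * D) * stftNorm N w g f := by
        rw [mul_assoc B.toReal, ENNReal.ofReal_mul ENNReal.toReal_nonneg, ENNReal.ofReal_toReal hB,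
          ← mul_assoc, mul_comm (ENNReal.ofReal (C * D))]

lemma integrable_mul_stft (hN : AdmissibleNorm N) (hw : IsControlledWeight w C k)
    {g : 𝓢(Rd d, ℂ)} {f : 𝓢'(Rd d, ℂ)} (hf : stftNorm N w g f < ∞) {H : Rd d × Rd d → ℂ}
    (hm : AEStronglyMeasurable H volume) {D : ℝ}
    (hH : ∀ z, phaseWeight z ^ (d + 1 + k) * ‖H z‖ ≤ D) :
    Integrable (fun z => H z * stft g f z) volume := by
  obtain ⟨A, -, h⟩ := hN.exists_lintegral_mul_stft_le hw g
  exact ⟨hm.mul (continuous_stft g f).aestronglyMeasurable,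
    (h f H D hH).trans_lt (ENNReal.mul_lt_top ENNReal.ofReal_lt_top hf)⟩

lemma exists_norm_integral_mul_stft_le (hN : AdmissibleNorm N) (hw : IsControlledWeight w C k)
    (g : 𝓢(Rd d, ℂ)) : ∃ A : ℝ, 0 ≤ A ∧ ∀ (f : 𝓢'(Rd d, ℂ)) (H : Rd d × Rd d → ℂ) (D : ℝ),
      stftNorm N w g f < ∞ → (∀ z, phaseWeight z ^ (d + 1 + k) * ‖H z‖ ≤ D) →
      ‖∫ z, H z * stft g f z‖ ≤ A * D * (stftNorm N w g f).toReal := by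
  obtain ⟨A, hA, h⟩ := hN.exists_lintegral_mul_stft_le hw g
  refine ⟨A, hA, fun f H D hf hH => ?_⟩
  have hD : 0 ≤ D := by
    have := phaseWeight_pos (0 : Rd d × Rd d)
    exact le_trans (by positivity) (hH 0)
  exact norm_le_toReal_of_enorm_le (by positivity) hf
    ((enorm_integral_le_lintegral_enorm _).trans (h f H D hH))

lemma exists_norm_apply_le (hN : AdmissibleNorm N) (hw : IsControlledWeight w C k)
    {g : 𝓢(Rd d, ℂ)} (hg : g ≠ 0) : ∃ (q : Seminorm ℂ 𝓢(Rd d, ℂ)) (A : ℝ), 0 ≤ A ∧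
      Continuous q ∧ ∀ f : 𝓢'(Rd d, ℂ), stftNorm N w g f < ∞ → ∀ φ,
        ‖f φ‖ ≤ A * q φ * (stftNorm N w g f).toReal := by
  obtain ⟨A, hA, h⟩ := hN.exists_norm_integral_mul_stft_le hw g
  obtain ⟨q, hq, hqb⟩ := PairingDecay.phaseWeight_pow (d + 1 + k) g
  have hM := moyalConst_pos hg
  refine ⟨q, A / moyalConst g, by positivity, hq, fun f hf φ => ?_⟩
  have pairing_le := h f (shiftPairing g φ) (q φ) hf (hqb φ)
  rw [integral_shiftPairing_mul_stft, norm_mul, Complex.norm_real,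
    Real.norm_of_nonneg hM.le] at pairing_le
  rwa [div_mul_eq_mul_div, div_mul_eq_mul_div, le_div_iff₀ hM, mul_comm]

lemma stftNorm_shiftDistribution_lt_top (hN : AdmissibleNorm N) (hw : IsControlledWeight w C k)
    (g : 𝓢(Rd d, ℂ)) (y : Rd d × Rd d) : stftNorm N w g (shiftDistribution g y) < ∞ := by
  obtain ⟨B, -, hB⟩ := exists_phaseWeight_pow_mul_stftKernel_le g (d + 1 + k)
  have decay (z : Rd d × Rd d) :
      phaseWeight z ^ (d + 1 + k) * ‖stft g (shiftDistribution g y) z‖ ≤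
        phaseWeight y ^ (d + 1 + k) * B := by
    rw [stft_shiftDistribution]
    exact phaseWeight_pow_mul_stftKernel_le hB z y
  refine (hN.mono (hw.enorm_mul_le decay)).trans_lt ?_
  rw [hN.const_mul ENNReal.ofReal_ne_top]
  exact ENNReal.mul_lt_top ENNReal.ofReal_lt_top hN.decay_lt_top

end AdmissibleNorm

end Estimates

/-! ### Spaces of distributions normed by their short-time Fourier transforms -/

section Space

variable {d : ℕ} {N : (Rd d × Rd d → ℝ≥0∞) → ℝ≥0∞} {w : Rd d × Rd d → ℝ} {C : ℝ} {k : ℕ}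
  {g : 𝓢(Rd d, ℂ)} {X : Type*} [SeminormedAddCommGroup X] [NormedSpace ℂ X]
  {J : X →ₗ[ℂ] 𝓢'(Rd d, ℂ)}

/-- `X` is, through the embedding `J`, the space of tempered distributions with finite `stftNorm`.
This treats modulation and Wiener amalgam spaces simultaneously. -/
structure IsStftSpace (N : (Rd d × Rd d → ℝ≥0∞) → ℝ≥0∞) (w : Rd d × Rd d → ℝ) (g : 𝓢(Rd d, ℂ))
    (J : X →ₗ[ℂ] 𝓢'(Rd d, ℂ)) : Prop where
  injective : Function.Injective J
  lt_top : ∀ x, stftNorm N w g (J x) < ∞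
  norm_eq : ∀ x, ‖x‖ = (stftNorm N w g (J x)).toReal
  surj : ∀ f, stftNorm N w g f < ∞ → ∃ x, J x = f

lemma exists_distribution_of_cauchySeq {f : ℕ → 𝓢'(Rd d, ℂ)} {q : Seminorm ℂ 𝓢(Rd d, ℂ)}
    (hq : Continuous q) (hf : ∀ φ, CauchySeq fun n => f n φ) {M : ℝ}
    (hM : ∀ n φ, ‖f n φ‖ ≤ M * q φ) :
    ∃ F : 𝓢'(Rd d, ℂ), ∀ φ, Tendsto (fun n => f n φ) atTop (𝓝 (F φ)) := by
  choose F hF using fun φ => cauchySeq_tendsto_of_complete (hf φ)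
  let L : 𝓢(Rd d, ℂ) →ₗ[ℂ] ℂ :=
    linearMapOfTendsto F (fun n => (f n : 𝓢(Rd d, ℂ) →ₗ[ℂ] ℂ)) (tendsto_pi_nhds.2 hF)
  have norm_le (φ : 𝓢(Rd d, ℂ)) : ‖L φ‖ ≤ M * q φ :=
    le_of_tendsto (hF φ).norm (Eventually.of_forall fun n => hM n φ)
  have hL : Continuous L := by
    refine continuous_of_continuousAt_zero L ?_
    rw [ContinuousAt, map_zero]
    exact squeeze_zero_norm norm_le (by simpa using (hq.const_mul M).tendsto 0)
  exact ⟨ContinuousLinearMap.toPointwiseConvergenceCLM _ _ _ _ ⟨L, hL⟩, hF⟩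

namespace IsStftSpace

lemma stftNorm_eq (hJ : IsStftSpace N w g J) (x : X) :
    stftNorm N w g (J x) = ENNReal.ofReal ‖x‖ := by
  rw [hJ.norm_eq, ENNReal.ofReal_toReal (hJ.lt_top x).ne]

lemma exists_norm_apply_le (hJ : IsStftSpace N w g J) (hN : AdmissibleNorm N)
    (hw : IsControlledWeight w C k) (hg : g ≠ 0) :
    ∃ (q : Seminorm ℂ 𝓢(Rd d, ℂ)) (A : ℝ), 0 ≤ A ∧ Continuous q ∧
      ∀ x φ, ‖J x φ‖ ≤ A * q φ * ‖x‖ := by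
  obtain ⟨q, A, hA, hq, h⟩ := hN.exists_norm_apply_le hw hg
  refine ⟨q, A, hA, hq, fun x φ => ?_⟩
  rw [hJ.norm_eq]
  exact h _ (hJ.lt_top x) φ

lemma t0Space (hJ : IsStftSpace N w g J) (hN : AdmissibleNorm N) (hw : IsControlledWeight w C k)
    (hg : g ≠ 0) : T0Space X := by
  obtain ⟨q, A, -, -, h⟩ := hJ.exists_norm_apply_le hN hw hg
  refine ⟨fun x y hxy => sub_eq_zero.1 (hJ.injective ?_)⟩
  rw [map_zero]
  refine ContinuousLinearMap.ext fun φ => norm_le_zero_iff.1 ((h (x - y) φ).trans_eq ?_)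
  rw [← dist_eq_norm, Metric.inseparable_iff.1 hxy, mul_zero]

lemma exists_weak_limit (hJ : IsStftSpace N w g J) (hN : AdmissibleNorm N)
    (hw : IsControlledWeight w C k) (hg : g ≠ 0) {u : ℕ → X} (hu : CauchySeq u) :
    ∃ F : 𝓢'(Rd d, ℂ), ∀ φ, Tendsto (fun n => J (u n) φ) atTop (𝓝 (F φ)) := by
  obtain ⟨q, A, hA, hq, h⟩ := hJ.exists_norm_apply_le hN hw hg
  obtain ⟨M, hM⟩ := hu.norm_bddAbove
  refine exists_distribution_of_cauchySeq (q := q) (M := A * M) hq (fun φ => ?_) fun n φ => ?_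
  · let pairing : X →ₗ[ℂ] ℂ :=
      (PointwiseConvergenceCLM.evalCLM (RingHom.id ℂ) ℂ φ : 𝓢'(Rd d, ℂ) →ₗ[ℂ] ℂ) ∘ₗ J
    exact hu.map (AddMonoidHomClass.uniformContinuous_of_bound pairing (A * q φ) (h · φ))
  · calc ‖J (u n) φ‖ ≤ A * q φ * ‖u n‖ := h _ φ
      _ ≤ A * q φ * M := by
          gcongr
          exact hM ⟨n, rfl⟩
      _ = A * M * q φ := mul_right_comm _ _ _

lemma stftNorm_sub_le_liminf (hJ : IsStftSpace N w g J) (hN : AdmissibleNorm N)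
    (hw : IsControlledWeight w C k) {u : ℕ → X} {F : 𝓢'(Rd d, ℂ)}
    (hF : ∀ φ, Tendsto (fun n => J (u n) φ) atTop (𝓝 (F φ))) (x : X) :
    stftNorm N w g (F - J x) ≤ liminf (fun n => ENNReal.ofReal ‖u n - x‖) atTop := by
  have enorm_eq_liminf (z : Rd d × Rd d) : ‖stft g (F - J x) z * (w z : ℂ)‖ₑ =
      liminf (fun n => ‖stft g (J (u n - x)) z * (w z : ℂ)‖ₑ) atTop := by
    refine (Tendsto.enorm (Tendsto.mul_const _ ?_)).liminf_eq.symm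
    simp only [map_sub, stft_sub]
    exact (hF _).sub_const _
  calc stftNorm N w g (F - J x)
      = N fun z => liminf (fun n => ‖stft g (J (u n - x)) z * (w z : ℂ)‖ₑ) atTop :=
        congrArg N (funext enorm_eq_liminf)
    _ ≤ liminf (fun n => stftNorm N w g (J (u n - x))) atTop :=
        hN.liminf_le fun n => hw.aemeasurable_enorm_stft_mul g _
    _ = liminf (fun n => ENNReal.ofReal ‖u n - x‖) atTop := by simp only [hJ.stftNorm_eq]

lemma completeSpace (hJ : IsStftSpace N w g J) (hN : AdmissibleNorm N)
    (hw : IsControlledWeight w C k) (hg : g ≠ 0) : CompleteSpace X := by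
  refine Metric.complete_of_cauchySeq_tendsto fun u hu => ?_
  obtain ⟨F, hF⟩ := hJ.exists_weak_limit hN hw hg hu
  have eventually_close {ε : ℝ} (hε : 0 < ε) : ∃ n₀, ∀ m ≥ n₀,
      stftNorm N w g (F - J (u m)) ≤ ENNReal.ofReal ε := by
    obtain ⟨n₀, hn₀⟩ := Metric.cauchySeq_iff.1 hu ε hε
    refine ⟨n₀, fun m hm => (hJ.stftNorm_sub_le_liminf hN hw hF (u m)).trans ?_⟩
    refine liminf_le_of_frequently_le' (Eventually.frequently ?_)
    filter_upwards [eventually_ge_atTop n₀] with n hn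
    rw [← dist_eq_norm]
    exact ENNReal.ofReal_le_ofReal (hn₀ n hn m hm).le
  obtain ⟨x, rfl⟩ : ∃ x, J x = F := by
    obtain ⟨m, hm⟩ := eventually_close one_pos
    obtain ⟨y, hy⟩ := hJ.surj _ ((hm m le_rfl).trans_lt ENNReal.ofReal_lt_top)
    exact ⟨y + u m, by rw [map_add, hy, sub_add_cancel]⟩
  refine ⟨x, Metric.tendsto_atTop.2 fun ε hε => ?_⟩
  obtain ⟨n₀, hn₀⟩ := eventually_close (half_pos hε)
  refine ⟨n₀, fun m hm => ?_⟩
  have norm_sub_le := hn₀ m hm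
  rw [← map_sub, hJ.stftNorm_eq, ENNReal.ofReal_le_ofReal_iff (half_pos hε).le] at norm_sub_le
  rw [dist_comm, dist_eq_norm]
  exact norm_sub_le.trans_lt (half_lt_self hε)

end IsStftSpace

end Space

/-! ### Criteria for the metric approximation property -/

section MetricApproximation

variable {X : Type*} [SeminormedAddCommGroup X] [NormedSpace ℂ X]

lemma metricApproximationProperty_of_tendsto_of_norm_le_one {T : ℕ → X →L[ℂ] X}
    (hfin : ∀ n, FiniteDimensional ℂ (LinearMap.range (T n : X →ₗ[ℂ] X)))
    (hnorm : ∀ n, ‖T n‖ ≤ 1) (hlim : ∀ x, Tendsto (fun n => T n x) atTop (𝓝 x)) :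
    MetricApproximationProperty X := by
  intro K hK ε hε
  obtain ⟨t, -, ht, hcov⟩ := hK.finite_cover_balls (show 0 < ε / 3 by positivity)
  obtain ⟨n, hn⟩ : ∃ n, ∀ x ∈ t, dist (T n x) x < ε / 3 :=
    ((eventually_all_finite ht).2 fun x _ =>
      Metric.tendsto_nhds.1 (hlim x) _ (by positivity)).exists
  refine ⟨T n, hfin n, hnorm n, fun y hy => ?_⟩
  obtain ⟨x, hx, hyx⟩ := Set.mem_iUnion₂.1 (hcov hy)
  have dist_map_le : dist (T n x) (T n y) ≤ dist y x := by
    rw [dist_comm, dist_eq_norm, ← map_sub, dist_eq_norm]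
    exact (ContinuousLinearMap.le_of_opNorm_le _ (hnorm n) _).trans_eq (one_mul _)
  rw [← dist_eq_norm]
  linarith [dist_triangle4 y x (T n x) (T n y), dist_comm x (T n x), hn x hx,
    Metric.mem_ball.1 hyx]

lemma metricApproximationProperty_of_tendsto {T : ℕ → X →L[ℂ] X} {c : ℕ → ℝ}
    (hfin : ∀ n, FiniteDimensional ℂ (LinearMap.range (T n : X →ₗ[ℂ] X)))
    (hnorm : ∀ n x, ‖T n x‖ ≤ c n * ‖x‖) (hc : Tendsto c atTop (𝓝 1))
    (hlim : ∀ x, Tendsto (fun n => T n x) atTop (𝓝 x)) : MetricApproximationProperty X := by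
  let b (n : ℕ) : ℝ := max (c n) 1
  have hb_pos (n : ℕ) : 0 < b n := lt_max_of_lt_right one_pos
  have hb : Tendsto (fun n => ((b n : ℂ))⁻¹) atTop (𝓝 1) := by
    have hb_real : Tendsto b atTop (𝓝 1) := by
      simpa only [max_self] using hc.max (tendsto_const_nhds (x := (1 : ℝ)))
    simpa using ((Complex.continuous_ofReal.tendsto 1).comp hb_real).inv₀ (by simp)
  refine metricApproximationProperty_of_tendsto_of_norm_le_one
    (T := fun n => (b n : ℂ)⁻¹ • T n) (fun n => ?_) (fun n => ?_) fun x => ?_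
  · have := hfin n
    refine Submodule.finiteDimensional_of_le (S₂ := LinearMap.range (T n : X →ₗ[ℂ] X)) ?_
    rintro - ⟨x, rfl⟩
    exact Submodule.smul_mem _ _ ⟨x, rfl⟩
  · rw [norm_smul, norm_inv, Complex.norm_real, Real.norm_of_nonneg (hb_pos n).le,
      inv_mul_le_iff₀ (hb_pos n), mul_one]
    refine ContinuousLinearMap.opNorm_le_bound _ (hb_pos n).le fun x => (hnorm n x).trans ?_
    gcongr
    exact le_max_left _ _
  · simpa using hb.smul (hlim x)

lemma finiteDimensional_range_sum_smulRight {ι : Type*} (s : Finset ι) (l : ι → X →L[ℂ] ℂ)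
    (e : ι → X) : FiniteDimensional ℂ (LinearMap.range
      ((∑ i ∈ s, (l i).smulRight (e i) : X →L[ℂ] X) : X →ₗ[ℂ] X)) := by
  have := FiniteDimensional.span_of_finite ℂ (s.finite_toSet.image e)
  refine Submodule.finiteDimensional_of_le (S₂ := Submodule.span ℂ (e '' s)) ?_
  rintro - ⟨x, rfl⟩
  rw [ContinuousLinearMap.coe_coe, _root_.sum_apply]
  exact Submodule.sum_mem _ fun i hi => Submodule.smul_mem _ _ (Submodule.subset_span ⟨i, hi, rfl⟩)

end MetricApproximation

/-! ### Cutoffs and discretisation of the reproducing kernel -/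

section Cutoff

variable {d : ℕ}

/-- A cutoff function on phase space, supported in the ball of radius `1 / δ` and varying at rate
`δ`; it is the symbol of the approximating localisation operators. -/
def cutoff (δ : ℝ) (z : Rd d × Rd d) : ℝ := max 0 (1 - δ * ‖z‖)

lemma cutoff_nonneg (δ : ℝ) (z : Rd d × Rd d) : 0 ≤ cutoff δ z := le_max_left _ _

lemma cutoff_le_one {δ : ℝ} (hδ : 0 ≤ δ) (z : Rd d × Rd d) : cutoff δ z ≤ 1 :=
  max_le zero_le_one (sub_le_self _ (by positivity))

lemma cutoff_eq_zero {δ : ℝ} (hδ : 0 < δ) {z : Rd d × Rd d} (hz : 1 / δ < ‖z‖) :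
    cutoff δ z = 0 := by
  rw [div_lt_iff₀' hδ] at hz
  exact max_eq_left (sub_nonpos.2 hz.le)

lemma continuous_cutoff (δ : ℝ) : Continuous (cutoff (d := d) δ) := by
  unfold cutoff
  fun_prop

lemma continuous_ofReal_cutoff (δ : ℝ) : Continuous fun z : Rd d × Rd d => (cutoff δ z : ℂ) :=
  Complex.continuous_ofReal.comp (continuous_cutoff δ)

lemma tendsto_cutoff (z : Rd d × Rd d) : Tendsto (fun δ => cutoff δ z) (𝓝 0) (𝓝 1) := by
  have continuous_left : Continuous fun δ => cutoff δ z := by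
    unfold cutoff
    fun_prop
  simpa [cutoff] using continuous_left.tendsto 0

lemma abs_cutoff_sub_le {δ : ℝ} (hδ : 0 ≤ δ) (z z' : Rd d × Rd d) :
    |cutoff δ z' - cutoff δ z| ≤ δ * ‖z - z'‖ :=
  calc |cutoff δ z' - cutoff δ z|
      ≤ max |0 - 0| |1 - δ * ‖z'‖ - (1 - δ * ‖z‖)| := abs_max_sub_max_le_max _ _ _ _
    _ = δ * |‖z‖ - ‖z'‖| := by
        rw [sub_self, abs_zero, max_eq_right (abs_nonneg _), sub_sub_sub_cancel_left, ← mul_sub,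
          abs_mul, abs_of_nonneg hδ]
    _ ≤ δ * ‖z - z'‖ := by
        gcongr
        exact abs_norm_sub_norm_le z z'

lemma abs_cutoff_sub_le_one {δ : ℝ} (hδ : 0 ≤ δ) (z z' : Rd d × Rd d) :
    |cutoff δ z' - cutoff δ z| ≤ 1 :=
  abs_sub_le_of_nonneg_of_le (cutoff_nonneg δ z') (cutoff_le_one hδ z') (cutoff_nonneg δ z)
    (cutoff_le_one hδ z)

lemma enorm_ofReal_cutoff_mul_le {δ : ℝ} (hδ : 0 ≤ δ) (z : Rd d × Rd d) (c : ℂ) :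
    ‖(cutoff δ z : ℂ) * c‖ₑ ≤ ‖c‖ₑ := by
  rw [enorm_le_iff_norm_le, norm_mul, Complex.norm_real, Real.norm_of_nonneg (cutoff_nonneg δ z)]
  exact mul_le_of_le_one_left (norm_nonneg c) (cutoff_le_one hδ z)

lemma enorm_cutoff_sub_one_mul_le {δ : ℝ} (hδ : 0 ≤ δ) (z : Rd d × Rd d) (c : ℂ) :
    ‖(cutoff δ z - 1 : ℂ) * c‖ₑ ≤ ‖c‖ₑ := by
  rw [enorm_le_iff_norm_le, norm_mul, ← Complex.ofReal_one, ← Complex.ofReal_sub,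
    Complex.norm_real]
  exact mul_le_of_le_one_left (norm_nonneg c) (abs_sub_le_of_nonneg_of_le (cutoff_nonneg δ z)
    (cutoff_le_one hδ z) zero_le_one le_rfl)

lemma phaseWeight_pow_le_of_norm_le {R : ℝ} {z : Rd d × Rd d} (hz : ‖z‖ ≤ R) (n : ℕ) :
    phaseWeight z ^ n ≤ ((1 + R) ^ 2) ^ n := by
  have := phaseWeight_pos z
  have := phaseWeight_le_one_add_norm_sq z
  gcongr
  exact this.trans (by gcongr)

lemma phaseWeight_pow_mul_norm_cutoff_mul_le {δ : ℝ} (hδ : 0 < δ) (m : ℕ) {c : ℂ} {a : ℝ}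
    (z : Rd d × Rd d) (ha : 0 ≤ a) (hc : ‖z‖ ≤ 1 / δ → ‖c‖ ≤ a) :
    phaseWeight z ^ m * ‖(cutoff δ z : ℂ) * c‖ ≤ ((1 + 1 / δ) ^ 2) ^ m * a := by
  rcases le_or_gt ‖z‖ (1 / δ) with hz | hz
  · rw [norm_mul, Complex.norm_real, Real.norm_of_nonneg (cutoff_nonneg δ z)]
    exact mul_le_mul (phaseWeight_pow_le_of_norm_le hz m)
      ((mul_le_of_le_one_left (norm_nonneg c) (cutoff_le_one hδ.le z)).trans (hc hz))
      (mul_nonneg (cutoff_nonneg δ z) (norm_nonneg c)) (by positivity)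
  · rw [cutoff_eq_zero hδ hz, Complex.ofReal_zero, zero_mul, norm_zero, mul_zero]
    positivity

end Cutoff

section Discretisation

variable {d : ℕ}

lemma exists_phaseWeight_pow_mul_stftKernel_le_of_lt_norm (g : 𝓢(Rd d, ℂ)) (R : ℝ) (m : ℕ) {ε : ℝ}
    (hε : 0 < ε) : ∃ R' : ℝ, ∀ z y : Rd d × Rd d, R' < ‖z‖ → ‖y‖ ≤ R →
      phaseWeight z ^ m * ‖stftKernel g z y‖ ≤ ε := by
  obtain ⟨B, hB, h⟩ := exists_phaseWeight_pow_mul_stftKernel_le g (m + 1)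
  let D := ((1 + R) ^ 2) ^ (m + 1) * B
  refine ⟨D / ε, fun z y hz hy => ?_⟩
  have lt_phaseWeight : D < ε * phaseWeight z := by
    rw [← div_lt_iff₀' hε]
    exact hz.trans_le (norm_le_phaseWeight z)
  refine le_of_mul_le_mul_right ?_ (phaseWeight_pos z)
  calc phaseWeight z ^ m * ‖stftKernel g z y‖ * phaseWeight z
      = phaseWeight z ^ (m + 1) * ‖stftKernel g z y‖ := by ring
    _ ≤ phaseWeight y ^ (m + 1) * B := phaseWeight_pow_mul_stftKernel_le h z y
    _ ≤ D := mul_le_mul_of_nonneg_right (phaseWeight_pow_le_of_norm_le hy _) hB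
    _ ≤ ε * phaseWeight z := lt_phaseWeight.le

lemma exists_stftKernel_equicontinuous (g : 𝓢(Rd d, ℂ)) (R : ℝ) (m : ℕ) {ε : ℝ} (hε : 0 < ε) :
    ∃ η : ℝ, 0 < η ∧ ∀ y y' : Rd d × Rd d, ‖y‖ ≤ R → ‖y'‖ ≤ R → dist y y' < η →
      ∀ z, phaseWeight z ^ m * ‖stftKernel g z y - stftKernel g z y'‖ ≤ ε := by
  obtain ⟨R', far⟩ := exists_phaseWeight_pow_mul_stftKernel_le_of_lt_norm g R m (half_pos hε)
  have continuous_weighted : Continuous fun a : (Rd d × Rd d) × (Rd d × Rd d) =>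
      ((phaseWeight a.1 ^ m : ℝ) : ℂ) * stftKernel g a.1 a.2 := by
    have continuous_phaseWeight : Continuous (phaseWeight (d := d)) := by
      unfold phaseWeight
      fun_prop
    exact (Complex.continuous_ofReal.comp ((continuous_phaseWeight.comp continuous_fst).pow m)).mul
      (continuous_stftKernel g)
  obtain ⟨η, hη, near⟩ := Metric.uniformContinuousOn_iff.1
    (((isCompact_closedBall 0 R').prod (isCompact_closedBall 0 R)).uniformContinuousOn_of_continuous
      continuous_weighted.continuousOn) ε hε
  refine ⟨η, hη, fun y y' hy hy' hyy' z => ?_⟩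
  have hz := phaseWeight_pos z
  rcases le_or_gt ‖z‖ R' with hzR | hzR
  · have dist_lt := near (z, y) (by simp [hzR, hy]) (z, y') (by simp [hzR, hy'])
      (by simpa [Prod.dist_eq, hη] using hyy')
    rw [dist_eq_norm, ← mul_sub, norm_mul, Complex.norm_real,
      Real.norm_of_nonneg (by positivity)] at dist_lt
    exact dist_lt.le
  · calc phaseWeight z ^ m * ‖stftKernel g z y - stftKernel g z y'‖
        ≤ phaseWeight z ^ m * ‖stftKernel g z y‖ + phaseWeight z ^ m * ‖stftKernel g z y'‖ := by
          rw [← mul_add]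
          gcongr
          exact norm_sub_le _ _
      _ ≤ ε := by linarith [far z y hzR hy, far z y' hzR hy']

lemma exists_simpleFunc_dist_lt {α : Type*} [PseudoMetricSpace α]
    [TopologicalSpace.SeparableSpace α] [MeasurableSpace α] [OpensMeasurableSpace α] [Nonempty α]
    {K : Set α} (hK : IsCompact K) {r : ℝ} (hr : 0 < r) :
    ∃ ζ : SimpleFunc α α, ∀ y ∈ K, dist (ζ y) y < r := by
  let e := TopologicalSpace.denseSeq α
  obtain ⟨t, ht⟩ := hK.elim_finite_subcover (fun i => Metric.ball (e i) r)
    (fun _ => Metric.isOpen_ball) fun y _ =>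
      Set.mem_iUnion.2 ((TopologicalSpace.denseRange_denseSeq α).exists_dist_lt y hr)
  refine ⟨SimpleFunc.nearestPt e (t.sup id), fun y hy => ?_⟩
  obtain ⟨i, hi, hyi⟩ := Set.mem_iUnion₂.1 (ht hy)
  have edist_le := SimpleFunc.edist_nearestPt_le e y (Finset.le_sup (f := id) hi)
  rw [edist_dist, edist_dist, ENNReal.ofReal_le_ofReal_iff dist_nonneg] at edist_le
  exact edist_le.trans_lt (Metric.mem_ball'.1 hyi)

lemma exists_simpleFunc_stftKernel_sub_le (g : 𝓢(Rd d, ℂ)) (R : ℝ) (m : ℕ) {ε : ℝ} (hε : 0 < ε) :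
    ∃ ζ : SimpleFunc (Rd d × Rd d) (Rd d × Rd d), ∀ y, ‖y‖ ≤ R → ∀ z,
      phaseWeight z ^ m * ‖stftKernel g z (ζ y) - stftKernel g z y‖ ≤ ε := by
  obtain ⟨η, hη, h⟩ := exists_stftKernel_equicontinuous g (R + 1) m hε
  obtain ⟨ζ, hζ⟩ := exists_simpleFunc_dist_lt (isCompact_closedBall (0 : Rd d × Rd d) R)
    (lt_min hη one_pos)
  refine ⟨ζ, fun y hy => ?_⟩
  have dist_lt := hζ y (mem_closedBall_zero_iff.2 hy)
  refine h _ y ?_ (by linarith) (dist_lt.trans_le (min_le_left _ _))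
  have norm_sub_le : ‖ζ y - y‖ ≤ 1 := by
    rw [← dist_eq_norm]
    exact dist_lt.le.trans (min_le_right _ _)
  linarith [norm_le_norm_add_norm_sub' (ζ y) y]

/-- The kernel of `f ↦ ∑ y, (∫ over ζ = y of cutoff δ * stft g f) • shiftDistribution g y`, the
localisation operator with symbol `cutoff δ` discretised by `ζ`, on the side of short-time Fourier
transforms. -/
def sampledKernel (g : 𝓢(Rd d, ℂ)) (δ : ℝ) (ζ : SimpleFunc (Rd d × Rd d) (Rd d × Rd d))
    (z z' : Rd d × Rd d) : ℂ :=
  (cutoff δ z' : ℂ) * stftKernel g z (ζ z')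

/-- The kernel of the error made by discretising the localisation operator with symbol
`cutoff δ`. -/
def discretisationKernel (g : 𝓢(Rd d, ℂ)) (δ : ℝ) (ζ : SimpleFunc (Rd d × Rd d) (Rd d × Rd d))
    (z z' : Rd d × Rd d) : ℂ :=
  (cutoff δ z' : ℂ) * (stftKernel g z (ζ z') - stftKernel g z z')

/-- The kernel of the commutator of multiplication by the cutoff with the reproducing kernel. -/
def commutatorKernel (g : 𝓢(Rd d, ℂ)) (δ : ℝ) (z z' : Rd d × Rd d) : ℂ :=
  ((cutoff δ z' - cutoff δ z : ℝ) : ℂ) * stftKernel g z z'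

lemma measurable_discretisationKernel (g : 𝓢(Rd d, ℂ)) (δ : ℝ)
    (ζ : SimpleFunc (Rd d × Rd d) (Rd d × Rd d)) :
    Measurable (Function.uncurry (discretisationKernel g δ ζ)) := by
  have measurable_kernel := (continuous_stftKernel g).measurable
  exact ((continuous_ofReal_cutoff δ).measurable.comp measurable_snd).mul
    ((measurable_kernel.comp (measurable_fst.prodMk (ζ.measurable.comp measurable_snd))).sub
      measurable_kernel)

lemma measurable_commutatorKernel (g : 𝓢(Rd d, ℂ)) (δ : ℝ) :
    Measurable (Function.uncurry (commutatorKernel g δ)) := by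
  have := continuous_cutoff (d := d) δ
  have := continuous_stftKernel g
  refine Continuous.measurable (Continuous.mul ?_ this)
  fun_prop

lemma exists_simpleFunc_discretisationKernel_le (g : 𝓢(Rd d, ℂ)) (m : ℕ) {δ ε : ℝ} (hδ : 0 < δ)
    (hε : 0 < ε) : ∃ ζ : SimpleFunc (Rd d × Rd d) (Rd d × Rd d), ∀ z z',
      phaseWeight z ^ m * (phaseWeight z' ^ m * ‖discretisationKernel g δ ζ z z'‖) ≤ ε := by
  let D := ((1 + 1 / δ) ^ 2) ^ m
  have hD : 0 < D := by positivity
  obtain ⟨ζ, hζ⟩ := exists_simpleFunc_stftKernel_sub_le g (1 / δ) m (div_pos hε hD)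
  refine ⟨ζ, fun z z' => ?_⟩
  have hz : 0 < phaseWeight z ^ m := pow_pos (phaseWeight_pos z) m
  rw [← le_div_iff₀' hz]
  calc phaseWeight z' ^ m * ‖discretisationKernel g δ ζ z z'‖
      ≤ D * (ε / D / phaseWeight z ^ m) := by
        refine phaseWeight_pow_mul_norm_cutoff_mul_le hδ m z' (by positivity) fun hz' => ?_
        rw [le_div_iff₀' hz]
        exact hζ z' hz' z
    _ = ε / phaseWeight z ^ m := by field_simp

/-- The part of the cutoff living on a fibre of a simple function. -/
def cutoffPiece (δ : ℝ) (ζ : SimpleFunc (Rd d × Rd d) (Rd d × Rd d)) (y : Rd d × Rd d) :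
    Rd d × Rd d → ℂ :=
  (ζ ⁻¹' {y}).indicator fun z => (cutoff δ z : ℂ)

lemma aestronglyMeasurable_cutoffPiece (δ : ℝ) (ζ : SimpleFunc (Rd d × Rd d) (Rd d × Rd d))
    (y : Rd d × Rd d) : AEStronglyMeasurable (cutoffPiece δ ζ y) volume :=
  (continuous_ofReal_cutoff δ).aestronglyMeasurable.indicator (ζ.measurableSet_fiber y)

lemma phaseWeight_pow_mul_norm_cutoffPiece_le {δ : ℝ} (hδ : 0 < δ)
    (ζ : SimpleFunc (Rd d × Rd d) (Rd d × Rd d)) (m : ℕ) (y z : Rd d × Rd d) :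
    phaseWeight z ^ m * ‖cutoffPiece δ ζ y z‖ ≤ ((1 + 1 / δ) ^ 2) ^ m := by
  have hz := phaseWeight_pos z
  calc phaseWeight z ^ m * ‖cutoffPiece δ ζ y z‖
      ≤ phaseWeight z ^ m * ‖(cutoff δ z : ℂ) * 1‖ := by
        rw [mul_one]
        gcongr
        exact norm_indicator_le_norm_self _ _
    _ ≤ ((1 + 1 / δ) ^ 2) ^ m * 1 :=
        phaseWeight_pow_mul_norm_cutoff_mul_le hδ m z zero_le_one fun _ => norm_one.le
    _ = _ := mul_one _

lemma sum_cutoffPiece_mul (δ : ℝ) (ζ : SimpleFunc (Rd d × Rd d) (Rd d × Rd d))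
    (c : Rd d × Rd d → ℂ) (z : Rd d × Rd d) :
    ∑ y ∈ ζ.range, cutoffPiece δ ζ y z * c y = cutoff δ z * c (ζ z) := by
  rw [Finset.sum_eq_single_of_mem (ζ z) (ζ.mem_range_self z) fun y _ hy => ?_, cutoffPiece,
    Set.indicator_of_mem (show z ∈ ζ ⁻¹' {ζ z} from rfl)]
  rw [cutoffPiece, Set.indicator_of_notMem (by simpa using hy.symm), zero_mul]

end Discretisation

/-! ### Integral operators acting on short-time Fourier transforms -/

section IntegralOperators

variable {d : ℕ} {N : (Rd d × Rd d → ℝ≥0∞) → ℝ≥0∞} {w : Rd d × Rd d → ℝ} {C : ℝ} {k : ℕ}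
  {g : 𝓢(Rd d, ℂ)}

/-- The integral operator with kernel `κ` applied to the short-time Fourier transform of `f`. -/
def stftIntegral (κ : Rd d × Rd d → Rd d × Rd d → ℂ) (g : 𝓢(Rd d, ℂ)) (f : 𝓢'(Rd d, ℂ))
    (z : Rd d × Rd d) : ℂ :=
  ∫ z', κ z z' * stft g f z'

lemma IsControlledWeight.aemeasurable_enorm_stftIntegral_mul (hw : IsControlledWeight w C k)
    {κ : Rd d × Rd d → Rd d × Rd d → ℂ} (hκ : Measurable (Function.uncurry κ)) (g : 𝓢(Rd d, ℂ))
    (f : 𝓢'(Rd d, ℂ)) : AEMeasurable fun z => ‖stftIntegral κ g f z * (w z : ℂ)‖ₑ := by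
  have measurable_integrand : Measurable fun a : (Rd d × Rd d) × (Rd d × Rd d) =>
      κ a.1 a.2 * stft g f a.2 :=
    hκ.mul ((continuous_stft g f).measurable.comp measurable_snd)
  exact (measurable_integrand.stronglyMeasurable.integral_prod_right'.aestronglyMeasurable.mul
    (Complex.continuous_ofReal.comp_aestronglyMeasurable hw.aestronglyMeasurable)).enorm

lemma integrable_stftKernel_mul_stft (g : 𝓢(Rd d, ℂ)) (f : 𝓢'(Rd d, ℂ)) (z : Rd d × Rd d) :
    Integrable (fun z' => stftKernel g z z' * stft g f z') volume :=
  integrable_shiftPairing_mul_stft g _ _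

lemma integrable_commutatorKernel_mul_stft (g : 𝓢(Rd d, ℂ)) (f : 𝓢'(Rd d, ℂ)) {δ : ℝ}
    (hδ : 0 ≤ δ) (z : Rd d × Rd d) :
    Integrable (fun z' => commutatorKernel g δ z z' * stft g f z') volume := by
  simp only [commutatorKernel, mul_assoc]
  refine (integrable_stftKernel_mul_stft g f z).bdd_mul (c := 1)
    (Complex.continuous_ofReal.comp ((continuous_cutoff δ).sub
      continuous_const)).aestronglyMeasurable (Eventually.of_forall fun z' => ?_)
  rw [Complex.norm_real]
  exact abs_cutoff_sub_le_one hδ z z'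

lemma stftIntegral_sampledKernel {f : 𝓢'(Rd d, ℂ)} {δ : ℝ} (hδ : 0 ≤ δ)
    {ζ : SimpleFunc (Rd d × Rd d) (Rd d × Rd d)} {z : Rd d × Rd d}
    (hi : Integrable (fun z' => discretisationKernel g δ ζ z z' * stft g f z') volume) :
    stftIntegral (sampledKernel g δ ζ) g f z =
      stftIntegral (discretisationKernel g δ ζ) g f z +
        stftIntegral (commutatorKernel g δ) g f z + moyalConst g * (cutoff δ z * stft g f z) := by
  have integrable_commutator := integrable_commutatorKernel_mul_stft g f hδ z
  have integrable_sum : Integrable (fun z' => discretisationKernel g δ ζ z z' * stft g f z' +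
      commutatorKernel g δ z z' * stft g f z') volume := hi.add integrable_commutator
  have reproducing : (moyalConst g : ℂ) * (cutoff δ z * stft g f z) =
      ∫ z', (cutoff δ z : ℂ) * (stftKernel g z z' * stft g f z') := by
    rw [integral_const_mul, integral_stftKernel_mul_stft, mul_left_comm]
  rw [reproducing, stftIntegral, stftIntegral, stftIntegral,
    ← integral_add hi integrable_commutator,
    ← integral_add integrable_sum ((integrable_stftKernel_mul_stft g f z).const_mul _)]
  refine integral_congr_ae (Eventually.of_forall fun z' => ?_)
  simp only [sampledKernel, discretisationKernel, commutatorKernel, Complex.ofReal_sub]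
  ring

lemma sum_integral_cutoffPiece_mul_stftKernel {f : 𝓢'(Rd d, ℂ)} {δ : ℝ}
    {ζ : SimpleFunc (Rd d × Rd d) (Rd d × Rd d)}
    (hi : ∀ y, Integrable (fun z => cutoffPiece δ ζ y z * stft g f z) volume) (z : Rd d × Rd d) :
    ∑ y ∈ ζ.range, (∫ z', cutoffPiece δ ζ y z' * stft g f z') * stftKernel g z y =
      stftIntegral (sampledKernel g δ ζ) g f z := by
  simp only [← integral_mul_const]
  rw [← integral_finsetSum _ fun y _ => (hi y).mul_const _]
  refine integral_congr_ae (Eventually.of_forall fun z' => ?_)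
  calc ∑ y ∈ ζ.range, cutoffPiece δ ζ y z' * stft g f z' * stftKernel g z y
      = (∑ y ∈ ζ.range, cutoffPiece δ ζ y z' * stftKernel g z y) * stft g f z' := by
        rw [Finset.sum_mul]
        exact Finset.sum_congr rfl fun y _ => mul_right_comm _ _ _
    _ = sampledKernel g δ ζ z z' * stft g f z' := by rw [sum_cutoffPiece_mul, sampledKernel]

lemma IsControlledWeight.enorm_stftIntegral_commutatorKernel_le (hw : IsControlledWeight w C k)
    {B : ℝ} (hB : 0 ≤ B) (hBK : ∀ z z' : Rd d × Rd d, ‖z - z'‖ * ‖stftKernel g z z'‖ * w z ≤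
      B * (phaseWeight (z - z') ^ (d + 1))⁻¹ * w z') (f : 𝓢'(Rd d, ℂ)) {δ : ℝ} (hδ : 0 ≤ δ)
    (z : Rd d × Rd d) : ‖stftIntegral (commutatorKernel g δ) g f z * (w z : ℂ)‖ₑ ≤
      ENNReal.ofReal (δ * B) * ∫⁻ z', phaseDecay (z - z') * ‖stft g f z' * (w z' : ℂ)‖ₑ := by
  rw [stftIntegral, ← integral_mul_const, ← lintegral_const_mul' _ _ ENNReal.ofReal_ne_top]
  refine (enorm_integral_le_lintegral_enorm _).trans (lintegral_mono fun z' => ?_)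
  have hzz' := phaseWeight_pos (z - z')
  have hz := hw.nonneg z
  rw [← ofReal_norm, ← ofReal_norm, phaseDecay, ← ENNReal.ofReal_mul (by positivity),
    ← ENNReal.ofReal_mul (by positivity)]
  refine ENNReal.ofReal_le_ofReal ?_
  simp only [commutatorKernel, norm_mul, Complex.norm_real, Real.norm_of_nonneg hz,
    Real.norm_of_nonneg (hw.nonneg z'), Real.norm_eq_abs]
  calc |cutoff δ z' - cutoff δ z| * ‖stftKernel g z z'‖ * ‖stft g f z'‖ * w z
      ≤ δ * ‖z - z'‖ * ‖stftKernel g z z'‖ * ‖stft g f z'‖ * w z := by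
        gcongr
        exact abs_cutoff_sub_le hδ z z'
    _ = δ * ‖stft g f z'‖ * (‖z - z'‖ * ‖stftKernel g z z'‖ * w z) := by ring
    _ ≤ δ * ‖stft g f z'‖ * (B * (phaseWeight (z - z') ^ (d + 1))⁻¹ * w z') :=
        mul_le_mul_of_nonneg_left (hBK z z') (by positivity)
    _ = _ := by ring

namespace AdmissibleNorm

lemma exists_stftIntegral_commutatorKernel_le (hN : AdmissibleNorm N)
    (hw : IsControlledWeight w C k) (g : 𝓢(Rd d, ℂ)) :
    ∃ A : ℝ, 0 ≤ A ∧ ∀ (f : 𝓢'(Rd d, ℂ)) (δ : ℝ), 0 ≤ δ →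
      N (fun z => ‖stftIntegral (commutatorKernel g δ) g f z * (w z : ℂ)‖ₑ) ≤
        ENNReal.ofReal (A * δ) * stftNorm N w g f := by
  obtain ⟨B, hB, hBK⟩ := hw.exists_norm_mul_stftKernel_mul_le g
  let I := (∫⁻ z : Rd d × Rd d, phaseDecay z).toReal
  have : 0 ≤ I := ENNReal.toReal_nonneg
  refine ⟨B * I, by positivity, fun f δ hδ => ?_⟩
  calc N (fun z => ‖stftIntegral (commutatorKernel g δ) g f z * (w z : ℂ)‖ₑ)
      ≤ N (fun z => ENNReal.ofReal (δ * B) *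
          ∫⁻ z', phaseDecay (z - z') * ‖stft g f z' * (w z' : ℂ)‖ₑ) :=
        hN.mono (hw.enorm_stftIntegral_commutatorKernel_le hB hBK f hδ)
    _ ≤ ENNReal.ofReal (δ * B) * ((∫⁻ z, phaseDecay z) * stftNorm N w g f) := by
        rw [hN.const_mul ENNReal.ofReal_ne_top]
        gcongr
        exact hN.conv_le measurable_phaseDecay (fun z => ENNReal.ofReal_ne_top)
          (hw.aemeasurable_enorm_stft_mul g f)
    _ = ENNReal.ofReal (B * I * δ) * stftNorm N w g f := by
        rw [← mul_assoc, ← ENNReal.ofReal_toReal lintegral_phaseDecay_lt_top.ne,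
          ← ENNReal.ofReal_mul (by positivity)]
        congr 2
        ring

lemma exists_stftIntegral_le_of_decay (hN : AdmissibleNorm N) (hw : IsControlledWeight w C k)
    (g : 𝓢(Rd d, ℂ)) :
    ∃ A : ℝ, 0 ≤ A ∧ ∀ (κ : Rd d × Rd d → Rd d × Rd d → ℂ) (ε : ℝ) (f : 𝓢'(Rd d, ℂ)),
      (∀ z z', phaseWeight z ^ (d + 1 + k) * (phaseWeight z' ^ (d + 1 + k) * ‖κ z z'‖) ≤ ε) →
      stftNorm N w g f < ∞ →
      N (fun z => ‖stftIntegral κ g f z * (w z : ℂ)‖ₑ) ≤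
        ENNReal.ofReal (A * ε) * stftNorm N w g f := by
  obtain ⟨A, hA, h⟩ := hN.exists_norm_integral_mul_stft_le hw g
  have hC := hw.const_pos
  let ν := (N phaseDecay).toReal
  have : 0 ≤ ν := ENNReal.toReal_nonneg
  refine ⟨C * A * ν, by positivity, fun κ ε f hκ hf => ?_⟩
  let r := (stftNorm N w g f).toReal
  have : 0 ≤ r := ENNReal.toReal_nonneg
  have hε : 0 ≤ ε := by
    have := phaseWeight_pos (0 : Rd d × Rd d)
    exact le_trans (by positivity) (hκ 0 0)
  have decay (z : Rd d × Rd d) :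
      phaseWeight z ^ (d + 1 + k) * ‖stftIntegral κ g f z‖ ≤ A * ε * r := by
    have hz := phaseWeight_pos z
    calc phaseWeight z ^ (d + 1 + k) * ‖stftIntegral κ g f z‖
        ≤ phaseWeight z ^ (d + 1 + k) * (A * (ε / phaseWeight z ^ (d + 1 + k)) * r) := by
          gcongr
          exact h f (κ z) _ hf fun z' => (le_div_iff₀' (by positivity)).2 (hκ z z')
      _ = A * ε * r := by field_simp
  calc N (fun z => ‖stftIntegral κ g f z * (w z : ℂ)‖ₑ)
      ≤ N (fun z => ENNReal.ofReal (C * (A * ε * r)) * phaseDecay z) :=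
        hN.mono (hw.enorm_mul_le decay)
    _ = ENNReal.ofReal (C * (A * ε * r)) * ENNReal.ofReal ν := by
        rw [hN.const_mul ENNReal.ofReal_ne_top, ENNReal.ofReal_toReal hN.decay_lt_top.ne]
    _ = ENNReal.ofReal (C * A * ν * ε) * ENNReal.ofReal r := by
        rw [← ENNReal.ofReal_mul (by positivity), ← ENNReal.ofReal_mul (by positivity)]
        congr 1
        ring
    _ = ENNReal.ofReal (C * A * ν * ε) * stftNorm N w g f := by
        rw [ENNReal.ofReal_toReal hf.ne]

lemma exists_simpleFunc_stftIntegral_discretisationKernel_le (hN : AdmissibleNorm N)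
    (hw : IsControlledWeight w C k) (g : 𝓢(Rd d, ℂ)) {δ : ℝ} (hδ : 0 < δ) :
    ∃ ζ : SimpleFunc (Rd d × Rd d) (Rd d × Rd d), ∀ f : 𝓢'(Rd d, ℂ), stftNorm N w g f < ∞ →
      (∀ z, Integrable (fun z' => discretisationKernel g δ ζ z z' * stft g f z') volume) ∧
      N (fun z => ‖stftIntegral (discretisationKernel g δ ζ) g f z * (w z : ℂ)‖ₑ) ≤
        ENNReal.ofReal δ * stftNorm N w g f := by
  obtain ⟨A, hA, h⟩ := hN.exists_stftIntegral_le_of_decay hw g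
  obtain ⟨ζ, hζ⟩ := exists_simpleFunc_discretisationKernel_le g (d + 1 + k) hδ
    (show 0 < δ / (A + 1) by positivity)
  refine ⟨ζ, fun f hf => ⟨fun z => ?_, (h _ _ f hζ hf).trans ?_⟩⟩
  · exact hN.integrable_mul_stft hw hf
      (measurable_discretisationKernel g δ ζ).of_uncurry_left.aestronglyMeasurable
      fun z' => (le_div_iff₀' (pow_pos (phaseWeight_pos z) _)).2 (hζ z z')
  · gcongr
    rw [mul_div_assoc', div_le_iff₀ (by positivity)]
    linarith

end AdmissibleNorm

end IntegralOperators

/-! ### Approximate identities of finite rank -/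

section FiniteRank

variable {d : ℕ} {N : (Rd d × Rd d → ℝ≥0∞) → ℝ≥0∞} {w : Rd d × Rd d → ℝ} {C : ℝ} {k : ℕ}
  {g : 𝓢(Rd d, ℂ)}

/-- The defect of `f'` from being the localisation of `f` to the cutoff, on the side of short-time
Fourier transforms. -/
def cutoffDefect (g : 𝓢(Rd d, ℂ)) (δ : ℝ) (f f' : 𝓢'(Rd d, ℂ)) (z : Rd d × Rd d) : ℂ :=
  stft g f' z - cutoff δ z * stft g f z

lemma IsControlledWeight.aemeasurable_enorm_cutoffDefect_mul (hw : IsControlledWeight w C k)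
    (g : 𝓢(Rd d, ℂ)) (δ : ℝ) (f f' : 𝓢'(Rd d, ℂ)) :
    AEMeasurable fun z => ‖cutoffDefect g δ f f' z * (w z : ℂ)‖ₑ :=
  (hw.aestronglyMeasurable_mul ((continuous_stft g f').sub
    ((continuous_ofReal_cutoff δ).mul (continuous_stft g f)))).enorm

lemma IsControlledWeight.aemeasurable_enorm_cutoff_sub_one_mul (hw : IsControlledWeight w C k)
    (g : 𝓢(Rd d, ℂ)) (δ : ℝ) (f : 𝓢'(Rd d, ℂ)) :
    AEMeasurable fun z => ‖(cutoff δ z - 1 : ℂ) * (stft g f z * (w z : ℂ))‖ₑ :=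
  (((continuous_ofReal_cutoff δ).sub continuous_const).aestronglyMeasurable.mul
    (hw.aestronglyMeasurable_mul (continuous_stft g f))).enorm

lemma cutoffDefect_eq (hg : g ≠ 0) {f f' : 𝓢'(Rd d, ℂ)} {δ : ℝ} (hδ : 0 ≤ δ)
    {ζ : SimpleFunc (Rd d × Rd d) (Rd d × Rd d)} {z : Rd d × Rd d}
    (hi : Integrable (fun z' => discretisationKernel g δ ζ z z' * stft g f z') volume)
    (hf' : stft g f' z = (moyalConst g : ℂ)⁻¹ * stftIntegral (sampledKernel g δ ζ) g f z) :
    cutoffDefect g δ f f' z = (moyalConst g : ℂ)⁻¹ *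
      (stftIntegral (discretisationKernel g δ ζ) g f z +
        stftIntegral (commutatorKernel g δ) g f z) := by
  have hM : (moyalConst g : ℂ) ≠ 0 := Complex.ofReal_ne_zero.2 (moyalConst_pos hg).ne'
  rw [cutoffDefect, hf', stftIntegral_sampledKernel hδ hi, mul_add _ _ ((moyalConst g : ℂ) * _),
    inv_mul_cancel_left₀ hM, add_sub_cancel_right]

namespace AdmissibleNorm

lemma stftNorm_le_add_cutoffDefect (hN : AdmissibleNorm N) (hw : IsControlledWeight w C k)
    {δ : ℝ} (hδ : 0 ≤ δ) (f f' : 𝓢'(Rd d, ℂ)) :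
    stftNorm N w g f' ≤
      stftNorm N w g f + N (fun z => ‖cutoffDefect g δ f f' z * (w z : ℂ)‖ₑ) := by
  refine (hN.mono fun z => ?_).trans (hN.add_le (hw.aemeasurable_enorm_stft_mul g f)
    (hw.aemeasurable_enorm_cutoffDefect_mul g δ f f'))
  calc ‖stft g f' z * (w z : ℂ)‖ₑ
      = ‖cutoff δ z * (stft g f z * (w z : ℂ)) + cutoffDefect g δ f f' z * (w z : ℂ)‖ₑ := by
        rw [cutoffDefect]
        ring_nf
    _ ≤ ‖stft g f z * (w z : ℂ)‖ₑ + ‖cutoffDefect g δ f f' z * (w z : ℂ)‖ₑ :=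
        (enorm_add_le _ _).trans (by grw [enorm_ofReal_cutoff_mul_le hδ])

lemma stftNorm_sub_le_add_cutoffDefect (hN : AdmissibleNorm N) (hw : IsControlledWeight w C k)
    (δ : ℝ) (f f' : 𝓢'(Rd d, ℂ)) :
    stftNorm N w g (f' - f) ≤
      N (fun z => ‖(cutoff δ z - 1 : ℂ) * (stft g f z * (w z : ℂ))‖ₑ) +
        N (fun z => ‖cutoffDefect g δ f f' z * (w z : ℂ)‖ₑ) := by
  refine (hN.mono fun z => ?_).trans (hN.add_le (hw.aemeasurable_enorm_cutoff_sub_one_mul g δ f)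
    (hw.aemeasurable_enorm_cutoffDefect_mul g δ f f'))
  refine Eq.trans_le ?_ (enorm_add_le _ _)
  rw [stft_sub, cutoffDefect]
  ring_nf

lemma tendsto_cutoff_sub_one_mul (hN : AdmissibleNorm N) (hw : IsControlledWeight w C k)
    {δ : ℕ → ℝ} (hδ : ∀ n, 0 ≤ δ n) (hδ_lim : Tendsto δ atTop (𝓝 0)) {f : 𝓢'(Rd d, ℂ)}
    (hf : stftNorm N w g f < ∞) :
    Tendsto (fun n => N fun z => ‖(cutoff (δ n) z - 1 : ℂ) * (stft g f z * (w z : ℂ))‖ₑ)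
      atTop (𝓝 0) := by
  refine hN.tendsto_zero (fun n => hw.aemeasurable_enorm_cutoff_sub_one_mul g (δ n) f)
    (hw.aemeasurable_enorm_stft_mul g f)
    (fun n => Eventually.of_forall fun z => enorm_cutoff_sub_one_mul_le (hδ n) z _) hf
    (Eventually.of_forall fun z => ?_)
  have tendsto_ofReal : Tendsto (fun n => (cutoff (δ n) z : ℂ)) atTop (𝓝 1) := by
    simpa [Function.comp_def] using
      (Complex.continuous_ofReal.tendsto 1).comp ((tendsto_cutoff z).comp hδ_lim)
  simpa using ((tendsto_ofReal.sub_const 1).mul_const (stft g f z * (w z : ℂ))).enorm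

lemma enorm_mul_add_mul_le (hN : AdmissibleNorm N) (c : ℂ) {F G : Rd d × Rd d → ℂ}
    (hF : AEMeasurable fun z => ‖F z * (w z : ℂ)‖ₑ)
    (hG : AEMeasurable fun z => ‖G z * (w z : ℂ)‖ₑ) :
    N (fun z => ‖c * (F z + G z) * (w z : ℂ)‖ₑ) ≤
      ‖c‖ₑ * (N (fun z => ‖F z * (w z : ℂ)‖ₑ) + N (fun z => ‖G z * (w z : ℂ)‖ₑ)) := by
  calc N (fun z => ‖c * (F z + G z) * (w z : ℂ)‖ₑ)
      ≤ N (fun z => ‖c‖ₑ * (‖F z * (w z : ℂ)‖ₑ + ‖G z * (w z : ℂ)‖ₑ)) := hN.mono fun z => by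
        rw [mul_assoc, add_mul, enorm_mul]
        gcongr
        exact enorm_add_le _ _
    _ ≤ _ := by
        rw [hN.const_mul enorm_ne_top]
        gcongr
        exact hN.add_le hF hG

end AdmissibleNorm

namespace IsStftSpace

variable {X : Type*} [SeminormedAddCommGroup X] [NormedSpace ℂ X] {J : X →ₗ[ℂ] 𝓢'(Rd d, ℂ)}

lemma exists_clm_integral (hJ : IsStftSpace N w g J) (hN : AdmissibleNorm N)
    (hw : IsControlledWeight w C k) {H : Rd d × Rd d → ℂ} (hm : AEStronglyMeasurable H volume)
    {D : ℝ} (hH : ∀ z, phaseWeight z ^ (d + 1 + k) * ‖H z‖ ≤ D) :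
    ∃ l : X →L[ℂ] ℂ, ∀ x, l x = ∫ z, H z * stft g (J x) z := by
  obtain ⟨A, -, h⟩ := hN.exists_norm_integral_mul_stft_le hw g
  have integrable (x : X) := hN.integrable_mul_stft hw (hJ.lt_top x) hm hH
  let l : X →ₗ[ℂ] ℂ :=
    { toFun x := ∫ z, H z * stft g (J x) z
      map_add' x y := by
        rw [← integral_add (integrable x) (integrable y), map_add]
        exact integral_congr_ae (Eventually.of_forall fun z => mul_add (H z) _ _)
      map_smul' c x := by
        rw [RingHom.id_apply, smul_eq_mul, ← integral_const_mul, map_smul]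
        exact integral_congr_ae (Eventually.of_forall fun z => mul_left_comm (H z) c _) }
  refine ⟨l.mkContinuous (A * D) fun x => ?_, fun x => rfl⟩
  rw [hJ.norm_eq]
  exact h (J x) H D (hJ.lt_top x) hH

lemma exists_finiteRank_stft_eq (hJ : IsStftSpace N w g J) (hN : AdmissibleNorm N)
    (hw : IsControlledWeight w C k) {δ : ℝ} (hδ : 0 < δ)
    (ζ : SimpleFunc (Rd d × Rd d) (Rd d × Rd d)) (c : ℂ) :
    ∃ T : X →L[ℂ] X, FiniteDimensional ℂ (LinearMap.range (T : X →ₗ[ℂ] X)) ∧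
      ∀ x z, stft g (J (T x)) z = c * stftIntegral (sampledKernel g δ ζ) g (J x) z := by
  have decay := phaseWeight_pow_mul_norm_cutoffPiece_le hδ ζ (d + 1 + k)
  have measurable := aestronglyMeasurable_cutoffPiece δ ζ
  choose l hl using fun y => hJ.exists_clm_integral hN hw (measurable y) (decay y)
  choose e he using fun y => hJ.surj _ (hN.stftNorm_shiftDistribution_lt_top hw g y)
  refine ⟨∑ y ∈ ζ.range, (c • l y).smulRight (e y),
    finiteDimensional_range_sum_smulRight _ _ _, fun x z => ?_⟩
  let evalStft : X →ₗ[ℂ] ℂ := (PointwiseConvergenceCLM.evalCLM (RingHom.id ℂ) ℂ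
    (stftAtom g z.1 z.2) : 𝓢'(Rd d, ℂ) →ₗ[ℂ] ℂ) ∘ₗ J
  calc evalStft ((∑ y ∈ ζ.range, (c • l y).smulRight (e y) : X →L[ℂ] X) x)
      = ∑ y ∈ ζ.range, (c • l y) x * stft g (J (e y)) z := by
        rw [_root_.sum_apply, map_sum]
        exact Finset.sum_congr rfl fun y _ => map_smul evalStft _ _
    _ = c * ∑ y ∈ ζ.range,
          (∫ z', cutoffPiece δ ζ y z' * stft g (J x) z') * stftKernel g z y := by
        rw [Finset.mul_sum]
        refine Finset.sum_congr rfl fun y _ => ?_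
        rw [he, stft_shiftDistribution, ← hl, ← mul_assoc]
        rfl
    _ = c * stftIntegral (sampledKernel g δ ζ) g (J x) z := by
        rw [sum_integral_cutoffPiece_mul_stftKernel fun y =>
          hN.integrable_mul_stft hw (hJ.lt_top x) (measurable y) (decay y)]

lemma exists_finiteRank (hJ : IsStftSpace N w g J) (hN : AdmissibleNorm N)
    (hw : IsControlledWeight w C k) (hg : g ≠ 0) :
    ∃ A : ℝ, 0 ≤ A ∧ ∀ δ : ℝ, 0 < δ → ∃ T : X →L[ℂ] X,
      FiniteDimensional ℂ (LinearMap.range (T : X →ₗ[ℂ] X)) ∧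
      ∀ x, N (fun z => ‖cutoffDefect g δ (J x) (J (T x)) z * (w z : ℂ)‖ₑ) ≤
        ENNReal.ofReal (A * δ * ‖x‖) := by
  obtain ⟨A, hA, commutator_le⟩ := hN.exists_stftIntegral_commutatorKernel_le hw g
  have hM := moyalConst_pos hg
  have enorm_inv : ‖(moyalConst g : ℂ)⁻¹‖ₑ = ENNReal.ofReal (moyalConst g)⁻¹ := by
    rw [← Complex.ofReal_inv, ← ofReal_norm, Complex.norm_real,
      Real.norm_of_nonneg (inv_nonneg.2 hM.le)]
  refine ⟨(moyalConst g)⁻¹ * (1 + A), by positivity, fun δ hδ => ?_⟩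
  obtain ⟨ζ, discretisation_le⟩ :=
    hN.exists_simpleFunc_stftIntegral_discretisationKernel_le hw g hδ
  obtain ⟨T, hfin, hT⟩ := hJ.exists_finiteRank_stft_eq hN hw hδ ζ (moyalConst g : ℂ)⁻¹
  refine ⟨T, hfin, fun x => ?_⟩
  obtain ⟨integrable, norm_discretisation_le⟩ := discretisation_le (J x) (hJ.lt_top x)
  simp only [cutoffDefect_eq hg hδ.le (integrable _) (hT x _)]
  refine (hN.enorm_mul_add_mul_le _
    (hw.aemeasurable_enorm_stftIntegral_mul (measurable_discretisationKernel g δ ζ) g (J x))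
    (hw.aemeasurable_enorm_stftIntegral_mul (measurable_commutatorKernel g δ) g (J x))).trans ?_
  calc _ ≤ ENNReal.ofReal (moyalConst g)⁻¹ * (ENNReal.ofReal δ * ENNReal.ofReal ‖x‖ +
          ENNReal.ofReal (A * δ) * ENNReal.ofReal ‖x‖) := by
        rw [enorm_inv, ← hJ.stftNorm_eq]
        gcongr
        exact commutator_le (J x) δ hδ.le
    _ = ENNReal.ofReal ((moyalConst g)⁻¹ * (1 + A) * δ * ‖x‖) := by
        rw [← add_mul, ← ENNReal.ofReal_add hδ.le (by positivity),
          ← ENNReal.ofReal_mul (by positivity), ← ENNReal.ofReal_mul (by positivity)]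
        congr 1
        ring

lemma norm_le_of_cutoffDefect_le (hJ : IsStftSpace N w g J) (hN : AdmissibleNorm N)
    (hw : IsControlledWeight w C k) {δ a : ℝ} (hδ : 0 ≤ δ) (ha : 0 ≤ a) {x x' : X}
    (h : N (fun z => ‖cutoffDefect g δ (J x) (J x') z * (w z : ℂ)‖ₑ) ≤ ENNReal.ofReal a) :
    ‖x'‖ ≤ ‖x‖ + a := by
  rw [← ENNReal.ofReal_le_ofReal_iff (by positivity), ENNReal.ofReal_add (norm_nonneg x) ha,
    ← hJ.stftNorm_eq, ← hJ.stftNorm_eq]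
  grw [hN.stftNorm_le_add_cutoffDefect hw hδ (J x) (J x'), h]

lemma tendsto_of_cutoffDefect (hJ : IsStftSpace N w g J) (hN : AdmissibleNorm N)
    (hw : IsControlledWeight w C k) {δ : ℕ → ℝ} (hδ : ∀ n, 0 ≤ δ n)
    (hδ_lim : Tendsto δ atTop (𝓝 0)) {u : ℕ → X} {x : X}
    (h : Tendsto (fun n => N fun z => ‖cutoffDefect g (δ n) (J x) (J (u n)) z * (w z : ℂ)‖ₑ)
      atTop (𝓝 0)) : Tendsto u atTop (𝓝 x) := by
  have tendsto_ofReal : Tendsto (fun n => ENNReal.ofReal ‖u n - x‖) atTop (𝓝 0) := by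
    refine tendsto_of_tendsto_of_tendsto_of_le_of_le tendsto_const_nhds
      (by simpa only [add_zero] using
        (hN.tendsto_cutoff_sub_one_mul hw hδ hδ_lim (hJ.lt_top x)).add h)
      (fun _ => zero_le) fun n => ?_
    rw [← hJ.stftNorm_eq, map_sub]
    exact hN.stftNorm_sub_le_add_cutoffDefect hw (δ n) (J x) (J (u n))
  rw [tendsto_iff_norm_sub_tendsto_zero]
  simpa [Function.comp_def] using (ENNReal.tendsto_toReal ENNReal.zero_ne_top).comp tendsto_ofReal

lemma metricApproximationProperty (hJ : IsStftSpace N w g J) (hN : AdmissibleNorm N)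
    (hw : IsControlledWeight w C k) (hg : g ≠ 0) : MetricApproximationProperty X := by
  obtain ⟨A, hA, h⟩ := hJ.exists_finiteRank hN hw hg
  let δ (n : ℕ) : ℝ := 1 / ((n : ℝ) + 1)
  have hδ (n : ℕ) : 0 < δ n := by positivity
  have hδ_lim : Tendsto δ atTop (𝓝 0) := tendsto_one_div_add_atTop_nhds_zero_nat
  choose T hfin defect_le using fun n => h (δ n) (hδ n)
  refine metricApproximationProperty_of_tendsto (c := fun n => 1 + A * δ n) hfin
    (fun n x => ?_) (by simpa using (hδ_lim.const_mul A).const_add 1) fun x => ?_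
  · have := hδ n
    rw [one_add_mul]
    exact hJ.norm_le_of_cutoffDefect_le hN hw (hδ n).le (by positivity) (defect_le n x)
  · refine hJ.tendsto_of_cutoffDefect hN hw (fun n => (hδ n).le) hδ_lim ?_
    refine tendsto_of_tendsto_of_tendsto_of_le_of_le tendsto_const_nhds ?_ (fun _ => zero_le)
      fun n => defect_le n x
    simpa using ENNReal.tendsto_ofReal ((hδ_lim.const_mul A).mul_const ‖x‖)

end IsStftSpace

end FiniteRank

/-! ### Modulation and Wiener amalgam spaces -/

section Spaces

variable {d : ℕ} {p q : ℝ} [Fact (1 ≤ p)] [Fact (1 ≤ q)] {w : Rd d × Rd d → ℝ} {C : ℝ} {k : ℕ}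

/-- The inclusion of the modulation space into the tempered distributions. -/
def ModulationSpace.inclusion (p q : ℝ) [Fact (1 ≤ p)] [Fact (1 ≤ q)] (w : Rd d × Rd d → ℝ)
    (g : 𝓢(Rd d, ℂ)) : ModulationSpace p q w g →ₗ[ℂ] 𝓢'(Rd d, ℂ) :=
  Submodule.subtype ((mixedLp d p q).comap (weightedStft w g))

/-- The inclusion of the Wiener amalgam space into the tempered distributions. -/
def WienerAmalgamSpace.inclusion (p q : ℝ) [Fact (1 ≤ p)] [Fact (1 ≤ q)] (w : Rd d × Rd d → ℝ)
    (g : 𝓢(Rd d, ℂ)) : WienerAmalgamSpace p q w g →ₗ[ℂ] 𝓢'(Rd d, ℂ) :=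
  Submodule.subtype ((mixedLp d q p).comap (flipMap d ∘ₗ weightedStft w g))

lemma ModulationSpace.isStftSpace (hw : IsControlledWeight w C k) (g : 𝓢(Rd d, ℂ)) :
    IsStftSpace (mixedENorm p q volume volume) w g (ModulationSpace.inclusion p q w g) := by
  have mixedNorm_eq (f : 𝓢'(Rd d, ℂ)) :
      mixedNorm p q (weightedStft w g f) = stftNorm (mixedENorm p q volume volume) w g f :=
    mixedNorm_eq_mixedENorm _
  exact {
    injective := Subtype.val_injective
    lt_top x := (mixedNorm_eq x.1).symm.trans_lt x.2.2
    norm_eq x := congrArg ENNReal.toReal (mixedNorm_eq x.1)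
    surj f hf := ⟨⟨f, hw.aestronglyMeasurable_mul (continuous_stft g f),
      (mixedNorm_eq f).trans_lt hf⟩, rfl⟩ }

lemma WienerAmalgamSpace.isStftSpace (hw : IsControlledWeight w C k) (g : 𝓢(Rd d, ℂ)) :
    IsStftSpace (fun F => mixedENorm q p volume volume fun z => F z.swap) w g
      (WienerAmalgamSpace.inclusion p q w g) := by
  have mixedNorm_eq (f : 𝓢'(Rd d, ℂ)) : mixedNorm q p (flipMap d (weightedStft w g f)) =
      stftNorm (fun F => mixedENorm q p volume volume fun z => F z.swap) w g f :=
    mixedNorm_eq_mixedENorm _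
  exact {
    injective := Subtype.val_injective
    lt_top x := (mixedNorm_eq x.1).symm.trans_lt x.2.2
    norm_eq x := congrArg ENNReal.toReal (mixedNorm_eq x.1)
    surj f hf := ⟨⟨f, AEStronglyMeasurable.prod_swap
      (hw.aestronglyMeasurable_mul (continuous_stft g f)), (mixedNorm_eq f).trans_lt hf⟩, rfl⟩ }

end Spaces

end

theorem corollary2p2_general (d : ℕ) (p q : ℝ) [Fact (1 ≤ p)] [Fact (1 ≤ q)]
    (w : Rd d × Rd d → ℝ) (hw : IsWeight w) (hw0 : w ≠ 0) (hmod : IsPolynomiallyModerate w)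
    (g : 𝓢(Rd d, ℂ)) (hg : g ≠ 0) :
    (T0Space (ModulationSpace p q w g) ∧ CompleteSpace (ModulationSpace p q w g) ∧
      MetricApproximationProperty (ModulationSpace p q w g)) ∧
    (T0Space (WienerAmalgamSpace p q w g) ∧ CompleteSpace (WienerAmalgamSpace p q w g) ∧
      MetricApproximationProperty (WienerAmalgamSpace p q w g)) := by
  have hp : 1 ≤ p := Fact.out
  have hq : 1 ≤ q := Fact.out
  obtain ⟨C, k, hwC⟩ := exists_isControlledWeight hw hw0 hmod
  have modulation := ModulationSpace.isStftSpace (p := p) (q := q) hwC g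
  have amalgam := WienerAmalgamSpace.isStftSpace (p := p) (q := q) hwC g
  have norm_modulation := admissibleNorm_mixedENorm (d := d) hp hq
  have norm_amalgam := (admissibleNorm_mixedENorm (d := d) hq hp).swap
  exact ⟨⟨modulation.t0Space norm_modulation hwC hg,
      modulation.completeSpace norm_modulation hwC hg,
      modulation.metricApproximationProperty norm_modulation hwC hg⟩,
    amalgam.t0Space norm_amalgam hwC hg, amalgam.completeSpace norm_amalgam hwC hg,
    amalgam.metricApproximationProperty norm_amalgam hwC hg⟩

theorem corollary2p2 (d : ℕ) (p q : ℝ) [Fact (1 ≤ p)] [Fact (1 ≤ q)]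
    (w : Rd d × Rd d → ℝ) (hw : IsWeight w) (hw0 : w ≠ 0)
    (hsub : IsSubmultiplicative w) (hmod : IsPolynomiallyModerate w)
    (g : 𝓢(Rd d, ℂ)) (hg : g ≠ 0) :
    (T0Space (ModulationSpace p q w g) ∧ CompleteSpace (ModulationSpace p q w g) ∧
      MetricApproximationProperty (ModulationSpace p q w g)) ∧
    (T0Space (WienerAmalgamSpace p q w g) ∧ CompleteSpace (WienerAmalgamSpace p q w g) ∧
      MetricApproximationProperty (WienerAmalgamSpace p q w g)) :=
  corollary2p2_general d p q w hw hw0 hmod g hg
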